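/- Let $k$ be an algebraically closed field of characteristic $0$, let $n\ge 1$, and let $\mathfrak g=\mathfrak{gl}(n|n)$ over $k$, with matrix units $e_{ij}$ ($1\le i,j\le 2n$), diagonal Cartan subalgebra $\mathfrak h$, dual basis $\varepsilon_1,\dots,\varepsilon_{2n}$, $\delta_j=\varepsilon_{n+j}$, bilinear form $(\varepsilon_i,\varepsilon_j)=(-1)^{|i|}\delta_{ij}$, and integral weights $\Lambda=\bigoplus_i\mathbb Z\varepsilon_i$. Borel subalgebras with the standard (block upper triangular) even part are labelled by partitions $\beta=(\beta_1\ge\dots\ge\beta_n\ge0)$ with $\beta_1\le n$: in the corresponding $\varepsilon\delta$-sequence, $\varepsilon_i$ is preceded by exactly $\beta_{n+1-i}$ of the symbols $\delta_1,\dots,\delta_n$, and $\varepsilon_a-\varepsilon_c$ is positive if $\varepsilon_a$ comes before $\varepsilon_c$. The upper triangular Borel is $()=(0,\dots,0)$. For $\mathfrak b_{n-1|n-1}=(\beta_1,\dots,\beta_{n-1})$ put $()\star\mathfrak b_{n-1|n-1}=(\beta_1+1,\dots,\beta_{n-1}+1,0)$, a Borel of $\mathfrak{gl}(n|n)$. Let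 $\mathfrak b_{\mathbf o}=(n-1,n-2,\dots,1,0)$ (in any rank $n$). Let $\mathrm{par}:\Lambda\to\mathbb Z/2$ be a function with $\mathrm{par}(0)=0$ and $\mathrm{par}(\lambda+\varepsilon_a-\varepsilon_c)=\mathrm{par}(\lambda)+|a|+|c|$ (such a function is fixed in each rank), and let $M^{\mathfrak b}(\lambda)=\Pi^{\mathrm{par}(\lambda)}\operatorname{Ind}_{\mathfrak b}^{\mathfrak g}k_\lambda$ be the $\mathfrak b$-Verma supermodule of highest weight $\lambda$, where $\Pi$ is the parity shift. For odd $x\in\mathfrak g$ with $[x,x]=0$ let $\operatorname{DS}_x M=\ker x_M/\operatorname{im}x_M$, a supermodule over the Lie superalgebra $\operatorname{DS}_x\mathfrak g=\ker(\operatorname{ad}x)/\operatorname{im}(\operatorname{ad}x)$; for $x=e_{1,n+1}$, the root vector of $\alpha=\varepsilon_1-\delta_1$, write $\operatorname{DS}_{\varepsilon_1-\delta_1}$. Put $I=\{1,n+1\}$ and $J=\{2,\dots,n\}\cup\{n+2,\dots,2n\}$. The inclusion $\mathfrak{gl}(J)\subset\mathfrak g$ induces an isomorphism $\mathfrak{gl}(n-1|n-1)\cong\mathfrak{gl}(J)\cong\operatorname{DS}_{e_{1,n+1}}\mathfrak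 g$, through which $\operatorname{DS}_{\varepsilon_1-\delta_1}M$ is a $\mathfrak{gl}(n-1|n-1)$-supermodule. Let $\operatorname{pr}_I(\lambda)$ and $\operatorname{pr}_J(\lambda)$ be the restrictions of $\lambda$ to the Cartan subalgebras of $\mathfrak{gl}(I)\cong\mathfrak{gl}(1|1)$ and $\mathfrak{gl}(J)\cong\mathfrak{gl}(n-1|n-1)$. Call $\operatorname{pr}_I(\lambda)$ atypical if the simple $\mathfrak{gl}(1|1)$-module $L^{()}(\operatorname{pr}_I(\lambda))$ has nonzero atypicality (the largest number of mutually orthogonal distinct odd roots, modulo sign, that are orthogonal to $\operatorname{pr}_I(\lambda)+\rho^{()}$, where $\rho^{\mathfrak b}=\rho_{\bar0}-\rho_{\bar1}^{\mathfrak b}+\tfrac12(\sum_i\varepsilon_i-\sum_j\delta_j)$ and $\rho_{\bar0}$, $\rho_{\bar1}^{\mathfrak b}$ are the half sums of the even and of the odd positive roots), and typical otherwise. **Theorem.** For every Borel $\mathfrak b_{n-1|n-1}$ of $\mathfrak{gl}(n-1|n-1)$ with standard even part and every $\lambda\in\Lambda$ there is an (even) isomorphism of $\mathfrak{gl}(n-1|n-1)$-supermodules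 $$\operatorname{DS}_{\varepsilon_1-\delta_1}\bigl(M^{()\star\mathfrak b_{n-1|n-1}}(\lambda)\bigr)\cong\begin{cases}M^{\mathfrak b_{n-1|n-1}}(\operatorname{pr}_J(\lambda))\oplus\Pi M^{\mathfrak b_{n-1|n-1}}(\operatorname{pr}_J(\lambda)),&\operatorname{pr}_I(\lambda)\text{ atypical},\\0,&\operatorname{pr}_I(\lambda)\text{ typical}.\end{cases}$$ In particular, $$\operatorname{DS}_{\varepsilon_1-\delta_1}\bigl(M^{\mathfrak b_{\mathbf o}}(\lambda)\bigr)\cong\begin{cases}M^{\mathfrak b_{\mathbf o}}(\operatorname{pr}_J(\lambda))\oplus\Pi M^{\mathfrak b_{\mathbf o}}(\operatorname{pr}_J(\lambda)),&\operatorname{pr}_I(\lambda)\text{ atypical},\\0,&\operatorname{pr}_I(\lambda)\text{ typical},\end{cases}$$ where on the right-hand side $\mathfrak b_{\mathbf o}$ is the Borel of $\mathfrak{gl}(n-1|n-1)$. Moreover, for $\mathfrak b=()\star\mathfrak b_{n-1|n-1}$ the odd root $\alpha=\varepsilon_1-\delta_1$ is $\mathfrak b$-simple, the Borel subalgebra of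 $\mathfrak{gl}(n-1|n-1)\cong\operatorname{DS}_{e_{1,n+1}}\mathfrak g$ that $\mathfrak b$ induces is $\mathfrak b_{n-1|n-1}$, and $\operatorname{pr}_I(\lambda)$ is atypical if and only if $(\lambda,\alpha)=0$. -/

import Mathlib

namespace GLSuper

/-! ## Super vector spaces, Lie superalgebras and their supermodules -/

/-- A super vector space: a vector space with a `ℤ/2`-grading `V = V₀ ⊕ V₁`. -/
class SuperSpace (k V : Type*) [Field k] [AddCommGroup V] [Module k V] where
  part : ZMod 2 → Submodule k V
  isInternal : DirectSum.IsInternal part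

/-- The subspace of homogeneous vectors of parity `i`. -/
abbrev gr (k V : Type*) [Field k] [AddCommGroup V] [Module k V] [SuperSpace k V]
    (i : ZMod 2) : Submodule k V := SuperSpace.part i

/-- The Koszul sign `(-1)^{ij}`. -/
def sgn (k : Type*) [Field k] (i j : ZMod 2) : k := (-1) ^ (i.val * j.val)

/-- A Lie superalgebra over `k` (of characteristic `0`). -/
class LieSuper (k L : Type*) [Field k] [AddCommGroup L] [Module k L] extends
    SuperSpace k L where
  br : L →ₗ[k] L →ₗ[k] L
  br_mem : ∀ {i j : ZMod 2} {x y : L}, x ∈ gr k L i → y ∈ gr k L j → br x y ∈ gr k L (i + j)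
  br_skew : ∀ {i j : ZMod 2} {x y : L}, x ∈ gr k L i → y ∈ gr k L j →
    br x y = -(sgn k i j • br y x)
  br_jacobi : ∀ {i j l : ZMod 2} {x y z : L}, x ∈ gr k L i → y ∈ gr k L j → z ∈ gr k L l →
    br (br x y) z = br x (br y z) - sgn k i j • br y (br x z)

/-- A supermodule over a Lie superalgebra. -/
class LieSuperRep (k L V : Type*) [Field k] [AddCommGroup L] [Module k L] [LieSuper k L]
    [AddCommGroup V] [Module k V] [SuperSpace k V] where
  act : L →ₗ[k] V →ₗ[k] V
  act_mem : ∀ {i j : ZMod 2} {x : L} {v : V}, x ∈ gr k L i → v ∈ gr k V j →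
    act x v ∈ gr k V (i + j)
  act_br : ∀ {i j : ZMod 2} {x y : L} (v : V), x ∈ gr k L i → y ∈ gr k L j →
    act (LieSuper.br (k := k) x y) v = act x (act y v) - sgn k i j • act y (act x v)

/-- The bracket of a Lie superalgebra. -/
abbrev br (k : Type*) {L : Type*} [Field k] [AddCommGroup L] [Module k L] [LieSuper k L] :
    L →ₗ[k] L →ₗ[k] L := LieSuper.br

/-- The action of a Lie superalgebra on a supermodule. -/
abbrev act (k : Type*) {L : Type*} (V : Type*) [Field k] [AddCommGroup L] [Module k L]
    [LieSuper k L] [AddCommGroup V] [Module k V] [SuperSpace k V] [LieSuperRep k L V] :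
    L →ₗ[k] V →ₗ[k] V := LieSuperRep.act

/-- An (even) isomorphism of Lie superalgebras. -/
structure LieSuperEquiv (k L L' : Type*) [Field k] [AddCommGroup L] [Module k L] [LieSuper k L]
    [AddCommGroup L'] [Module k L'] [LieSuper k L'] extends L ≃ₗ[k] L' where
  map_gr : ∀ {i : ZMod 2} {x : L}, x ∈ gr k L i → toLinearEquiv x ∈ gr k L' i
  map_br : ∀ x y : L, toLinearEquiv (br k x y) = br k (toLinearEquiv x) (toLinearEquiv y)

/-- An (even) isomorphism of `L`-supermodules. -/
structure RepEquiv (k L V W : Type*) [Field k] [AddCommGroup L] [Module k L] [LieSuper k L]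
    [AddCommGroup V] [Module k V] [SuperSpace k V] [LieSuperRep k L V]
    [AddCommGroup W] [Module k W] [SuperSpace k W] [LieSuperRep k L W]
    extends V ≃ₗ[k] W where
  map_gr : ∀ {i : ZMod 2} {v : V}, v ∈ gr k V i → toLinearEquiv v ∈ gr k W i
  map_act : ∀ (x : L) (v : V), toLinearEquiv (act k V x v) = act k W x (toLinearEquiv v)

section basics

variable {k V L : Type*} [Field k] [AddCommGroup V] [Module k V] [AddCommGroup L] [Module k L]

theorem sgn_zero_left (j : ZMod 2) : sgn k 0 j = 1 := by simp [sgn]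
theorem sgn_zero_right (j : ZMod 2) : sgn k j 0 = 1 := by simp [sgn]
theorem sgn_one_one : sgn k 1 1 = -1 := by simp [sgn, ZMod.val_one]

theorem zmod_two_cases (i : ZMod 2) : i = 0 ∨ i = 1 := by
  revert i; decide

/-- Build a super vector space from two complementary subspaces. -/
theorem isInternal_of (p : ZMod 2 → Submodule k V)
    (hex : ∀ v, ∃ a ∈ p 0, ∃ b ∈ p 1, v = a + b)
    (huniq : ∀ a ∈ p 0, ∀ b ∈ p 1, a + b = 0 → a = 0) : DirectSum.IsInternal p := by
  have huniv : (Set.univ : Set (ZMod 2)) = {0, 1} := by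
    ext i; rcases zmod_two_cases i with rfl | rfl <;> simp
  rw [DirectSum.isInternal_submodule_iff_isCompl p (i := 0) (j := 1) (by decide) huniv]
  constructor
  · rw [Submodule.disjoint_def]
    intro v h0 h1
    exact huniq v h0 (-v) ((p 1).neg_mem h1) (by simp)
  · rw [codisjoint_iff, Submodule.eq_top_iff']
    intro v
    obtain ⟨a, ha, b, hb, rfl⟩ := hex v
    exact Submodule.add_mem_sup ha hb

variable [SuperSpace k V]

theorem isCompl_gr : IsCompl (gr k V 0) (gr k V 1) := by
  have huniv : (Set.univ : Set (ZMod 2)) = {0, 1} := by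
    ext i; rcases zmod_two_cases i with rfl | rfl <;> simp
  exact (DirectSum.isInternal_submodule_iff_isCompl _ (i := 0) (j := 1) (by decide) huniv).1
    SuperSpace.isInternal

theorem exists_decomp (k : Type*) [Field k] [Module k V] [SuperSpace k V] (v : V) :
    ∃ a ∈ gr k V 0, ∃ b ∈ gr k V 1, v = a + b := by
  have h : v ∈ gr k V 0 ⊔ gr k V 1 := by rw [isCompl_gr.sup_eq_top]; trivial
  obtain ⟨a, ha, b, hb, h⟩ := Submodule.mem_sup.1 h
  exact ⟨a, ha, b, hb, h.symm⟩

theorem eq_zero_left {a b : V} (ha : a ∈ gr k V 0) (hb : b ∈ gr k V 1) (h : a + b = 0) :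
    a = 0 := by
  have hab : a = -b := eq_neg_of_add_eq_zero_left h
  exact Submodule.disjoint_def.1 (isCompl_gr (k := k) (V := V)).disjoint a ha
    (hab ▸ (gr k V 1).neg_mem hb)

theorem eq_zero_right {a b : V} (ha : a ∈ gr k V 0) (hb : b ∈ gr k V 1) (h : a + b = 0) :
    b = 0 := by
  have h0 := eq_zero_left ha hb h
  simpa [h0] using h

/-- The parity involution `v ↦ (-1)^{|v|} v`. -/
noncomputable def pinv (k V : Type*) [Field k] [AddCommGroup V] [Module k V] [SuperSpace k V] :
    V →ₗ[k] V :=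
  LinearMap.ofIsCompl (isCompl_gr (k := k) (V := V)) (gr k V 0).subtype (-(gr k V 1).subtype)

theorem pinv_zero {v : V} (h : v ∈ gr k V 0) : pinv k V v = v := by
  have := LinearMap.ofIsCompl_apply_left (isCompl_gr (k := k) (V := V))
    (φ := (gr k V 0).subtype) (ψ := -(gr k V 1).subtype) ⟨v, h⟩
  simpa [pinv] using this

theorem pinv_one {v : V} (h : v ∈ gr k V 1) : pinv k V v = -v := by
  have := LinearMap.ofIsCompl_apply_right (isCompl_gr (k := k) (V := V))
    (φ := (gr k V 0).subtype) (ψ := -(gr k V 1).subtype) ⟨v, h⟩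
  simpa [pinv] using this

theorem pinv_gr {i : ZMod 2} {v : V} (h : v ∈ gr k V i) : pinv k V v = sgn k 1 i • v := by
  rcases zmod_two_cases i with rfl | rfl
  · simp [pinv_zero h, sgn_zero_right]
  · simp [pinv_one h, sgn_one_one]

theorem pinv_pinv (v : V) : pinv k V (pinv k V v) = v := by
  obtain ⟨a, ha, b, hb, rfl⟩ := exists_decomp k v
  simp [pinv_zero ha, pinv_one hb]

end basics

/-! ## Constructions on supermodules -/

section constructions

variable {k L V W : Type*} [Field k] [AddCommGroup L] [Module k L] [LieSuper k L]
  [AddCommGroup V] [Module k V] [SuperSpace k V] [LieSuperRep k L V]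
  [AddCommGroup W] [Module k W] [SuperSpace k W] [LieSuperRep k L W]

/-- The adjoint supermodule. -/
instance adjointRep : LieSuperRep k L L where
  act := br k
  act_mem := LieSuper.br_mem
  act_br := by
    intro i j x y v hx hy
    obtain ⟨a, ha, b, hb, rfl⟩ := exists_decomp k v
    simp only [map_add, LieSuper.br_jacobi hx hy ha, LieSuper.br_jacobi hx hy hb, smul_add]
    abel

/-- The parity shift `Π^p V`: the same vector space with the same action and with parities shifted
by `p`; so `PShift 1 V` is `Π V`. (The convention with `x · v = (-1)^{|x|} x v` on `Π V` gives an
isomorphic supermodule, through `v ↦ (-1)^{|v|} v`.) -/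
def PShift (_p : ZMod 2) (V : Type*) : Type _ := V

instance (p : ZMod 2) : AddCommGroup (PShift p V) := inferInstanceAs (AddCommGroup V)
instance (p : ZMod 2) : Module k (PShift p V) := inferInstanceAs (Module k V)

instance (p : ZMod 2) : SuperSpace k (PShift p V) where
  part i := (gr k V (i + p) : Submodule k V)
  isInternal := by
    refine isInternal_of (k := k) (V := V) (fun i => gr k V (i + p)) ?_ ?_
    · intro v
      obtain ⟨a, ha, b, hb, rfl⟩ := exists_decomp k v
      rcases zmod_two_cases p with rfl | rfl
      · exact ⟨a, by simpa using ha, b, by simpa using hb, rfl⟩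
      · exact ⟨b, by simpa using hb, a, by simpa [show (1 + 1 : ZMod 2) = 0 by decide] using ha,
          add_comm _ _⟩
    · intro a ha b hb h
      rcases zmod_two_cases p with rfl | rfl
      · exact eq_zero_left (k := k) (by simpa using ha) (by simpa using hb) h
      · exact eq_zero_right (k := k) (a := b) (b := a)
          (by simpa [show (1 + 1 : ZMod 2) = 0 by decide] using hb)
          (by simpa using ha) (by rw [add_comm]; exact h)

instance (p : ZMod 2) : LieSuperRep k L (PShift p V) where
  act := (act k V : L →ₗ[k] V →ₗ[k] V)
  act_mem := by
    intro i j x v hx hv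
    have h := LieSuperRep.act_mem (k := k) (L := L) (V := V) (i := i) (j := j + p) hx hv
    rw [← add_assoc] at h
    exact h
  act_br := fun v hx hy => LieSuperRep.act_br (k := k) (L := L) (V := V) v hx hy

/-- The direct sum `V ⊕ W`, as a super vector space. -/
instance : SuperSpace k (V × W) where
  part i := (gr k V i).prod (gr k W i)
  isInternal := by
    refine isInternal_of _ ?_ ?_
    · rintro ⟨v, w⟩
      obtain ⟨a, ha, b, hb, rfl⟩ := exists_decomp k v
      obtain ⟨c, hc, d, hd, rfl⟩ := exists_decomp k w
      exact ⟨(a, c), ⟨ha, hc⟩, (b, d), ⟨hb, hd⟩, rfl⟩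
    · rintro ⟨a, c⟩ ⟨ha, hc⟩ ⟨b, d⟩ ⟨hb, hd⟩ h
      rw [Prod.ext_iff] at h ⊢
      exact ⟨eq_zero_left ha hb h.1, eq_zero_left hc hd h.2⟩

/-- The direct sum `V ⊕ W` of two supermodules. -/
instance : LieSuperRep k L (V × W) where
  act := LinearMap.mk₂ k (fun x v => (act k V x v.1, act k W x v.2))
    (by intros; simp) (by intros; simp) (by intros; simp) (by intros; simp)
  act_mem := fun hx hv =>
    ⟨LieSuperRep.act_mem hx hv.1, LieSuperRep.act_mem hx hv.2⟩
  act_br := fun v hx hy =>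
    Prod.ext (LieSuperRep.act_br v.1 hx hy) (LieSuperRep.act_br v.2 hx hy)

/-- The restriction of an `L'`-supermodule `V` along an isomorphism `e : L ≃ L'`. -/
def Pull {k L L' : Type*} [Field k] [AddCommGroup L] [Module k L] [LieSuper k L]
    [AddCommGroup L'] [Module k L'] [LieSuper k L'] (_e : LieSuperEquiv k L L')
    (V : Type*) : Type _ := V

section pull

variable {L' : Type*} [AddCommGroup L'] [Module k L'] [LieSuper k L'] (e : LieSuperEquiv k L' L)

instance : AddCommGroup (Pull e V) := inferInstanceAs (AddCommGroup V)
instance : Module k (Pull e V) := inferInstanceAs (Module k V)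
instance : SuperSpace k (Pull e V) := inferInstanceAs (SuperSpace k V)
instance : LieSuperRep k L' (Pull e V) where
  act := (act k V).comp (e.toLinearEquiv : L' →ₗ[k] L)
  act_mem := fun hx hv => LieSuperRep.act_mem (k := k) (L := L) (V := V) (e.map_gr hx) hv
  act_br := by
    intro i j x y v hx hy
    have h := LieSuperRep.act_br (k := k) (L := L) (V := V) v (e.map_gr hx) (e.map_gr hy)
    rw [← e.map_br] at h
    exact h

end pull

end constructions

/-! ## The Duflo–Serganova functor -/

/-- The odd elements `x` with `[x, x] = 0`. -/
structure OddSqZero (k L : Type*) [Field k] [AddCommGroup L] [Module k L] [LieSuper k L] where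
  val : L
  odd : val ∈ gr k L 1
  sq : br k val val = 0

section DS

variable {k L : Type*} [Field k] [AddCommGroup L] [Module k L] [LieSuper k L]
  (x : OddSqZero k L) (V : Type*) [AddCommGroup V] [Module k V] [SuperSpace k V]
  [LieSuperRep k L V]

/-- `DS_x V = ker x_V / im x_V`, where `x_V` is the action of `x` on `V`; for `V = L`, the adjoint
module, this is `L_x = DS_x L`. -/
def DS : Type _ :=
  LinearMap.ker (act k V x.val) ⧸
    (LinearMap.range (act k V x.val)).submoduleOf (LinearMap.ker (act k V x.val))

instance : AddCommGroup (DS x V) := by unfold DS; infer_instance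
instance : Module k (DS x V) := by unfold DS; infer_instance

/-- The class in `DS_x V` of an element of `ker x_V`. -/
def DS.mk : LinearMap.ker (act k V x.val) →ₗ[k] DS x V := Submodule.mkQ _

variable {V}

theorem DS.mk_surjective : Function.Surjective (DS.mk x V) := Submodule.mkQ_surjective _

theorem DS.mk_eq_zero (v : LinearMap.ker (act k V x.val)) :
    DS.mk x V v = 0 ↔ ∃ w : V, act k V x.val w = v := by
  exact (Submodule.Quotient.mk_eq_zero _).trans Iff.rfl

theorem mem_ker_parts {a b : V} (ha : a ∈ gr k V 0) (hb : b ∈ gr k V 1)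
    (h : act k V x.val (a + b) = 0) : act k V x.val a = 0 ∧ act k V x.val b = 0 := by
  have h1 : act k V x.val a ∈ gr k V 1 := by
    simpa using LieSuperRep.act_mem (k := k) (V := V) x.odd ha
  have h0 : act k V x.val b ∈ gr k V 0 := by
    simpa [show (1 + 1 : ZMod 2) = 0 by decide] using
      LieSuperRep.act_mem (k := k) (V := V) x.odd hb
  rw [map_add, add_comm] at h
  exact ⟨eq_zero_right h0 h1 h, eq_zero_left h0 h1 h⟩

/-- Parity on `DS_x V` is induced by the parity of `V`. -/
instance : SuperSpace k (DS x V) where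
  part i := ((gr k V i).comap (LinearMap.ker (act k V x.val)).subtype).map (DS.mk x V)
  isInternal := by
    refine isInternal_of _ ?_ ?_
    · intro v
      obtain ⟨⟨v, hv⟩, rfl⟩ := DS.mk_surjective x v
      obtain ⟨a, ha, b, hb, rfl⟩ := exists_decomp k v
      obtain ⟨h0, h1⟩ := mem_ker_parts x ha hb hv
      exact ⟨_, ⟨⟨a, h0⟩, ha, rfl⟩, _, ⟨⟨b, h1⟩, hb, rfl⟩, by rw [← map_add]; rfl⟩
    · rintro _ ⟨⟨a, ha'⟩, ha, rfl⟩ _ ⟨⟨b, hb'⟩, hb, rfl⟩ h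
      rw [← map_add, DS.mk_eq_zero] at h
      rw [DS.mk_eq_zero]
      obtain ⟨w, hw⟩ := h
      obtain ⟨c, hc, d, hd, rfl⟩ := exists_decomp k w
      have h1 : act k V x.val c ∈ gr k V 1 := by
        simpa using LieSuperRep.act_mem (k := k) (V := V) x.odd hc
      have h0 : act k V x.val d ∈ gr k V 0 := by
        simpa [show (1 + 1 : ZMod 2) = 0 by decide] using
          LieSuperRep.act_mem (k := k) (V := V) x.odd hd
      refine ⟨d, sub_eq_zero.1 (eq_zero_left (k := k) (b := act k V x.val c - b)
        ((gr k V 0).sub_mem h0 ha) ((gr k V 1).sub_mem h1 hb) ?_)⟩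
      have hw' : act k V x.val c + act k V x.val d = a + b := by rw [← map_add]; exact hw
      calc _ = (act k V x.val c + act k V x.val d) - (a + b) := by abel
        _ = 0 := by rw [hw', sub_self]

theorem mem_gr_DS {i : ZMod 2} {v : DS x V} : v ∈ gr k (DS x V) i ↔
    ∃ w : LinearMap.ker (act k V x.val), (w : V) ∈ gr k V i ∧ DS.mk x V w = v := Iff.rfl

/-- `x A v = [x, A] v + (-1)^{|A|} A x v`. -/
theorem act_act (A : L) (v : V) : act k V x.val (act k V A v) =
    act k V (br k x.val A) v + act k V (pinv k L A) (act k V x.val v) := by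
  obtain ⟨a, ha, b, hb, rfl⟩ := exists_decomp k A
  have h0 := LieSuperRep.act_br (k := k) (V := V) v x.odd ha
  have h1 := LieSuperRep.act_br (k := k) (V := V) v x.odd hb
  simp only [map_add, LinearMap.add_apply, pinv_zero ha, pinv_one hb, h0, h1, sgn_zero_right,
    sgn_one_one, one_smul, map_neg, LinearMap.neg_apply, neg_smul]
  abel

theorem br_pinv (A : L) (h : br k x.val A = 0) : br k x.val (pinv k L A) = 0 := by
  obtain ⟨a, ha, b, hb, rfl⟩ := exists_decomp k A
  obtain ⟨h0, h1⟩ := mem_ker_parts (V := L) x ha hb h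
  have h0' : br k x.val a = 0 := h0
  have h1' : br k x.val b = 0 := h1
  simp [pinv_zero ha, pinv_one hb, h0', h1']

/-- An element of `ker (ad x)` acts on `ker x_V`. -/
def kerAct : LinearMap.ker (act k L x.val) →ₗ[k]
    LinearMap.ker (act k V x.val) →ₗ[k] LinearMap.ker (act k V x.val) :=
  LinearMap.mk₂ k
    (fun A v => ⟨act k V A.1 v.1, by
      have hA : br k x.val A.1 = 0 := A.2
      have hv : act k V x.val v.1 = 0 := v.2
      simp [LinearMap.mem_ker, act_act x A.1 v.1, hA, hv]⟩)
    (by intros; ext; simp) (by intros; ext; simp) (by intros; ext; simp) (by intros; ext; simp)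

theorem kerAct_left_exact (A : LinearMap.ker (act k L x.val)) (hA : DS.mk x L A = 0)
    (v : LinearMap.ker (act k V x.val)) : DS.mk x V (kerAct x A v) = 0 := by
  obtain ⟨B, hB⟩ := (DS.mk_eq_zero x A).1 hA
  refine (DS.mk_eq_zero x _).2 ⟨act k V B v.1, ?_⟩
  have hv : act k V x.val v.1 = 0 := v.2
  have hB' : br k x.val B = A.1 := hB
  rw [act_act x B v.1, hv, hB', map_zero, add_zero]
  rfl

theorem kerAct_right_exact (A : LinearMap.ker (act k L x.val))
    (v : LinearMap.ker (act k V x.val)) (hv : DS.mk x V v = 0) :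
    DS.mk x V (kerAct x A v) = 0 := by
  obtain ⟨w, hw⟩ := (DS.mk_eq_zero x v).1 hv
  refine (DS.mk_eq_zero x _).2 ⟨act k V (pinv k L A.1) w, ?_⟩
  have h := act_act x (pinv k L A.1) w
  have hA : br k x.val A.1 = 0 := A.2
  rw [br_pinv x A.1 hA, pinv_pinv, hw] at h
  rw [h]
  simp only [map_zero, LinearMap.zero_apply, zero_add]
  rfl

/-- The action of `ker (ad x)` on `DS_x V`. -/
def DS.preAction : LinearMap.ker (act k L x.val) →ₗ[k] DS x V →ₗ[k] DS x V where
  toFun A := Submodule.liftQ _ ((DS.mk x V).comp (kerAct x A)) fun v hv =>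
    kerAct_right_exact x A v ((Submodule.Quotient.mk_eq_zero _).2 hv)
  map_add' A B := by
    refine LinearMap.ext fun v => ?_
    obtain ⟨v, rfl⟩ := DS.mk_surjective x v
    change DS.mk x V (kerAct x (A + B) v) = DS.mk x V (kerAct x A v) + DS.mk x V (kerAct x B v)
    rw [map_add, LinearMap.add_apply, map_add]
  map_smul' c A := by
    refine LinearMap.ext fun v => ?_
    obtain ⟨v, rfl⟩ := DS.mk_surjective x v
    change DS.mk x V (kerAct x (c • A) v) = c • DS.mk x V (kerAct x A v)
    rw [map_smul, LinearMap.smul_apply, map_smul]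

/-- The action of `DS_x L` on `DS_x V`, induced by the action of `L` on `V`. -/
def DS.action : DS x L →ₗ[k] DS x V →ₗ[k] DS x V :=
  Submodule.liftQ _ (DS.preAction x) fun A hA => LinearMap.ext fun v => by
    obtain ⟨v, rfl⟩ := DS.mk_surjective x v
    exact kerAct_left_exact x A ((Submodule.Quotient.mk_eq_zero _).2 hA) v

theorem DS.action_mk (A : LinearMap.ker (act k L x.val)) (v : LinearMap.ker (act k V x.val)) :
    DS.action x (DS.mk x L A) (DS.mk x V v) = DS.mk x V (kerAct x A v) := rfl

/-- The Lie superalgebra `L_x = DS_x L`. -/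
instance : LieSuper k (DS x L) where
  br := DS.action x
  br_mem := by
    rintro i j _ _ ⟨A, hA, rfl⟩ ⟨B, hB, rfl⟩
    exact ⟨kerAct x A B, LieSuper.br_mem (k := k) hA hB, rfl⟩
  br_skew := by
    rintro i j _ _ ⟨A, hA, rfl⟩ ⟨B, hB, rfl⟩
    rw [DS.action_mk, DS.action_mk, ← map_smul, ← map_neg]
    exact congrArg _ (Subtype.ext (LieSuper.br_skew (k := k) hA hB))
  br_jacobi := by
    rintro i j l _ _ _ ⟨A, hA, rfl⟩ ⟨B, hB, rfl⟩ ⟨C, hC, rfl⟩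
    rw [DS.action_mk, DS.action_mk, DS.action_mk, DS.action_mk, DS.action_mk, DS.action_mk,
      ← map_smul, ← map_sub]
    exact congrArg _ (Subtype.ext (LieSuper.br_jacobi (k := k) hA hB hC))

/-- `DS_x V` is a supermodule over `DS_x L`. -/
instance : LieSuperRep k (DS x L) (DS x V) where
  act := DS.action x
  act_mem := by
    rintro i j _ _ ⟨A, hA, rfl⟩ ⟨v, hv, rfl⟩
    exact ⟨kerAct x A v, LieSuperRep.act_mem (k := k) hA hv, rfl⟩
  act_br := by
    rintro i j _ _ v ⟨A, hA, rfl⟩ ⟨B, hB, rfl⟩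
    obtain ⟨v, rfl⟩ := DS.mk_surjective x v
    have h : LieSuper.br (k := k) (DS.mk x L A) (DS.mk x L B) = DS.mk x L (kerAct x A B) := rfl
    rw [h]
    rw [DS.action_mk, DS.action_mk, DS.action_mk, DS.action_mk, DS.action_mk, ← map_smul,
      ← map_sub]
    exact congrArg _ (Subtype.ext (LieSuperRep.act_br (k := k) (V := V) v.1 hA hB))

end DS

/-! ## The universal enveloping superalgebra -/

section UEA

variable (k L : Type*) [Field k] [AddCommGroup L] [Module k L] [LieSuper k L]

/-- The defining relations `x y - (-1)^{|x||y|} y x = [x, y]` of the enveloping superalgebra. -/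
inductive UEA.Rel : TensorAlgebra k L → TensorAlgebra k L → Prop
  | bracket {i j : ZMod 2} {x y : L} (hx : x ∈ gr k L i) (hy : y ∈ gr k L j) :
      UEA.Rel (TensorAlgebra.ι k x * TensorAlgebra.ι k y -
        sgn k i j • (TensorAlgebra.ι k y * TensorAlgebra.ι k x)) (TensorAlgebra.ι k (br k x y))

/-- The universal enveloping superalgebra `U(L)`. -/
def UEA : Type _ := RingQuot (UEA.Rel k L)

noncomputable instance : Ring (UEA k L) := inferInstanceAs (Ring (RingQuot (UEA.Rel k L)))
noncomputable instance : Algebra k (UEA k L) :=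
  inferInstanceAs (Algebra k (RingQuot (UEA.Rel k L)))

/-- The canonical map `L → U(L)`. -/
noncomputable def UEA.ι : L →ₗ[k] UEA k L :=
  (RingQuot.mkAlgHom k (UEA.Rel k L)).toLinearMap.comp (TensorAlgebra.ι k)

variable {k L}

theorem UEA.ι_br {i j : ZMod 2} {x y : L} (hx : x ∈ gr k L i) (hy : y ∈ gr k L j) :
    UEA.ι k L (br k x y) = UEA.ι k L x * UEA.ι k L y - sgn k i j • (UEA.ι k L y * UEA.ι k L x) := by
  have h := RingQuot.mkAlgHom_rel k (UEA.Rel.bracket hx hy)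
  rw [map_sub, map_smul, map_mul, map_mul] at h
  exact h.symm

/-- The parity automorphism of `U(L)`, extending `x ↦ (-1)^{|x|} x`. -/
noncomputable def UEA.parity : UEA k L →ₐ[k] UEA k L :=
  RingQuot.liftAlgHom k ⟨TensorAlgebra.lift k ((UEA.ι k L).comp (pinv k L)), by
    rintro _ _ ⟨hx, hy⟩
    rename_i i j x y
    simp only [map_sub, map_smul, map_mul, TensorAlgebra.lift_ι_apply, LinearMap.comp_apply,
      pinv_gr hx, pinv_gr hy, pinv_gr (LieSuper.br_mem (k := k) hx hy), UEA.ι_br hx hy]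
    have hs : sgn k 1 (i + j) = sgn k 1 i * sgn k 1 j := by
      rcases zmod_two_cases i with rfl | rfl <;> rcases zmod_two_cases j with rfl | rfl <;>
        simp [sgn_zero_right, sgn_one_one, show (1 + 1 : ZMod 2) = 0 by decide]
    simp only [hs, smul_mul_smul_comm, smul_sub, smul_smul]
    congr 2
    ring⟩

theorem UEA.parity_ι (x : L) : UEA.parity (UEA.ι k L x) = UEA.ι k L (pinv k L x) := by
  refine (RingQuot.liftAlgHom_mkAlgHom_apply k _ _ _).trans ?_
  simp

theorem UEA.parity_parity (u : UEA k L) : UEA.parity (UEA.parity u) = u := by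
  have h : (UEA.parity.comp UEA.parity : UEA k L →ₐ[k] UEA k L) = AlgHom.id k _ := by
    refine RingQuot.ringQuot_ext' k (UEA.parity.comp UEA.parity) (AlgHom.id k _) ?_
    refine TensorAlgebra.hom_ext ?_
    refine LinearMap.ext fun x => ?_
    change UEA.parity (UEA.parity (UEA.ι k L x)) = UEA.ι k L x
    rw [UEA.parity_ι, UEA.parity_ι, pinv_pinv]
  exact congrArg (fun f => f u) h

variable [CharZero k]

/-- The grading of `U(L)`: parity `i` is the `(-1)^i`-eigenspace of the parity automorphism, that
is, the span of the products of homogeneous elements of `L` whose parities add up to `i`. -/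
noncomputable instance : SuperSpace k (UEA k L) where
  part i := LinearMap.ker (UEA.parity.toLinearMap - sgn k 1 i • (LinearMap.id : UEA k L →ₗ[k] _))
  isInternal := by
    refine isInternal_of _ ?_ ?_
    · intro u
      refine ⟨(2⁻¹ : k) • (u + UEA.parity u), ?_, (2⁻¹ : k) • (u - UEA.parity u), ?_, ?_⟩
      · simp [sgn_zero_right, UEA.parity_parity, add_comm]
      · simp [sgn_one_one, UEA.parity_parity]
      · rw [← smul_add, add_add_sub_cancel, ← two_smul k u, smul_smul, inv_mul_cancel₀ two_ne_zero,
          one_smul]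
    · intro a ha b hb h
      have ha' : UEA.parity a = a := by
        simpa [sgn_zero_right, sub_eq_zero] using ha
      have hb' : UEA.parity b = -b := by
        simpa [sgn_one_one, add_eq_zero_iff_eq_neg] using hb
      have h2 := congrArg UEA.parity h
      rw [map_add, ha', hb', map_zero, ← sub_eq_add_neg] at h2
      have h3 : (2 : k) • a = 0 := by
        rw [two_smul]
        calc a + a = (a + b) + (a - b) := by abel
          _ = 0 := by rw [h, h2, add_zero]
      simpa using h3

theorem UEA.mem_gr {i : ZMod 2} {u : UEA k L} :
    u ∈ gr k (UEA k L) i ↔ UEA.parity u = sgn k 1 i • u := by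
  change u ∈ LinearMap.ker _ ↔ _
  simp [sub_eq_zero]

theorem UEA.mul_mem {i j : ZMod 2} {u v : UEA k L} (hu : u ∈ gr k (UEA k L) i)
    (hv : v ∈ gr k (UEA k L) j) : u * v ∈ gr k (UEA k L) (i + j) := by
  rw [UEA.mem_gr] at *
  have hs : sgn k 1 (i + j) = sgn k 1 i * sgn k 1 j := by
    rcases zmod_two_cases i with rfl | rfl <;> rcases zmod_two_cases j with rfl | rfl <;>
      simp [sgn_zero_right, sgn_one_one, show (1 + 1 : ZMod 2) = 0 by decide]
  rw [map_mul, hu, hv, hs, smul_mul_smul_comm]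

theorem UEA.ι_mem {i : ZMod 2} {x : L} (hx : x ∈ gr k L i) : UEA.ι k L x ∈ gr k (UEA k L) i := by
  rw [UEA.mem_gr, UEA.parity_ι, pinv_gr hx, map_smul]

end UEA

/-! ## The Lie superalgebra `𝔤𝔩(n|n)` -/

/-- The indices `1, …, n` (`Sum.inl`) and `n + 1, …, 2n` (`Sum.inr`). -/
abbrev Ix (n : ℕ) : Type := Fin n ⊕ Fin n

/-- The parity `|a|` of an index. -/
def ipar {n : ℕ} : Ix n → ZMod 2
  | Sum.inl _ => 0
  | Sum.inr _ => 1

/-- The underlying vector space of `𝔤𝔩(n|n)`, with basis the matrix units `e_{ac}`. -/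
abbrev gl (k : Type*) (n : ℕ) : Type _ := Matrix (Ix n) (Ix n) k

section gl

variable {k : Type*} [Field k] {n : ℕ}

/-- The odd part of a matrix, the even part being `A - oddPart A`. -/
def oddPart (A : gl k n) : gl k n :=
  Matrix.of fun a c => if ipar a + ipar c = 1 then A a c else 0

/-- `e_{ac}` has parity `|a| + |c|`. -/
instance : SuperSpace k (gl k n) where
  part i :=
    { carrier := {A | ∀ a c, ipar a + ipar c ≠ i → A a c = 0}
      add_mem' := by
        intro A B hA hB a c h
        simp [hA a c h, hB a c h]
      zero_mem' := by intro a c _; rfl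
      smul_mem' := by
        intro t A hA a c h
        simp [hA a c h] }
  isInternal := by
    refine isInternal_of _ ?_ ?_
    · intro A
      refine ⟨A - oddPart A, ?_, oddPart A, ?_, by simp⟩
      · intro a c h
        have h1 := (zmod_two_cases (ipar a + ipar c)).resolve_left h
        simp [oddPart, h1]
      · intro a c h
        simp [oddPart, h]
    · intro A hA B hB h
      ext a c
      rcases zmod_two_cases (ipar a + ipar c) with h0 | h0
      · have := congrFun (congrFun h a) c
        have hB' := hB a c (by rw [h0]; decide)
        simpa [hB'] using this
      · exact hA a c (by rw [h0]; decide)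

theorem gl_mem {i : ZMod 2} {A : gl k n} :
    A ∈ gr k (gl k n) i ↔ ∀ a c, ipar a + ipar c ≠ i → A a c = 0 := Iff.rfl

theorem oddPart_zero {A : gl k n} (h : A ∈ gr k (gl k n) 0) : oddPart A = 0 := by
  ext a c
  by_cases h1 : ipar a + ipar c = 1
  · simp [oddPart, h a c (by rw [h1]; decide)]
  · simp [oddPart, h1]

theorem oddPart_one {A : gl k n} (h : A ∈ gr k (gl k n) 1) : oddPart A = A := by
  ext a c
  by_cases h1 : ipar a + ipar c = 1
  · simp [oddPart, h1]
  · simp [oddPart, h1, h a c h1]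

theorem gl_mul_mem {i j : ZMod 2} {A B : gl k n} (hA : A ∈ gr k (gl k n) i)
    (hB : B ∈ gr k (gl k n) j) : A * B ∈ gr k (gl k n) (i + j) := by
  intro a c h
  rw [Matrix.mul_apply]
  refine Finset.sum_eq_zero fun d _ => ?_
  by_cases h1 : ipar a + ipar d = i
  · by_cases h2 : ipar d + ipar c = j
    · refine absurd ?_ h
      rw [← h1, ← h2]
      have : ∀ p q r : ZMod 2, p + r = p + q + (q + r) := by decide
      exact this _ _ _
    · rw [hB d c h2, mul_zero]
  · rw [hA a d h1, zero_mul]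

/-- The supercommutator. It is the bilinear map with `[A, B] = AB - (-1)^{|A||B|} BA` for
homogeneous `A` and `B`. -/
def superComm : gl k n →ₗ[k] gl k n →ₗ[k] gl k n :=
  LinearMap.mk₂ k (fun A B => A * B - B * A + (2 : k) • (oddPart B * oddPart A))
    (by
      intro A A' B
      have h : oddPart (A + A') = oddPart A + oddPart A' := by
        ext a c; simp only [oddPart, Matrix.of_apply, Matrix.add_apply]; split_ifs <;> simp
      simp only [h, add_mul, mul_add, smul_add]; abel)
    (by
      intro t A B
      have h : oddPart (t • A) = t • oddPart A := by
        ext a c; simp [oddPart]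
      simp only [h, smul_mul_assoc, mul_smul_comm, smul_add, smul_sub, smul_comm t (2 : k)])
    (by
      intro A B B'
      have h : oddPart (B + B') = oddPart B + oddPart B' := by
        ext a c; simp only [oddPart, Matrix.of_apply, Matrix.add_apply]; split_ifs <;> simp
      simp only [h, add_mul, mul_add, smul_add]; abel)
    (by
      intro t A B
      have h : oddPart (t • B) = t • oddPart B := by
        ext a c; simp [oddPart]
      simp only [h, smul_mul_assoc, mul_smul_comm, smul_add, smul_sub, smul_comm t (2 : k)])

theorem superComm_eq {i j : ZMod 2} {A B : gl k n} (hA : A ∈ gr k (gl k n) i)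
    (hB : B ∈ gr k (gl k n) j) : superComm A B = A * B - sgn k i j • (B * A) := by
  have h : superComm A B = A * B - B * A + (2 : k) • (oddPart B * oddPart A) := rfl
  rw [h]
  rcases zmod_two_cases i with rfl | rfl
  · simp [oddPart_zero hA, sgn_zero_left]
  · rcases zmod_two_cases j with rfl | rfl
    · simp [oddPart_zero hB, sgn_zero_right]
    · rw [oddPart_one hA, oddPart_one hB, sgn_one_one, two_smul]
      simp only [neg_smul, one_smul]
      abel

theorem superComm_mem {i j : ZMod 2} {A B : gl k n} (hA : A ∈ gr k (gl k n) i)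
    (hB : B ∈ gr k (gl k n) j) : superComm A B ∈ gr k (gl k n) (i + j) := by
  rw [superComm_eq hA hB]
  exact Submodule.sub_mem _ (gl_mul_mem hA hB)
    (Submodule.smul_mem _ _ (add_comm j i ▸ gl_mul_mem hB hA))

theorem sgn_add_left (i j l : ZMod 2) : sgn k (i + j) l = sgn k i l * sgn k j l := by
  rcases zmod_two_cases i with rfl | rfl <;> rcases zmod_two_cases j with rfl | rfl <;>
    rcases zmod_two_cases l with rfl | rfl <;>
    simp [sgn_zero_right, sgn_zero_left, sgn_one_one, show (1 + 1 : ZMod 2) = 0 by decide]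

theorem sgn_comm (i j : ZMod 2) : sgn k i j = sgn k j i := by
  simp [sgn, mul_comm]

theorem sgn_mul_self (i j : ZMod 2) : sgn k i j * sgn k i j = 1 := by
  rcases zmod_two_cases i with rfl | rfl <;> rcases zmod_two_cases j with rfl | rfl <;>
    simp [sgn_zero_right, sgn_zero_left, sgn_one_one]

/-- The Lie superalgebra `𝔤𝔩(n|n)`. -/
instance : LieSuper k (gl k n) where
  br := superComm
  br_mem := superComm_mem
  br_skew := by
    intro i j A B hA hB
    rw [superComm_eq hA hB, superComm_eq hB hA, smul_sub, smul_smul, sgn_comm j i, sgn_mul_self,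
      one_smul]
    abel
  br_jacobi := by
    intro i j l A B C hA hB hC
    rw [superComm_eq (superComm_mem hA hB) hC, superComm_eq hA (superComm_mem hB hC),
      superComm_eq hB (superComm_mem hA hC), superComm_eq hA hB, superComm_eq hB hC,
      superComm_eq hA hC]
    simp only [sub_mul, mul_sub, smul_sub, smul_smul, smul_mul_assoc, mul_smul_comm, mul_assoc,
      sgn_add_left, sgn_comm i (j + l), sgn_comm j (i + l), sgn_comm l, sgn_comm j i]
    have h := sgn_mul_self (k := k) i j
    have e2 : sgn k i j * (sgn k i j * (sgn k j l * sgn k i l)) = sgn k i l * sgn k j l := by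
      rw [← mul_assoc, h, one_mul, mul_comm]
    have e3 : sgn k i l * (sgn k j l * sgn k i j) = sgn k i j * (sgn k i l * sgn k j l) := by
      ring
    have e1 : sgn k i j * (sgn k i j * sgn k j l) = sgn k j l := by rw [← mul_assoc, h, one_mul]
    simp only [e1, e2, e3]
    abel

end gl

/-! ## Weights, positive systems and Borel subalgebras -/

/-- The integral weights `∑ λ_a ε_a`, where `δ_j = ε_{n+j}`. -/
abbrev Wt (n : ℕ) : Type := Ix n → ℤ

/-- The weight `ε_a - ε_c`. -/
def root {n : ℕ} (a c : Ix n) : Wt n := Pi.single a 1 - Pi.single c 1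

/-- The bilinear form, `(ε_a, ε_c) = (-1)^{|a|} δ_{ac}`. -/
def form {n : ℕ} (u v : Ix n → ℚ) : ℚ := ∑ a, (-1) ^ (ipar a).val * (u a * v a)

/-- An integral weight, as a rational one. -/
def Wt.toRat {n : ℕ} (u : Wt n) : Ix n → ℚ := fun a => (u a : ℚ)

/-- The set `L(n,n)` of the Borel subalgebras of `𝔤𝔩(n|n)` with the standard even part, each
given by the partition `β₁ ≥ ⋯ ≥ βₙ ≥ 0` with `β₁ ≤ n` that labels it (`part r` is `β_{r+1}`). -/
structure BoxPartition (n : ℕ) where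
  part : Fin n → ℕ
  anti : Antitone part
  le : ∀ r, part r ≤ n

namespace BoxPartition

variable {n : ℕ}

/-- `b.pos a c` says that `ε_a - ε_c` is a positive root. In the `εδ`-sequence of the partition
`β`, the symbol `ε_i` is preceded by exactly `β_{n+1-i}` of the symbols `δ_1, …, δ_n`; both the
`ε_i` and the `δ_j` occur in increasing order, and `ε_a - ε_c` is positive if `ε_a` comes
before `ε_c`. -/
def pos (b : BoxPartition n) : Ix n → Ix n → Prop
  | Sum.inl i, Sum.inl j => i < j
  | Sum.inr i, Sum.inr j => i < j
  | Sum.inl i, Sum.inr j => b.part i.rev < j.val + 1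
  | Sum.inr j, Sum.inl i => j.val + 1 ≤ b.part i.rev

/-- The Borel subalgebra `𝔟`, spanned by the `e_{aa}` and the `e_{ac}` with `ε_a - ε_c`
positive. -/
def borel (k : Type*) [Field k] (b : BoxPartition n) : Submodule k (gl k n) where
  carrier := {A | ∀ a c, a ≠ c → ¬ b.pos a c → A a c = 0}
  add_mem' := by
    intro A B hA hB a c h h'
    simp [hA a c h h', hB a c h h']
  zero_mem' := by intro a c _ _; rfl
  smul_mem' := by
    intro t A hA a c h h'
    simp [hA a c h h']

/-- `ε_a - ε_c` is a simple root: positive and not the sum of two positive roots. -/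
def IsSimpleRoot (b : BoxPartition n) (a c : Ix n) : Prop :=
  b.pos a c ∧ ¬ ∃ p q r s : Ix n, b.pos p q ∧ b.pos r s ∧ root p q + root r s = root a c

open Classical in
/-- `ρ_0`, half the sum of the even positive roots. -/
noncomputable def rho0 (b : BoxPartition n) : Ix n → ℚ :=
  (1 / 2 : ℚ) • ∑ a, ∑ c, if b.pos a c ∧ ipar a = ipar c then (root a c).toRat else 0

open Classical in
/-- `ρ_1^𝔟`, half the sum of the odd positive roots. -/
noncomputable def rho1 (b : BoxPartition n) : Ix n → ℚ :=
  (1 / 2 : ℚ) • ∑ a, ∑ c, if b.pos a c ∧ ipar a ≠ ipar c then (root a c).toRat else 0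

/-- The Berezinian weight `ε_1 + ⋯ + ε_n - (δ_1 + ⋯ + δ_n)`. -/
def ber (n : ℕ) : Ix n → ℚ := fun a => (-1) ^ (ipar a).val

/-- The integral Weyl vector `ρ^𝔟 = ρ_0 - ρ_1^𝔟 + ber / 2`. -/
noncomputable def rho (b : BoxPartition n) : Ix n → ℚ :=
  b.rho0 - b.rho1 + (1 / 2 : ℚ) • ber n

/-- The root `ε_i - δ_j`; these represent the odd roots modulo sign. -/
def oddRoot (s : Fin n × Fin n) : Ix n → ℚ := (root (Sum.inl s.1) (Sum.inr s.2)).toRat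

open Classical in
/-- The atypicality of `L^𝔟(λ)`: the largest number of mutually orthogonal distinct odd roots
(modulo sign) that are orthogonal to `λ + ρ^𝔟`. -/
noncomputable def atypicality (b : BoxPartition n) (u : Wt n) : ℕ :=
  ((Finset.univ : Finset (Finset (Fin n × Fin n))).filter fun S =>
    (∀ s ∈ S, form (u.toRat + b.rho) (oddRoot s) = 0) ∧
    ∀ s ∈ S, ∀ t ∈ S, s ≠ t → form (oddRoot s) (oddRoot t) = 0).sup Finset.card

/-- The weight `λ` is atypical (with respect to `𝔟`) if `L^𝔟(λ)` has nonzero atypicality. -/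
def IsAtypical (b : BoxPartition n) (u : Wt n) : Prop := b.atypicality u ≠ 0

/-- The empty partition `()`, labelling the upper triangular Borel subalgebra. -/
def empty (n : ℕ) : BoxPartition n where
  part _ := 0
  anti := fun _ _ _ => le_rfl
  le _ := Nat.zero_le _

/-- `𝔟_{1|1} ⋆ 𝔟_{m|m} = (β₁ + 1, …, β_m + 1, β_{m+1})`, where `𝔟_{1|1} = (β_{m+1})` and
`𝔟_{m|m} = (β₁, …, β_m)`. -/
def star {m : ℕ} (b₁ : BoxPartition 1) (b : BoxPartition m) : BoxPartition (m + 1) where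
  part := Fin.snoc (α := fun _ => ℕ) (fun r => b.part r + 1) (b₁.part 0)
  anti := by
    intro r s h
    have h1 := b₁.le 0
    induction s using Fin.lastCases with
    | last =>
      induction r using Fin.lastCases with
      | last => exact le_rfl
      | cast r => simp only [Fin.snoc_last, Fin.snoc_castSucc]; omega
    | cast s =>
      induction r using Fin.lastCases with
      | last => exact absurd h (by simp [Fin.le_def])
      | cast r =>
        simp only [Fin.snoc_castSucc]
        have := b.anti (show r ≤ s from h)
        omega
  le := by
    intro r
    have h1 := b₁.le 0
    induction r using Fin.lastCases with
    | last => simp only [Fin.snoc_last]; omega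
    | cast r => simp only [Fin.snoc_castSucc]; have := b.le r; omega

/-- The hypercube Borel subalgebra `𝔟_γ = (n - 1 + γ_n, n - 2 + γ_{n-1}, …, 1 + γ_2, γ_1)`, for
`γ ∈ {0,1}^n`. -/
def hypercube {n : ℕ} (γ : Fin n → Fin 2) : BoxPartition n where
  part r := r.rev.val + (γ r.rev).val
  anti := by
    intro r s h
    rcases h.eq_or_lt with rfl | h
    · exact le_rfl
    · have h1 := (γ s.rev).isLt
      have h2 := Fin.rev_lt_rev.2 h
      rw [Fin.lt_def] at h2
      dsimp only
      omega
  le := by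
    intro r
    have h1 := (γ r.rev).isLt
    have h2 := r.rev.isLt
    omega

/-- The hypercube Borel subalgebra `𝔟_o`, with `o = (0, …, 0)`. -/
def bo (n : ℕ) : BoxPartition n := hypercube fun _ => 0

end BoxPartition

/-! ## Verma supermodules -/

/-- A choice of the function `par : Λ → ℤ/2`, normalised by `par 0 = 0`, for which the weight
supermodules with `M_λ` of parity `par λ` form a category closed under the action of
`𝔤𝔩(n|n)`: moving by a root changes `par` by the parity of the root. -/
structure ParityChoice (n : ℕ) where
  par : Wt n → ZMod 2
  par_zero : par 0 = 0
  par_root : ∀ (u : Wt n) (a c : Ix n), par (u + root a c) = par u + (ipar a + ipar c)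

instance (n : ℕ) : Inhabited (ParityChoice n) where
  default :=
    { par := fun u => ∑ j, ((u (Sum.inr j) : ℤ) : ZMod 2)
      par_zero := by simp
      par_root := by
        intro u a c
        have h : ∀ d : Ix n, ∑ j : Fin n, (((Pi.single d 1 : Wt n) (Sum.inr j) : ℤ) : ZMod 2)
            = ipar d := by
          rintro (i | i)
          · simp [ipar]
          · simp [ipar, Pi.single_apply, Sum.inr.injEq]
        simp only [root, Pi.add_apply, Pi.sub_apply, Int.cast_add, Int.cast_sub,
          Finset.sum_add_distrib, Finset.sum_sub_distrib, h]
        have : ∀ p q r : ZMod 2, p + (q - r) = p + (q + r) := by decide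
        exact this _ _ _ }

section Verma

variable (k : Type*) [Field k] {n : ℕ}

/-- The value `λ(A)` of a weight on the diagonal part of `A`. -/
def evalWt (u : Wt n) : gl k n →ₗ[k] k where
  toFun A := ∑ a, (u a : k) * A a a
  map_add' A B := by simp [mul_add, Finset.sum_add_distrib]
  map_smul' t A := by simp [-Fintype.sum_sum_type, Finset.mul_sum, mul_left_comm]

/-- The left ideal of `U(𝔤)` generated by the `A - λ(A)` with `A ∈ 𝔟`. -/
noncomputable def vermaIdeal (b : BoxPartition n) (u : Wt n) :
    Submodule (UEA k (gl k n)) (UEA k (gl k n)) :=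
  Submodule.span _ {z | ∃ A ∈ b.borel k, z = UEA.ι k (gl k n) A - algebraMap k _ (evalWt k u A)}

/-- The module `Ind_𝔟^𝔤 k_λ = U(𝔤) ⊗_{U(𝔟)} k_λ`, that is, `U(𝔤) / U(𝔤){A - λ(A) : A ∈ 𝔟}`,
where `k_λ` is the one-dimensional even `𝔟`-module on which `𝔥` acts through `λ` and the
nilradical acts as zero. -/
def IndVerma (b : BoxPartition n) (u : Wt n) : Type _ := UEA k (gl k n) ⧸ vermaIdeal k b u

variable {k} (b : BoxPartition n) (u : Wt n)

noncomputable instance : AddCommGroup (IndVerma k b u) :=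
  inferInstanceAs (AddCommGroup (UEA k (gl k n) ⧸ vermaIdeal k b u))
noncomputable instance : Module (UEA k (gl k n)) (IndVerma k b u) :=
  inferInstanceAs (Module (UEA k (gl k n)) (UEA k (gl k n) ⧸ vermaIdeal k b u))
noncomputable instance : Module k (IndVerma k b u) :=
  inferInstanceAs (Module k (UEA k (gl k n) ⧸ vermaIdeal k b u))
instance : IsScalarTower k (UEA k (gl k n)) (IndVerma k b u) :=
  inferInstanceAs (IsScalarTower k (UEA k (gl k n)) (UEA k (gl k n) ⧸ vermaIdeal k b u))

/-- The class in `Ind_𝔟^𝔤 k_λ` of an element of `U(𝔤)`. -/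
noncomputable def IndVerma.mkₗ : UEA k (gl k n) →ₗ[k] IndVerma k b u :=
  (vermaIdeal k b u).mkQ.restrictScalars k

theorem IndVerma.mkₗ_surjective : Function.Surjective (IndVerma.mkₗ (k := k) b u) :=
  fun v => Submodule.Quotient.mk_surjective (vermaIdeal k b u) v

theorem IndVerma.mkₗ_eq_zero (z : UEA k (gl k n)) :
    IndVerma.mkₗ b u z = 0 ↔ z ∈ vermaIdeal k b u :=
  Submodule.Quotient.mk_eq_zero (vermaIdeal k b u)

theorem pinv_entry (A : gl k n) (a c : Ix n) :
    pinv k (gl k n) A a c = sgn k 1 (ipar a + ipar c) * A a c := by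
  obtain ⟨E, hE, O, hO, rfl⟩ := exists_decomp k A
  rw [map_add, pinv_zero hE, pinv_one hO]
  rcases zmod_two_cases (ipar a + ipar c) with h | h
  · have := hO a c (by rw [h]; decide)
    simp [h, sgn_zero_right, this]
  · have := hE a c (by rw [h]; decide)
    simp [h, sgn_one_one, this]

theorem parity_mem_vermaIdeal {z : UEA k (gl k n)} (hz : z ∈ vermaIdeal k b u) :
    UEA.parity z ∈ vermaIdeal k b u := by
  induction hz using Submodule.span_induction with
  | mem z hz =>
    obtain ⟨A, hA, rfl⟩ := hz
    refine Submodule.subset_span ⟨pinv k _ A, ?_, ?_⟩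
    · intro a c h h'
      rw [pinv_entry, hA a c h h', mul_zero]
    · have h : evalWt k u (pinv k _ A) = evalWt k u A := by
        change ∑ a, (u a : k) * pinv k (gl k n) A a a = ∑ a, (u a : k) * A a a
        refine Finset.sum_congr rfl fun a _ => ?_
        have h2 : ∀ p : ZMod 2, p + p = 0 := by decide
        rw [pinv_entry, h2, sgn_zero_right, one_mul]
      rw [map_sub, UEA.parity_ι, AlgHom.commutes, h]
  | zero => rw [map_zero]; exact Submodule.zero_mem _
  | add y z _ _ hy hz => rw [map_add]; exact Submodule.add_mem _ hy hz
  | smul t z _ hz =>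
    rw [smul_eq_mul, map_mul, ← smul_eq_mul]
    exact Submodule.smul_mem _ _ hz

variable [CharZero k]

/-- Parity on `Ind_𝔟^𝔤 k_λ` is induced by the parity of `U(𝔤)`. -/
noncomputable instance : SuperSpace k (IndVerma k b u) where
  part i := (gr k (UEA k (gl k n)) i).map (IndVerma.mkₗ b u)
  isInternal := by
    refine isInternal_of _ ?_ ?_
    · intro v
      obtain ⟨z, rfl⟩ := IndVerma.mkₗ_surjective b u v
      obtain ⟨a, ha, c, hc, rfl⟩ := exists_decomp k z
      exact ⟨_, ⟨a, ha, rfl⟩, _, ⟨c, hc, rfl⟩, map_add _ _ _⟩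
    · rintro _ ⟨a, ha, rfl⟩ _ ⟨c, hc, rfl⟩ h
      rw [← map_add, IndVerma.mkₗ_eq_zero] at h
      rw [IndVerma.mkₗ_eq_zero]
      have h' := parity_mem_vermaIdeal b u h
      rw [map_add, UEA.mem_gr.1 ha, UEA.mem_gr.1 hc, sgn_zero_right, sgn_one_one, one_smul,
        neg_one_smul] at h'
      have h2 := Submodule.smul_mem _ (algebraMap k (UEA k (gl k n)) 2⁻¹)
        (Submodule.add_mem _ h h')
      rw [show a + c + (a + -c) = (2 : k) • a by rw [two_smul]; abel, algebraMap_smul, smul_smul,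
        inv_mul_cancel₀ two_ne_zero, one_smul] at h2
      exact h2

/-- The `𝔤𝔩(n|n)`-supermodule `Ind_𝔟^𝔤 k_λ`. -/
noncomputable instance : LieSuperRep k (gl k n) (IndVerma k b u) where
  act := (Algebra.lsmul k k (IndVerma k b u) :
    UEA k (gl k n) →ₐ[k] Module.End k (IndVerma k b u)).toLinearMap.comp (UEA.ι k (gl k n))
  act_mem := by
    rintro i j A _ hA ⟨z, hz, rfl⟩
    exact ⟨UEA.ι k _ A * z, UEA.mul_mem (UEA.ι_mem hA) hz, rfl⟩
  act_br := by
    intro i j A B v hA hB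
    have h := UEA.ι_br hA hB
    change UEA.ι k (gl k n) (br k A B) • v = UEA.ι k (gl k n) A • UEA.ι k (gl k n) B • v -
      sgn k i j • UEA.ι k (gl k n) B • UEA.ι k (gl k n) A • v
    rw [h, sub_smul, mul_smul, smul_assoc, mul_smul]

variable (k)

/-- The `𝔟`-Verma module `M^𝔟(λ) = Π^{par λ} Ind_𝔟^𝔤 k_λ`. -/
abbrev Verma (par : ParityChoice n) (b : BoxPartition n) (u : Wt n) : Type _ :=
  PShift (par.par u) (IndVerma k b u)

end Verma

/-! ## The functor `DS_{ε_1 - δ_1}` on `𝔤𝔩(m+1|m+1)`-supermodules -/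

section root

/-- The embedding of index sets that identifies the indices of `𝔤𝔩(m|m)` with
`J = {2, …, n} ∪ {n + 2, …, 2n}`, where `n = m + 1`. -/
def up {m : ℕ} : Ix m → Ix (m + 1) := Sum.map Fin.succ Fin.succ

/-- The restriction of a weight to `I = {1, n + 1}`. -/
def prI {m : ℕ} (u : Wt (m + 1)) : Wt 1 := u ∘ Sum.map (fun _ => 0) (fun _ => 0)

/-- The restriction of a weight to `J`. -/
def prJ {m : ℕ} (u : Wt (m + 1)) : Wt m := u ∘ up

variable (k : Type*) [Field k] (m : ℕ)

/-- The linear map `𝔤𝔩(m|m) ≅ 𝔤𝔩(J) ⊆ 𝔤𝔩(m+1|m+1)` that sends `e_{ac}` to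
`e_{up a, up c}`. -/
def embJ : gl k m →ₗ[k] gl k (m + 1) where
  toFun A := ∑ a, ∑ c, Matrix.single (up a) (up c) (A a c)
  map_add' A B := by simp [Matrix.single_add, Finset.sum_add_distrib]
  map_smul' t A := by simp [-Fintype.sum_sum_type, Finset.smul_sum]

/-- The root vector `e_{1,n+1}` of the root `ε_1 - δ_1`. -/
def rootVec : OddSqZero k (gl k (m + 1)) where
  val := Matrix.single (Sum.inl 0) (Sum.inr 0) 1
  odd := by
    intro a c h
    refine Matrix.single_apply_of_ne _ _ _ _ _ ?_
    rintro ⟨rfl, rfl⟩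
    exact h (by simp [ipar])
  sq := by
    have h : (Matrix.single (Sum.inl 0) (Sum.inr 0) 1 : gl k (m + 1)) ∈ gr k (gl k (m + 1)) 1 := by
      intro a c h
      refine Matrix.single_apply_of_ne _ _ _ _ _ ?_
      rintro ⟨rfl, rfl⟩
      exact h (by simp [ipar])
    refine (superComm_eq h h).trans ?_
    simp [Matrix.single_mul_single_of_ne]

variable {k m}

theorem embJ_apply (A : gl k m) (a c : Ix (m + 1)) :
    embJ k m A a c = ∑ p, ∑ q, if up p = a ∧ up q = c then A p q else 0 := by
  simp [-Fintype.sum_sum_type, embJ, Matrix.sum_apply, Matrix.single_apply]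

theorem up_injective : Function.Injective (up (m := m)) :=
  Sum.map_injective.2 ⟨Fin.succ_injective _, Fin.succ_injective _⟩

theorem embJ_up (A : gl k m) (a c : Ix m) : embJ k m A (up a) (up c) = A a c := by
  simp [-Fintype.sum_sum_type, embJ_apply, up_injective.eq_iff, ite_and]

theorem ipar_up (a : Ix m) : ipar (up a) = ipar a := by
  rcases a with a | a <;> rfl

theorem embJ_of_left (A : gl k m) {a : Ix (m + 1)} (h : ∀ p, up p ≠ a) (c : Ix (m + 1)) :
    embJ k m A a c = 0 := by
  simp [-Fintype.sum_sum_type, embJ_apply, h]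

theorem embJ_of_right (A : gl k m) {c : Ix (m + 1)} (h : ∀ p, up p ≠ c) (a : Ix (m + 1)) :
    embJ k m A a c = 0 := by
  simp [-Fintype.sum_sum_type, embJ_apply, h]

theorem up_ne_inl (p : Ix m) : up p ≠ Sum.inl 0 := by
  rcases p with p | p <;> simp [up]

theorem up_ne_inr (p : Ix m) : up p ≠ Sum.inr 0 := by
  rcases p with p | p <;> simp [up]

theorem ix_cases (a : Ix (m + 1)) : a = Sum.inl 0 ∨ a = Sum.inr 0 ∨ ∃ p : Ix m, a = up p := by
  rcases a with a | a
  · induction a using Fin.cases with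
    | zero => exact Or.inl rfl
    | succ i => exact Or.inr (Or.inr ⟨Sum.inl i, rfl⟩)
  · induction a using Fin.cases with
    | zero => exact Or.inr (Or.inl rfl)
    | succ i => exact Or.inr (Or.inr ⟨Sum.inr i, rfl⟩)

theorem gl_ext {X : Type*} {A B : Matrix (Ix (m + 1)) (Ix (m + 1)) X} (h1 : ∀ c, A (Sum.inl 0) c = B (Sum.inl 0) c)
    (h2 : ∀ c, A (Sum.inr 0) c = B (Sum.inr 0) c)
    (h3 : ∀ p, A (up p) (Sum.inl 0) = B (up p) (Sum.inl 0))
    (h4 : ∀ p, A (up p) (Sum.inr 0) = B (up p) (Sum.inr 0))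
    (h5 : ∀ p q, A (up p) (up q) = B (up p) (up q)) : A = B := by
  ext a c
  rcases ix_cases a with rfl | rfl | ⟨p, rfl⟩
  · exact h1 c
  · exact h2 c
  · rcases ix_cases c with rfl | rfl | ⟨q, rfl⟩
    · exact h3 p
    · exact h4 p
    · exact h5 p q

theorem embJ_mem {i : ZMod 2} {A : gl k m} (h : A ∈ gr k (gl k m) i) :
    embJ k m A ∈ gr k (gl k (m + 1)) i := by
  intro a c hac
  rcases ix_cases a with rfl | rfl | ⟨p, rfl⟩
  · exact embJ_of_left A up_ne_inl c
  · exact embJ_of_left A up_ne_inr c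
  · rcases ix_cases c with rfl | rfl | ⟨q, rfl⟩
    · exact embJ_of_right A up_ne_inl _
    · exact embJ_of_right A up_ne_inr _
    · rw [embJ_up]
      exact h p q (by rwa [ipar_up, ipar_up] at hac)

theorem embJ_mul (A B : gl k m) : embJ k m (A * B) = embJ k m A * embJ k m B := by
  have hl : ∀ (X Y : gl k (m + 1)) (a : Ix (m + 1)) (c : Ix (m + 1)), (∀ d, X a d = 0) →
      (X * Y) a c = 0 := by
    intro X Y a c h
    simp [Matrix.mul_apply, h]
  have hr : ∀ (X Y : gl k (m + 1)) (a : Ix (m + 1)) (c : Ix (m + 1)), (∀ d, Y d c = 0) →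
      (X * Y) a c = 0 := by
    intro X Y a c h
    simp [Matrix.mul_apply, h]
  refine gl_ext ?_ ?_ ?_ ?_ ?_
  · intro c
    rw [embJ_of_left _ up_ne_inl, hl _ _ _ _ fun d => embJ_of_left _ up_ne_inl _]
  · intro c
    rw [embJ_of_left _ up_ne_inr, hl _ _ _ _ fun d => embJ_of_left _ up_ne_inr _]
  · intro p
    rw [embJ_of_right _ up_ne_inl, hr _ _ _ _ fun d => embJ_of_right _ up_ne_inl _]
  · intro p
    rw [embJ_of_right _ up_ne_inr, hr _ _ _ _ fun d => embJ_of_right _ up_ne_inr _]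
  · intro p q
    rw [embJ_up, Matrix.mul_apply, Matrix.mul_apply]
    rw [Fintype.sum_sum_type, Fintype.sum_sum_type, Fin.sum_univ_succ, Fin.sum_univ_succ]
    rw [embJ_of_left B up_ne_inl, embJ_of_left B up_ne_inr, mul_zero, mul_zero, zero_add, zero_add]
    refine congrArg₂ _ (Finset.sum_congr rfl fun i _ => ?_) (Finset.sum_congr rfl fun i _ => ?_)
    · exact (congrArg₂ _ (embJ_up A p (Sum.inl i)) (embJ_up B (Sum.inl i) q)).symm
    · exact (congrArg₂ _ (embJ_up A p (Sum.inr i)) (embJ_up B (Sum.inr i) q)).symm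

theorem embJ_br (A B : gl k m) : embJ k m (br k A B) = br k (embJ k m A) (embJ k m B) := by
  have h : ∀ i j : ZMod 2, ∀ A ∈ gr k (gl k m) i, ∀ B ∈ gr k (gl k m) j,
      embJ k m (br k A B) = br k (embJ k m A) (embJ k m B) := by
    intro i j A hA B hB
    have h1 : br k A B = _ := superComm_eq hA hB
    have h2 : br k (embJ k m A) (embJ k m B) = _ := superComm_eq (embJ_mem hA) (embJ_mem hB)
    rw [h1, h2, map_sub, map_smul, embJ_mul, embJ_mul]
  obtain ⟨a, ha, b, hb, rfl⟩ := exists_decomp k A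
  obtain ⟨c, hc, d, hd, rfl⟩ := exists_decomp k B
  simp only [map_add, LinearMap.add_apply, h 0 0 a ha c hc, h 0 1 a ha d hd, h 1 0 b hb c hc,
    h 1 1 b hb d hd]

theorem br_rootVec (A : gl k (m + 1)) (a c : Ix (m + 1)) :
    br k (rootVec k m).val A a c = (if a = Sum.inl 0 then A (Sum.inr 0) c else 0) -
      (if c = Sum.inr 0 then sgn k 1 (ipar a) * A a (Sum.inl 0) else 0) := by
  have key : br k (rootVec k m).val A =
      (rootVec k m).val * A - pinv k _ A * (rootVec k m).val := by
    obtain ⟨E, hE, O, hO, rfl⟩ := exists_decomp k A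
    have h1 : br k (rootVec k m).val E = _ := superComm_eq (rootVec k m).odd hE
    have h2 : br k (rootVec k m).val O = _ := superComm_eq (rootVec k m).odd hO
    rw [map_add, h1, h2, map_add, pinv_zero hE, pinv_one hO, sgn_zero_right, sgn_one_one]
    simp only [one_smul, neg_smul, mul_add, add_mul, neg_mul]
    abel
  rw [key, Matrix.sub_apply]
  congr 1
  · split_ifs with h
    · subst h; simp [rootVec]
    · simp [rootVec, h]
  · split_ifs with h
    · subst h; simp [rootVec, pinv_entry, ipar]
    · simp [rootVec, h]

/-- The map `𝔤𝔩(m|m) → DS_x 𝔤𝔩(m+1|m+1)`, induced by the inclusion of `𝔤𝔩(J)`, whose elements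
supercommute with `x = e_{1,n+1}`. -/
def glToDS (k : Type*) [Field k] (m : ℕ) : gl k m →ₗ[k] DS (rootVec k m) (gl k (m + 1)) :=
  (DS.mk (rootVec k m) (gl k (m + 1))).comp <| (embJ k m).codRestrict _ fun A => by
    change br k (rootVec k m).val (embJ k m A) = 0
    ext a c
    rw [br_rootVec, embJ_of_left _ up_ne_inr, embJ_of_right _ up_ne_inl]
    simp

theorem glToDS_injective : Function.Injective (glToDS k m) := by
  rw [← LinearMap.ker_eq_bot, Submodule.eq_bot_iff]
  intro A hA
  obtain ⟨B, hB⟩ := (DS.mk_eq_zero _ _).1 (LinearMap.mem_ker.1 hA)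
  have hB' : br k (rootVec k m).val B = embJ k m A := hB
  ext p q
  rw [← embJ_up A p q, ← hB', br_rootVec]
  simp [up_ne_inl, up_ne_inr]

theorem glToDS_surjective : Function.Surjective (glToDS k m) := by
  intro v
  obtain ⟨⟨C, hC⟩, rfl⟩ := DS.mk_surjective _ v
  have hC' : ∀ a c, (if a = Sum.inl 0 then C (Sum.inr 0) c else 0) -
      (if c = Sum.inr 0 then sgn k 1 (ipar a) * C a (Sum.inl 0) else 0) = 0 := by
    intro a c
    rw [← br_rootVec]
    exact congrFun (congrFun (show br k (rootVec k m).val C = 0 from hC) a) c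
  have e1 : ∀ c, c ≠ Sum.inr 0 → C (Sum.inr 0) c = 0 := by
    intro c hc
    simpa [hc] using hC' (Sum.inl 0) c
  have e2 : C (Sum.inr 0) (Sum.inr 0) = C (Sum.inl 0) (Sum.inl 0) := by
    have := hC' (Sum.inl 0) (Sum.inr 0)
    simpa [ipar, sgn_zero_right, sub_eq_zero] using this
  have e3 : ∀ p, C (up p) (Sum.inl 0) = 0 := by
    intro p
    have h := hC' (up p) (Sum.inr 0)
    have hs : sgn k 1 (ipar (up p)) ≠ 0 := by
      rcases zmod_two_cases (ipar (up p)) with h | h <;> simp [h, sgn_zero_right, sgn_one_one]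
    simpa [up_ne_inl, hs] using h
  refine ⟨Matrix.of fun p q => C (up p) (up q), ?_⟩
  refine eq_of_sub_eq_zero ((map_sub (DS.mk (rootVec k m) (gl k (m + 1))) _ _).symm.trans ?_)
  refine (DS.mk_eq_zero _ _).2 ⟨-(Matrix.of fun a c => if a = Sum.inr 0 then C (Sum.inl 0) c else
    if c = Sum.inl 0 ∧ a ≠ Sum.inl 0 then -(sgn k 1 (ipar a) * C a (Sum.inr 0)) else 0), ?_⟩
  change br k (rootVec k m).val _ = embJ k m _ - C
  rw [map_neg]
  have hss : ∀ p : Ix m, sgn k 1 (ipar (up p)) * (sgn k 1 (ipar (up p)) * C (up p) (Sum.inr 0)) =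
      C (up p) (Sum.inr 0) := by
    intro p
    rw [← mul_assoc, sgn_mul_self, one_mul]
  refine gl_ext ?_ ?_ ?_ ?_ ?_
  · intro c
    rw [Matrix.neg_apply, br_rootVec, Matrix.sub_apply, embJ_of_left _ up_ne_inl]
    simp
  · intro c
    rw [Matrix.neg_apply, br_rootVec, Matrix.sub_apply, embJ_of_left _ up_ne_inr]
    by_cases hc : c = Sum.inr 0
    · subst hc
      simp [ipar, sgn_one_one, e2]
    · simp [hc, e1 c hc]
  · intro p
    rw [Matrix.neg_apply, br_rootVec, Matrix.sub_apply, embJ_of_right _ up_ne_inl, e3]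
    simp [up_ne_inl]
  · intro p
    rw [Matrix.neg_apply, br_rootVec, Matrix.sub_apply, embJ_of_right _ up_ne_inr]
    simp [up_ne_inl, up_ne_inr, hss]
  · intro p q
    rw [Matrix.neg_apply, br_rootVec, Matrix.sub_apply, embJ_up]
    simp [up_ne_inl, up_ne_inr]

/-- The isomorphism of Lie superalgebras `𝔤𝔩(m|m) ≅ 𝔤𝔩(J) ≅ DS_x 𝔤𝔩(m+1|m+1)`, induced by the
inclusion of `𝔤𝔩(J)`. -/
noncomputable def glDS (k : Type*) [Field k] (m : ℕ) :
    LieSuperEquiv k (gl k m) (DS (rootVec k m) (gl k (m + 1))) where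
  toLinearEquiv := LinearEquiv.ofBijective (glToDS k m) ⟨glToDS_injective, glToDS_surjective⟩
  map_gr := fun hA => ⟨_, embJ_mem hA, rfl⟩
  map_br := fun A B =>
    congrArg (DS.mk (rootVec k m) (gl k (m + 1))) (Subtype.ext (embJ_br A B))

variable (k m) in
/-- `DS_{ε_1 - δ_1} V`, as a `𝔤𝔩(m|m)`-supermodule through `𝔤𝔩(m|m) ≅ DS_x 𝔤𝔩(m+1|m+1)`. -/
abbrev DSroot (V : Type*) [AddCommGroup V] [Module k V] [SuperSpace k V]
    [LieSuperRep k (gl k (m + 1)) V] : Type _ :=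
  Pull (glDS k m) (DS (rootVec k m) V)

variable (k) in
/-- The subalgebra of `𝔤𝔩(m|m) ≅ DS_x 𝔤𝔩(m+1|m+1)` that consists of the classes of the elements of
`𝔟` that supercommute with `x`. -/
noncomputable def dsBorel (b : BoxPartition (m + 1)) : Submodule k (gl k m) :=
  (((b.borel k).comap (LinearMap.ker (act k (gl k (m + 1)) (rootVec k m).val)).subtype).map
    (DS.mk (rootVec k m) (gl k (m + 1)))).comap (glToDS k m)

end root

end GLSuper

open GLSuper

/-! Write x = e_{1,n+1}, y = e_{n+1,1}, h = [x,y] = e_{11} + e_{n+1,n+1} and c = λ_1 + λ_{n+1}. Let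
M be the Verma module of 𝔤𝔩(n|n) and N the one of 𝔤𝔩(J) with highest weight pr_J(λ), both before the
parity shift. For 𝔤𝔩(1|1) with the upper triangular Borel the vector ρ is zero, so atypicality of
pr_I(λ) means c = 0 (`isAtypical_prI`).

Induction in stages. The Borel ()⋆𝔟 consists of the block upper triangular matrices, for the order
1, n+1, J, whose J-block lies in 𝔟 (`mem_star_borel`). Hence M is induced from the parabolic 𝔭 of
block upper triangular matrices, acting on N through the J-block and through the weight on I. With S
the strictly block lower triangular matrices, M should be U(S) ⊗ N. No PBW theorem is used: the rule
A(vt) = ±v(At) + [A,v]t, for v in S, determines an action of the whole algebra on U(S) ⊗ N, and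
`InducingDatum.op_br` shows that it is one. The universal properties give maps `toInd` and `ofInd`
with `ofInd_toInd`, through which statements pass between M and the model.

Typical case. Let R be right multiplication by y on U(S) ⊗ N, with a Koszul sign. It satisfies xR +
Rx = c (`op_rightMul_add`), so for c ≠ 0 it is a contracting homotopy up to a scalar and the
homology of x vanishes.

Atypical case. Now h kills N, and ad h kills y and is -1 on a complement of y in S. Hence M is the
sum of N + yN, on which h is zero, and of eigenspaces of h with negative integral eigenvalues
(`exists_decomp_negPart`). The operator h = xy + yx commutes with x and is invertible on the second
summand, which is therefore acyclic; on N + yN the operator x is zero. The sum N + yN is direct, as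
the homomorphism `epsCoeff` from U(S) to the dual numbers shows. So the homology is N ⊕ yN, and yN
is ΠN because y is odd and supercommutes with 𝔤𝔩(J) (`cycleMap_act`). The answer N ⊕ ΠN is unchanged
by Π, so the parity functions of the two ranks need not be related. -/

namespace GLSuper

/-! ### Universal property and generation of the enveloping superalgebra -/

section envelopingAlgebra

variable {k L B : Type*} [Field k] [AddCommGroup L] [Module k L] [LieSuper k L] [Ring B] [Algebra k B]

/-- The universal property of the enveloping superalgebra. -/
noncomputable def UEA.lift (f : L →ₗ[k] B) (hf : ∀ (i j : ZMod 2) (x y : L), x ∈ gr k L i →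
    y ∈ gr k L j → f (br k x y) = f x * f y - sgn k i j • (f y * f x)) : UEA k L →ₐ[k] B :=
  RingQuot.liftAlgHom k ⟨TensorAlgebra.lift k f, by
    rintro _ _ ⟨hx, hy⟩
    simp [hf _ _ _ _ hx hy]⟩

theorem UEA.lift_ι (f : L →ₗ[k] B) (hf : ∀ (i j : ZMod 2) (x y : L), x ∈ gr k L i →
    y ∈ gr k L j → f (br k x y) = f x * f y - sgn k i j • (f y * f x)) (x : L) :
    UEA.lift f hf (UEA.ι k L x) = f x := by
  refine (RingQuot.liftAlgHom_mkAlgHom_apply k _ _ _).trans ?_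
  simp

/-- A subspace of `U(L)` that contains `1` and is stable under left multiplication by `L`
is everything. -/
theorem UEA.eq_top_of_mul_mem (T : Submodule k (UEA k L)) (h1 : 1 ∈ T)
    (hm : ∀ x : L, ∀ u ∈ T, UEA.ι k L x * u ∈ T) : T = ⊤ := by
  rw [Submodule.eq_top_iff']
  intro u
  obtain ⟨t, rfl⟩ := RingQuot.mkAlgHom_surjective k (UEA.Rel k L) u
  -- Stability of all of `T`, rather than the case of 1 alone, is what passes through products in
  -- the induction on the tensor algebra.
  suffices h : ∀ v ∈ T, HMul.hMul (α := UEA k L) (RingQuot.mkAlgHom k (UEA.Rel k L) t) v ∈ T by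
    exact Eq.mp (congrArg (· ∈ T) (mul_one (M := UEA k L) _)) (h 1 h1)
  induction t using TensorAlgebra.induction with
  | algebraMap r =>
    intro v hv
    rw [AlgHom.commutes]
    exact (Algebra.smul_def (A := UEA k L) r v) ▸ T.smul_mem r hv
  | ι x => exact fun v hv => hm x v hv
  | mul a b ha hb =>
    intro v hv
    rw [map_mul]
    exact (mul_assoc (G := UEA k L) _ _ v) ▸ ha _ (hb v hv)
  | add a b ha hb =>
    intro v hv
    rw [map_add]
    exact (add_mul (R := UEA k L) _ _ v) ▸ T.add_mem (ha v hv) (hb v hv)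

theorem sgn_add_right {k : Type*} [Field k] (i j l : ZMod 2) :
    sgn k i (j + l) = sgn k i j * sgn k i l := by
  rw [sgn_comm, sgn_add_left, sgn_comm, sgn_comm l]

theorem pinv_mem_gr {k V : Type*} [Field k] [AddCommGroup V] [Module k V] [SuperSpace k V]
    {i : ZMod 2} {x : V} (h : x ∈ gr k V i) : pinv k V x ∈ gr k V i := by
  rw [pinv_gr h]; exact Submodule.smul_mem _ _ h

theorem linearMap_ext_gr {V W : Type*} [AddCommGroup V] [Module k V] [SuperSpace k V]
    [AddCommGroup W] [Module k W] {f g : V →ₗ[k] W} (h : ∀ i, ∀ v ∈ gr k V i, f v = g v) :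
    f = g := by
  ext v
  obtain ⟨a, ha, b, hb, rfl⟩ := exists_decomp k v
  rw [map_add, map_add, h 0 a ha, h 1 b hb]

end envelopingAlgebra

/-! ### Graded subalgebras as Lie superalgebras -/

section subalgebra

variable (k L : Type*) [Field k] [AddCommGroup L] [Module k L] [LieSuper k L]

/-- A graded subalgebra of a Lie superalgebra. -/
structure LieSuperSub extends Submodule k L where
  pinv_mem : ∀ {x : L}, x ∈ carrier → pinv k L x ∈ carrier
  br_mem : ∀ {x y : L}, x ∈ carrier → y ∈ carrier → br k x y ∈ carrier

variable {k L} [CharZero k] (S : LieSuperSub k L)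

instance : SuperSpace k S.toSubmodule where
  part i := (gr k L i).comap S.toSubmodule.subtype
  isInternal := by
    refine isInternal_of _ ?_ ?_
    · rintro ⟨v, hv⟩
      obtain ⟨a, ha, b, hb, rfl⟩ := exists_decomp k v
      have hv' := S.pinv_mem hv
      rw [map_add, pinv_zero ha, pinv_one hb] at hv'
      have h2 : (2 : k) ≠ 0 := two_ne_zero
      have haS : a ∈ S.toSubmodule := by
        have := S.toSubmodule.smul_mem (2⁻¹ : k) (S.toSubmodule.add_mem hv hv')
        rwa [show a + b + (a + -b) = (2 : k) • a by rw [two_smul]; abel, smul_smul,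
          inv_mul_cancel₀ h2, one_smul] at this
      have hbS : b ∈ S.toSubmodule := by
        have := S.toSubmodule.sub_mem hv haS
        rwa [add_sub_cancel_left] at this
      exact ⟨⟨a, haS⟩, ha, ⟨b, hbS⟩, hb, rfl⟩
    · rintro ⟨a, _⟩ ha ⟨b, _⟩ hb h
      exact Subtype.ext (eq_zero_left (k := k) ha hb (congrArg Subtype.val h))

instance : LieSuper k S.toSubmodule where
  br := LinearMap.mk₂ k (fun x y => ⟨br k x.1 y.1, S.br_mem x.2 y.2⟩)
    (by intros; ext; simp) (by intros; ext; simp) (by intros; ext; simp) (by intros; ext; simp)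
  br_mem := fun hx hy => LieSuper.br_mem (k := k) (L := L) hx hy
  br_skew := fun hx hy => Subtype.ext (LieSuper.br_skew (k := k) (L := L) hx hy)
  br_jacobi := fun hx hy hz => Subtype.ext (LieSuper.br_jacobi (k := k) (L := L) hx hy hz)

end subalgebra

/-! ### The action of U(S) on functions from L to an S-module -/

section induction

variable {k L : Type*} [Field k] [CharZero k] [AddCommGroup L] [Module k L] [LieSuper k L]
  (S : LieSuperSub k L)
  (X : Type*) [AddCommGroup X] [Module k X] [Module (UEA k S.toSubmodule) X]
  [IsScalarTower k (UEA k S.toSubmodule) X]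

/-- The action of a subalgebra on `Hom(L, X)`, normalised so that it is the one on the functions
`A ↦ A t` with `t` in an `L`-module `X`. -/
noncomputable def homAct : S.toSubmodule →ₗ[k] Module.End k (L →ₗ[k] X) :=
  LinearMap.mk₂ k (fun v φ =>
    -- Half of id ± pinv projects to the even and odd parts of the argument. On the odd part v is
    -- replaced by its parity twist; this gives the Koszul sign by a formula that is bilinear for
    -- inhomogeneous elements too.
    (2⁻¹ : k) • ((Algebra.lsmul k k X (UEA.ι k S.toSubmodule v)) ∘ₗ φ ∘ₗ (LinearMap.id + pinv k L) +
      (Algebra.lsmul k k X (UEA.ι k S.toSubmodule (pinv k _ v))) ∘ₗ φ ∘ₗ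
        (LinearMap.id - pinv k L)) + φ ∘ₗ (br k).flip v.1)
    (by
      intros
      simp only [map_add, LinearMap.add_comp, Submodule.coe_add, LinearMap.comp_add, smul_add]
      abel)
    (by
      intro c v φ
      simp only [map_smul, LinearMap.smul_comp, Submodule.coe_smul, LinearMap.comp_smul, smul_add,
        smul_comm c (2⁻¹ : k)])
    (by
      intros
      simp only [LinearMap.add_comp, LinearMap.comp_add, smul_add]
      abel)
    (by
      intro c v φ
      simp only [LinearMap.smul_comp, LinearMap.comp_smul, smul_add, smul_comm c (2⁻¹ : k)])

variable {S X}

/-- This is the rule A(vt) = ±v(At) + [A,v]t, read as a formula for the function A ↦ A(vt) in terms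
of the function A ↦ At. -/
theorem homAct_apply {i j : ZMod 2} {v : S.toSubmodule} (hv : v ∈ gr k S.toSubmodule i) {A : L}
    (hA : A ∈ gr k L j) (φ : L →ₗ[k] X) : homAct S X v φ A =
      sgn k i j • UEA.ι k S.toSubmodule v • φ A + φ (br k A v.1) := by
  have h : homAct S X v φ A = (2⁻¹ : k) • (UEA.ι k S.toSubmodule v • φ (A + pinv k L A) +
    UEA.ι k S.toSubmodule (pinv k _ v) • φ (A - pinv k L A)) + φ (br k A v.1) := rfl
  rw [h, pinv_gr hv, pinv_gr hA]
  congr 1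
  rcases zmod_two_cases j with rfl | rfl
  · simp only [sgn_zero_right, one_smul, sub_self, map_zero, smul_zero, add_zero, map_add, smul_add]
    rw [← two_smul k, smul_inv_smul₀ (two_ne_zero' k)]
  · rw [sgn_one_one, sgn_comm]
    simp only [neg_smul, one_smul, add_neg_cancel, sub_neg_eq_add, map_zero, smul_zero, zero_add,
      map_add, smul_add, map_smul, smul_assoc]
    rw [← two_smul k, smul_inv_smul₀ (two_ne_zero' k)]

variable (S X) in
/-- The `U(S)`-module structure on `Hom(L, X)`. -/
noncomputable def homActU : UEA k S.toSubmodule →ₐ[k] Module.End k (L →ₗ[k] X) :=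
  UEA.lift (homAct S X) <| by
    intro i j v w hv hw
    ext φ : 1
    refine linearMap_ext_gr fun l A hA => ?_
    have hvw := LieSuper.br_mem (k := k) hv hw
    have hAv : br k A v.1 ∈ gr k L (l + i) := LieSuper.br_mem (k := k) hA hv
    have hAw : br k A w.1 ∈ gr k L (l + j) := LieSuper.br_mem (k := k) hA hw
    have hbr : ((br k v w : S.toSubmodule) : L) = br k v.1 w.1 := rfl
    simp only [LinearMap.sub_apply, LinearMap.smul_apply, Module.End.mul_apply,
      homAct_apply hvw hA, homAct_apply hv hA, homAct_apply hw hA, homAct_apply hw hAv,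
      homAct_apply hv hAw, UEA.ι_br hv hw, hbr, sub_smul, mul_smul, smul_assoc, smul_add]
    -- The Jacobi identity for brackets from the right: it makes the terms with two brackets match.
    -- The mixed terms cancel by signs alone.
    have e : br k A (br k v.1 w.1) = br k (br k A v.1) w.1 - sgn k i j • br k (br k A w.1) v.1 := by
      have e1 := LieSuper.br_jacobi (k := k) hA (show v.1 ∈ gr k L i from hv)
        (show w.1 ∈ gr k L j from hw)
      have e2 := LieSuper.br_skew (k := k) (show v.1 ∈ gr k L i from hv) hAw
      rw [e1, e2, sgn_comm i (l + j), sgn_add_left, smul_neg, smul_smul, ← mul_assoc, sgn_mul_self,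
        one_mul, sgn_comm j i]
      abel
    rw [e, map_sub, map_smul]
    simp only [sgn_add_right, sgn_add_left]
    rcases zmod_two_cases i with rfl | rfl <;> rcases zmod_two_cases j with rfl | rfl <;>
      rcases zmod_two_cases l with rfl | rfl <;>
      simp only [sgn_zero_left, sgn_zero_right, sgn_one_one, one_smul, neg_smul, mul_one,
        mul_neg, neg_neg, smul_neg] <;> abel

variable (S X) in
theorem homActU_ι (v : S.toSubmodule) :
    homActU S X (UEA.ι k S.toSubmodule v) = homAct S X v := UEA.lift_ι _ _ v

end induction

/-! ### The module U(S) ⊗ N induced from a complementary subalgebra -/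

section induced

variable {k L : Type*} [Field k] [CharZero k] [AddCommGroup L] [Module k L] [LieSuper k L]
  (S : LieSuperSub k L) (N : Type*) [AddCommGroup N] [Module k N]

/-- A graded complement `𝔭 = ker proj` of `S` that is a subalgebra, with a representation on `N`,
extended by zero to `S`. -/
structure InducingDatum where
  proj : L →ₗ[k] S.toSubmodule
  proj_coe : ∀ s : S.toSubmodule, proj s.1 = s
  proj_mem : ∀ {i : ZMod 2} {x : L}, x ∈ gr k L i → (proj x).1 ∈ gr k L i
  proj_br : ∀ {x y : L}, proj x = 0 → proj y = 0 → proj (br k x y) = 0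
  rho : L →ₗ[k] Module.End k N
  rho_coe : ∀ s : S.toSubmodule, rho s.1 = 0
  rho_br : ∀ {i j : ZMod 2} {x y : L}, x ∈ gr k L i → y ∈ gr k L j → proj x = 0 → proj y = 0 →
    rho (br k x y) = rho x * rho y - sgn k i j • (rho y * rho x)

/-- The space `U(S) ⊗ N` of the module induced from `𝔭`. -/
def IndSpace : Type _ := TensorProduct k (UEA k S.toSubmodule) N

noncomputable instance : AddCommGroup (IndSpace S N) :=
  inferInstanceAs (AddCommGroup (TensorProduct k (UEA k S.toSubmodule) N))
noncomputable instance : Module k (IndSpace S N) :=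
  inferInstanceAs (Module k (TensorProduct k (UEA k S.toSubmodule) N))
noncomputable instance : Module (UEA k S.toSubmodule) (IndSpace S N) :=
  inferInstanceAs (Module (UEA k S.toSubmodule) (TensorProduct k (UEA k S.toSubmodule) N))
instance : IsScalarTower k (UEA k S.toSubmodule) (IndSpace S N) :=
  inferInstanceAs (IsScalarTower k (UEA k S.toSubmodule) (TensorProduct k (UEA k S.toSubmodule) N))

variable {S N}

namespace IndSpace

/-- The pure tensors. -/
noncomputable def tmul : UEA k S.toSubmodule →ₗ[k] N →ₗ[k] IndSpace S N := TensorProduct.mk _ _ _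

/-- The linear map on `U(S) ⊗ N` that is given by a bilinear map. -/
noncomputable def lift {P : Type*} [AddCommGroup P] [Module k P]
    (f : UEA k S.toSubmodule →ₗ[k] N →ₗ[k] P) : IndSpace S N →ₗ[k] P := TensorProduct.lift f

theorem lift_tmul {P : Type*} [AddCommGroup P] [Module k P]
    (f : UEA k S.toSubmodule →ₗ[k] N →ₗ[k] P) (u : UEA k S.toSubmodule) (n : N) :
    lift f (tmul u n) = f u n := rfl

theorem smul_tmul (u w : UEA k S.toSubmodule) (n : N) : u • tmul w n = tmul (u * w) n := rfl

theorem induction {P : IndSpace S N → Prop} (t : IndSpace S N) (h0 : P 0)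
    (h1 : ∀ u n, P (tmul u n)) (h2 : ∀ a b, P a → P b → P (a + b)) : P t :=
  TensorProduct.induction_on t h0 h1 h2

/-- A subspace of `U(S) ⊗ N` that contains `1 ⊗ N` and is stable under `S` is everything. -/
theorem mem_of_smul_mem (T : Submodule k (IndSpace S N)) (h1 : ∀ n : N, tmul 1 n ∈ T)
    (hm : ∀ i, ∀ v ∈ gr k S.toSubmodule i, ∀ t ∈ T, UEA.ι k S.toSubmodule v • t ∈ T)
    (t : IndSpace S N) : t ∈ T := by
  refine IndSpace.induction t T.zero_mem (fun u n => ?_) fun a b ha hb => T.add_mem ha hb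
  have h := UEA.eq_top_of_mul_mem (T.comap (tmul.flip n)) (h1 n) (by
    intro x u hu
    obtain ⟨a, ha, b, hb, rfl⟩ := exists_decomp k x
    have := T.add_mem (hm 0 a ha _ hu) (hm 1 b hb _ hu)
    rwa [← add_smul, ← map_add] at this)
  have : u ∈ (⊤ : Submodule k (UEA k S.toSubmodule)) := trivial
  rw [← h] at this
  exact this

end IndSpace

namespace InducingDatum

open IndSpace

variable (D : InducingDatum S N)

/-- The function `A ↦ A (1 ⊗ n)`. -/
noncomputable def base : N →ₗ[k] L →ₗ[k] IndSpace S N :=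
  LinearMap.mk₂ k (fun n A => tmul (UEA.ι k S.toSubmodule (D.proj A)) n + tmul 1 (D.rho A n))
    (by intros; simp only [map_add]; abel)
    (by intros; simp only [map_smul, smul_add])
    (by intros; simp only [map_add, LinearMap.add_apply]; abel)
    (by intros; simp only [map_smul, smul_add, LinearMap.smul_apply])

/-- The map that sends `t` to the function `A ↦ A t`. -/
noncomputable def orbit : IndSpace S N →ₗ[k] L →ₗ[k] IndSpace S N :=
  IndSpace.lift ((LinearMap.lcomp k _ D.base).comp
    (homActU S (IndSpace S N)).toLinearMap)

/-- The operators by which `L` acts on `U(S) ⊗ N`. -/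
noncomputable def op : L →ₗ[k] Module.End k (IndSpace S N) := D.orbit.flip

theorem op_one_tmul (A : L) (n : N) :
    D.op A (tmul 1 n) = tmul (UEA.ι k S.toSubmodule (D.proj A)) n + tmul 1 (D.rho A n) := by
  change homActU S (IndSpace S N) 1 (D.base n) A = _
  rw [map_one]
  rfl

theorem orbit_smul (v : S.toSubmodule) (t : IndSpace S N) :
    D.orbit (UEA.ι k S.toSubmodule v • t) = homAct S (IndSpace S N) v (D.orbit t) := by
  induction t using IndSpace.induction with
  | h0 => simp
  | h2 a b ha hb => rw [smul_add, map_add, ha, hb, map_add, map_add]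
  | h1 u n =>
    change homActU S (IndSpace S N) (UEA.ι k S.toSubmodule v * u) (D.base n) =
      homAct S (IndSpace S N) v (homActU S (IndSpace S N) u (D.base n))
    rw [map_mul, homActU_ι]
    rfl

/-- The operators are built to satisfy this commutation rule; together with their values on 1 ⊗ N it
determines them. -/
theorem op_smul {i j : ZMod 2} {v : S.toSubmodule} (hv : v ∈ gr k S.toSubmodule i) {A : L}
    (hA : A ∈ gr k L j) (t : IndSpace S N) : D.op A (UEA.ι k S.toSubmodule v • t) =
      sgn k i j • UEA.ι k S.toSubmodule v • D.op A t + D.op (br k A v.1) t := by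
  change D.orbit (UEA.ι k S.toSubmodule v • t) A = _
  rw [orbit_smul, homAct_apply hv hA]
  rfl

theorem op_coe (v : S.toSubmodule) (t : IndSpace S N) :
    D.op v.1 t = UEA.ι k S.toSubmodule v • t := by
  -- All v are treated at once: the step from t to wt uses the claim at t for the bracket [v,w] as
  -- well.
  suffices h : t ∈ (⨅ v : S.toSubmodule, LinearMap.ker (D.op v.1 -
      Algebra.lsmul k k (IndSpace S N) (UEA.ι k S.toSubmodule v))) by
    rw [Submodule.mem_iInf] at h
    exact sub_eq_zero.1 (LinearMap.mem_ker.1 (h v))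
  refine mem_of_smul_mem _ ?_ ?_ t
  · intro n
    rw [Submodule.mem_iInf]
    intro v
    rw [LinearMap.mem_ker, LinearMap.sub_apply, sub_eq_zero]
    change _ = UEA.ι k S.toSubmodule v • (tmul 1 n : IndSpace S N)
    rw [op_one_tmul, D.proj_coe, D.rho_coe, LinearMap.zero_apply, map_zero, add_zero,
      smul_tmul, mul_one]
  · intro j w hw t ht
    rw [Submodule.mem_iInf] at ht ⊢
    have ht' : ∀ v : S.toSubmodule, D.op v.1 t = UEA.ι k S.toSubmodule v • t :=
      fun v => sub_eq_zero.1 (LinearMap.mem_ker.1 (ht v))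
    have key : ∀ i, ∀ v ∈ gr k S.toSubmodule i, D.op v.1 (UEA.ι k S.toSubmodule w • t) =
        UEA.ι k S.toSubmodule v • UEA.ι k S.toSubmodule w • t := by
      intro i v hv
      rw [D.op_smul hw (show v.1 ∈ gr k L i from hv), ht',
        show br k v.1 w.1 = (br k v w : S.toSubmodule).1 from rfl, ht',
        UEA.ι_br hv hw, sub_smul, mul_smul, smul_assoc, mul_smul, sgn_comm]
      abel
    intro v
    obtain ⟨a, ha, b, hb, rfl⟩ := exists_decomp k v
    rw [LinearMap.mem_ker, LinearMap.sub_apply, sub_eq_zero]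
    change _ = UEA.ι k S.toSubmodule (a + b) • UEA.ι k S.toSubmodule w • t
    rw [Submodule.coe_add, map_add, map_add, add_smul, LinearMap.add_apply, key 0 a ha, key 1 b hb]

theorem op_br_coe_right {i j : ZMod 2} {A : L} (hA : A ∈ gr k L i) {v : S.toSubmodule}
    (hv : v ∈ gr k S.toSubmodule j) (t : IndSpace S N) :
    D.op (br k A v.1) t = D.op A (D.op v.1 t) - sgn k i j • D.op v.1 (D.op A t) := by
  rw [op_coe, op_coe, D.op_smul hv hA, sgn_comm]
  abel

theorem op_br_coe_left {i j : ZMod 2} {v : S.toSubmodule} (hv : v ∈ gr k S.toSubmodule i) {B : L}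
    (hB : B ∈ gr k L j) (t : IndSpace S N) :
    D.op (br k v.1 B) t = D.op v.1 (D.op B t) - sgn k i j • D.op B (D.op v.1 t) := by
  have h : br k v.1 B = _ := LieSuper.br_skew (k := k) (show v.1 ∈ gr k L i from hv) hB
  rw [h, map_neg, map_smul, LinearMap.neg_apply, LinearMap.smul_apply, D.op_br_coe_right hB hv,
    smul_sub, smul_smul, sgn_comm j i, sgn_mul_self, one_smul]
  abel

/-- Split A and B into their components in S and in 𝔭. A bracket with a component in S is governed
by the commutation rule, and on 1 ⊗ N the bracket of two components in 𝔭 is governed by the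
representation N. -/
theorem op_br_one_tmul {i j : ZMod 2} {A B : L} (hA : A ∈ gr k L i) (hB : B ∈ gr k L j) (n : N) :
    D.op (br k A B) (tmul 1 n) =
      D.op A (D.op B (tmul 1 n)) - sgn k i j • D.op B (D.op A (tmul 1 n)) := by
  have hd : ∀ A : L, ∃ A', D.proj A' = 0 ∧ A = (D.proj A).1 + A' := fun A =>
    ⟨A - (D.proj A).1, by rw [map_sub, proj_coe, sub_self], by abel⟩
  obtain ⟨A', hA0, hA1⟩ := hd A
  obtain ⟨B', hB0, hB1⟩ := hd B
  have hpA : D.proj A ∈ gr k S.toSubmodule i := D.proj_mem hA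
  have hpB : D.proj B ∈ gr k S.toSubmodule j := D.proj_mem hB
  have hA' : A' ∈ gr k L i := by
    have := (gr k L i).sub_mem hA (D.proj_mem hA)
    rwa [eq_sub_of_add_eq' hA1.symm]
  have hB' : B' ∈ gr k L j := by
    have := (gr k L j).sub_mem hB (D.proj_mem hB)
    rwa [eq_sub_of_add_eq' hB1.symm]
  have e1 := D.op_br_coe_left hpA hB (tmul 1 n)
  have e2 := D.op_br_coe_right hA' hpB (tmul 1 n)
  have e3 : D.op (br k A' B') (tmul 1 n) =
      D.op A' (D.op B' (tmul 1 n)) - sgn k i j • D.op B' (D.op A' (tmul 1 n)) := by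
    simp only [op_one_tmul, hA0, hB0, D.proj_br hA0 hB0, D.rho_br hA' hB' hA0 hB0, map_zero,
      LinearMap.zero_apply, zero_add, LinearMap.sub_apply, LinearMap.smul_apply,
      Module.End.mul_apply, map_sub, map_smul]
  have e4 : br k A B = br k (D.proj A).1 B + (br k A' (D.proj B).1 + br k A' B') := by
    rw [← map_add, ← hB1, ← LinearMap.add_apply, ← map_add, ← hA1]
  have e5 : D.op A = D.op (D.proj A).1 + D.op A' := by rw [← map_add, ← hA1]
  have e6 : D.op B = D.op (D.proj B).1 + D.op B' := by rw [← map_add, ← hB1]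
  rw [e4, map_add, map_add, LinearMap.add_apply, LinearMap.add_apply, e1, e2, e3, e5, e6]
  simp only [LinearMap.add_apply, map_add, smul_add]
  abel

/-- Induction on the vector, starting from 1 ⊗ N. To pass from t to vt, move v to the left past A
and B; by the Jacobi identity what remains is the relation at t for the pairs (A,B), (A,[B,v]) and
(B,[A,v]). This is why the induction runs over all pairs simultaneously. -/
theorem op_br {i j : ZMod 2} {A B : L} (hA : A ∈ gr k L i) (hB : B ∈ gr k L j) :
    D.op (br k A B) = D.op A * D.op B - sgn k i j • (D.op B * D.op A) := by
  suffices h : ∀ t, t ∈ (⨅ i : ZMod 2, ⨅ j : ZMod 2, ⨅ A : gr k L i, ⨅ B : gr k L j,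
      LinearMap.ker (D.op (br k A.1 B.1) - (D.op A.1 * D.op B.1 -
        sgn k i j • (D.op B.1 * D.op A.1)))) by
    ext t
    have h := h t
    simp only [Submodule.mem_iInf] at h
    exact sub_eq_zero.1 (LinearMap.mem_ker.1 (h i j ⟨A, hA⟩ ⟨B, hB⟩))
  clear hA hB
  intro t
  refine mem_of_smul_mem _ ?_ ?_ t
  · intro n
    simp only [Submodule.mem_iInf]
    rintro i j ⟨A, hA⟩ ⟨B, hB⟩
    exact sub_eq_zero.2 (D.op_br_one_tmul hA hB n)
  · intro l v hv t ht
    simp only [Submodule.mem_iInf] at ht ⊢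
    have key : ∀ {i j : ZMod 2} {A B : L}, A ∈ gr k L i → B ∈ gr k L j →
        D.op (br k A B) t = D.op A (D.op B t) - sgn k i j • D.op B (D.op A t) :=
      fun {i j A B} hA hB => sub_eq_zero.1 (LinearMap.mem_ker.1 (ht i j ⟨A, hA⟩ ⟨B, hB⟩))
    rintro i j ⟨A, hA⟩ ⟨B, hB⟩
    have hv' : v.1 ∈ gr k L l := hv
    have hAB : br k A B ∈ _ := LieSuper.br_mem (k := k) hA hB
    have hAv : br k A v.1 ∈ _ := LieSuper.br_mem (k := k) hA hv'
    have hBv : br k B v.1 ∈ _ := LieSuper.br_mem (k := k) hB hv'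
    refine sub_eq_zero.2 ?_
    simp only [LinearMap.sub_apply, LinearMap.smul_apply, Module.End.mul_apply]
    have e1 : br k (br k A B) v.1 = _ := LieSuper.br_jacobi (k := k) hA hB hv'
    rw [D.op_smul hv hAB, D.op_smul hv hA, D.op_smul hv hB, map_add, map_add, (D.op A).map_smul,
      (D.op B).map_smul, D.op_smul hv hA, D.op_smul hv hB, e1, map_sub, map_smul, LinearMap.sub_apply,
      LinearMap.smul_apply, key hA hBv, key hB hAv, key hA hB]
    simp only [sgn_add_right, smul_add, smul_sub]
    rcases zmod_two_cases i with rfl | rfl <;> rcases zmod_two_cases j with rfl | rfl <;>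
      rcases zmod_two_cases l with rfl | rfl <;>
      simp only [sgn_zero_left, sgn_zero_right, sgn_one_one, one_smul, neg_smul, mul_one,
        mul_neg, neg_neg, smul_neg] <;> abel

end InducingDatum

end induced

/-! ### Matrices supported on a transitive relation -/

section patterns

variable {k : Type*} [Field k] {n : ℕ}

/-- The matrix `A` is supported on the relation `r`. -/
def SupportedOn (r : Ix n → Ix n → Prop) (A : gl k n) : Prop := ∀ a c, ¬ r a c → A a c = 0

theorem SupportedOn.mul {r : Ix n → Ix n → Prop} (hr : ∀ a c d, r a c → r c d → r a d)
    {A B : gl k n} (hA : SupportedOn r A) (hB : SupportedOn r B) : SupportedOn r (A * B) := by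
  intro a c h
  rw [Matrix.mul_apply]
  refine Finset.sum_eq_zero fun d _ => ?_
  by_cases h1 : r a d
  · rw [hB d c fun h2 => h (hr _ _ _ h1 h2), mul_zero]
  · rw [hA a d h1, zero_mul]

theorem SupportedOn.oddPart {r : Ix n → Ix n → Prop} {A : gl k n} (hA : SupportedOn r A) :
    SupportedOn r (oddPart A) := by
  intro a c h
  simp [GLSuper.oddPart, hA a c h]

theorem br_eq (A B : gl k n) :
    br k A B = A * B - B * A + (2 : k) • (oddPart B * oddPart A) := rfl

theorem SupportedOn.br {r : Ix n → Ix n → Prop} (hr : ∀ a c d, r a c → r c d → r a d)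
    {A B : gl k n} (hA : SupportedOn r A) (hB : SupportedOn r B) :
    SupportedOn r (GLSuper.br k A B) := by
  intro a c h
  rw [br_eq, Matrix.add_apply, Matrix.sub_apply, Matrix.smul_apply, hA.mul hr hB a c h,
    hB.mul hr hA a c h, hB.oddPart.mul hr hA.oddPart a c h, sub_zero, smul_zero, add_zero]

end patterns

/-! ### Block triangular matrices for the order 1, n+1, J -/

section blocks

variable {m : ℕ}

/-- The position of an index in the order `1, n + 1, J`. -/
def rk : Ix (m + 1) → ℕ
  | Sum.inl i => if i = 0 then 0 else 2
  | Sum.inr i => if i = 0 then 1 else 2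

@[simp] theorem rk_inl : rk (Sum.inl 0 : Ix (m + 1)) = 0 := by simp [rk]
@[simp] theorem rk_inr : rk (Sum.inr 0 : Ix (m + 1)) = 1 := by simp [rk]
@[simp] theorem rk_up (p : Ix m) : rk (up p) = 2 := by
  rcases p with p | p <;> simp [rk, up, Fin.succ_ne_zero]

theorem sum_ix {X : Type*} [AddCommMonoid X] (f : Ix (m + 1) → X) :
    ∑ a, f a = f (Sum.inl 0) + f (Sum.inr 0) + ∑ p, f (up p) := by
  rw [Fintype.sum_sum_type, Fintype.sum_sum_type, Fin.sum_univ_succ, Fin.sum_univ_succ]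
  simp only [up, Sum.map_inl, Sum.map_inr]
  abel

variable (k : Type*) [Field k]

/-- The `J`-block of a matrix. -/
def blockJ (m : ℕ) : gl k (m + 1) →ₗ[k] gl k m where
  toFun A := Matrix.of fun p q => A (up p) (up q)
  map_add' _ _ := rfl
  map_smul' _ _ := rfl

/-- The value of a weight on the diagonal part of the `I`-block of a matrix. -/
def evalI (u : Wt (m + 1)) : gl k (m + 1) →ₗ[k] k where
  toFun A := u (Sum.inl 0) * A (Sum.inl 0) (Sum.inl 0) + u (Sum.inr 0) * A (Sum.inr 0) (Sum.inr 0)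
  map_add' A B := by simp only [Matrix.add_apply]; ring
  map_smul' t A := by simp only [Matrix.smul_apply, smul_eq_mul, RingHom.id_apply]; ring

variable {k}

theorem blockJ_apply (A : gl k (m + 1)) (p q : Ix m) : blockJ k m A p q = A (up p) (up q) := rfl

theorem evalI_apply (u : Wt (m + 1)) (A : gl k (m + 1)) : evalI k u A =
    u (Sum.inl 0) * A (Sum.inl 0) (Sum.inl 0) + u (Sum.inr 0) * A (Sum.inr 0) (Sum.inr 0) := rfl

theorem evalWt_eq (u : Wt (m + 1)) (A : gl k (m + 1)) :
    evalWt k u A = evalI k u A + evalWt k (prJ u) (blockJ k m A) := by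
  change ∑ a, (u a : k) * A a a = _
  rw [sum_ix]
  rfl

theorem blockJ_mem {i : ZMod 2} {A : gl k (m + 1)} (hA : A ∈ gr k (gl k (m + 1)) i) :
    blockJ k m A ∈ gr k (gl k m) i := by
  intro p q h
  exact hA _ _ (by rwa [ipar_up, ipar_up])

theorem blockJ_oddPart (A : gl k (m + 1)) : blockJ k m (oddPart A) = oddPart (blockJ k m A) := by
  ext p q
  simp [blockJ_apply, oddPart, ipar_up]

theorem blockJ_embJ (A : gl k m) : blockJ k m (embJ k m A) = A := by
  ext p q
  rw [blockJ_apply, embJ_up]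

theorem evalI_embJ (u : Wt (m + 1)) (A : gl k m) : evalI k u (embJ k m A) = 0 := by
  rw [evalI_apply, embJ_of_left A up_ne_inl, embJ_of_left A up_ne_inr]
  simp

theorem evalI_odd (u : Wt (m + 1)) {A : gl k (m + 1)} (hA : A ∈ gr k (gl k (m + 1)) 1) :
    evalI k u A = 0 := by
  have h : ∀ p : ZMod 2, p + p ≠ 1 := by decide
  rw [evalI_apply, hA _ _ (h _), hA _ _ (h _)]
  simp

/-- Block upper triangular matrices with respect to the order `1, n + 1, J`. -/
abbrev IsBlockUpper (A : gl k (m + 1)) : Prop := SupportedOn (fun a c => ¬ rk c < rk a) A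

theorem IsBlockUpper.br {A B : gl k (m + 1)} (hA : IsBlockUpper A) (hB : IsBlockUpper B) :
    IsBlockUpper (br k A B) := by
  refine SupportedOn.br ?_ hA hB
  intro a c d; omega

theorem isBlockUpper_embJ (A : gl k m) : IsBlockUpper (embJ k m A) := by
  intro a c h
  rcases ix_cases a with rfl | rfl | ⟨p, rfl⟩
  · exact embJ_of_left A up_ne_inl c
  · exact embJ_of_left A up_ne_inr c
  · rcases ix_cases c with rfl | rfl | ⟨q, rfl⟩
    · exact embJ_of_right A up_ne_inl _
    · exact embJ_of_right A up_ne_inr _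
    · simp at h

theorem blockJ_mul {A : gl k (m + 1)} (hA : IsBlockUpper A) (B : gl k (m + 1)) :
    blockJ k m (A * B) = blockJ k m A * blockJ k m B := by
  ext p q
  rw [blockJ_apply, Matrix.mul_apply, sum_ix, hA (up p) (Sum.inl 0) (by simp),
    hA (up p) (Sum.inr 0) (by simp), zero_mul, zero_mul, zero_add, zero_add, Matrix.mul_apply]
  rfl

theorem blockJ_br {A B : gl k (m + 1)} (hA : IsBlockUpper A) (hB : IsBlockUpper B) :
    blockJ k m (br k A B) = br k (blockJ k m A) (blockJ k m B) := by
  rw [br_eq, br_eq, map_add, map_sub, map_smul, blockJ_mul hA, blockJ_mul hB,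
    blockJ_mul (SupportedOn.oddPart hB), blockJ_oddPart, blockJ_oddPart]

theorem mul_inl {A B : gl k (m + 1)} (hB : IsBlockUpper B) :
    (A * B) (Sum.inl 0) (Sum.inl 0) = A (Sum.inl 0) (Sum.inl 0) * B (Sum.inl 0) (Sum.inl 0) := by
  rw [Matrix.mul_apply, sum_ix, hB (Sum.inr 0) (Sum.inl 0) (by simp),
    Finset.sum_eq_zero fun p _ => by rw [hB (up p) (Sum.inl 0) (by simp), mul_zero]]
  simp

theorem mul_inr {A B : gl k (m + 1)} (hA : IsBlockUpper A) (hB : IsBlockUpper B) :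
    (A * B) (Sum.inr 0) (Sum.inr 0) = A (Sum.inr 0) (Sum.inr 0) * B (Sum.inr 0) (Sum.inr 0) := by
  rw [Matrix.mul_apply, sum_ix, hA (Sum.inr 0) (Sum.inl 0) (by simp),
    Finset.sum_eq_zero fun p _ => by rw [hB (up p) (Sum.inr 0) (by simp), mul_zero]]
  simp

/-- The blocks of 1 and n+1 have size one, so these diagonal entries are multiplicative on block
upper triangular matrices and cancel in a commutator; odd parts have zero diagonal. Thus the weight
on I is a character of 𝔭. There is no conflict with h = [x,y], as y is not in 𝔭. -/
theorem evalI_br (u : Wt (m + 1)) {A B : gl k (m + 1)} (hA : IsBlockUpper A)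
    (hB : IsBlockUpper B) : evalI k u (br k A B) = 0 := by
  rw [evalI_apply, br_eq]
  simp only [Matrix.add_apply, Matrix.sub_apply, Matrix.smul_apply, mul_inl hB, mul_inl hA,
    mul_inr hA hB, mul_inr hB hA, mul_inl (SupportedOn.oddPart hA),
    mul_inr (SupportedOn.oddPart hB) (SupportedOn.oddPart hA)]
  simp [oddPart, ipar, show (1 + 1 : ZMod 2) ≠ 1 by decide]
  ring

/-! ### The decomposition of 𝔤𝔩(n|n) into S and 𝔭, and the representation of 𝔭 on N -/

section lower

variable [CharZero k]

/-- The strictly block lower triangular matrices with respect to the order `1, n + 1, J`. -/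
def lowerSub (k : Type*) [Field k] [CharZero k] (m : ℕ) : LieSuperSub k (gl k (m + 1)) where
  carrier := {A | SupportedOn (fun a c => rk c < rk a) A}
  add_mem' := by
    intro A B hA hB a c h
    simp [hA a c h, hB a c h]
  zero_mem' := by intro a c _; rfl
  smul_mem' := by
    intro t A hA a c h
    simp [hA a c h]
  pinv_mem := by
    intro A hA a c h
    rw [pinv_entry, hA a c h, mul_zero]
  br_mem := by
    intro A B hA hB
    refine SupportedOn.br ?_ hA hB
    intro a c d; omega

/-- The projection to the strictly block lower triangular matrices. -/
def lowerProj (k : Type*) [Field k] [CharZero k] (m : ℕ) : gl k (m + 1) →ₗ[k] (lowerSub k m).toSubmodule where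
  toFun A := ⟨Matrix.of fun a c => if rk c < rk a then A a c else 0, by
    intro a c h
    simp [h]⟩
  map_add' A B := by
    ext a c
    by_cases h : rk c < rk a <;> simp [h]
  map_smul' t A := by
    ext a c
    by_cases h : rk c < rk a <;> simp [h]

theorem lowerProj_apply (A : gl k (m + 1)) (a c : Ix (m + 1)) :
    (lowerProj k m A).1 a c = if rk c < rk a then A a c else 0 := rfl

theorem lowerProj_eq_zero {A : gl k (m + 1)} : lowerProj k m A = 0 ↔ IsBlockUpper A := by
  constructor
  · intro h a c hac
    have h2 := congrFun (congrFun (congrArg Subtype.val h) a) c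
    rw [lowerProj_apply, if_pos (not_not.1 hac)] at h2
    exact h2
  · intro h
    ext a c
    rw [lowerProj_apply]
    split_ifs with h1
    · exact h a c (not_not.2 h1)
    · rfl

/-- The datum that induces a representation of the block upper triangular matrices, on which the
`I`-block acts through a weight. -/
def inducingDatum (u : Wt (m + 1)) (N : Type*) [AddCommGroup N] [Module k N] [SuperSpace k N]
    [LieSuperRep k (gl k m) N] : InducingDatum (lowerSub k m) N where
  proj := lowerProj k m
  proj_coe := by
    rintro ⟨A, hA⟩
    ext a c
    rw [lowerProj_apply]
    split_ifs with h
    · rfl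
    · exact (hA a c h).symm
  proj_mem := by
    intro i A hA a c h
    rw [lowerProj_apply, hA a c h, ite_self]
  proj_br := by
    intro A B hA hB
    rw [lowerProj_eq_zero] at *
    exact hA.br hB
  rho := (act k N).comp (blockJ k m) + (LinearMap.lsmul k N).comp (evalI k u)
  rho_coe := by
    rintro ⟨A, hA⟩
    have h1 : blockJ k m A = 0 := by
      ext p q
      exact hA _ _ (by simp)
    have h2 : evalI k u A = 0 := by
      rw [evalI_apply, hA _ _ (by simp), hA _ _ (by simp)]
      simp
    ext v
    simp [h1, h2]
  rho_br := by
    intro i j A B hA hB hA0 hB0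
    rw [lowerProj_eq_zero] at hA0 hB0
    ext v
    have h := LieSuperRep.act_br (k := k) v (blockJ_mem hA) (blockJ_mem hB)
    -- If one argument is even, the bracket acts as an ordinary commutator and the scalars cancel.
    -- An anticommutator would see them, but they vanish on odd matrices.
    rcases zmod_two_cases i with rfl | rfl
    · simp [blockJ_br hA0 hB0, evalI_br u hA0 hB0, h, sgn_zero_left, smul_smul, mul_comm]
      abel
    · rcases zmod_two_cases j with rfl | rfl
      · simp [blockJ_br hA0 hB0, evalI_br u hA0 hB0, h, sgn_zero_right, smul_smul, mul_comm]
        abel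
      · simp [blockJ_br hA0 hB0, evalI_br u hA0 hB0, h, evalI_odd u hA, evalI_odd u hB]

theorem inducingDatum_rho (u : Wt (m + 1)) (N : Type*) [AddCommGroup N] [Module k N]
    [SuperSpace k N] [LieSuperRep k (gl k m) N] (A : gl k (m + 1)) (v : N) :
    (inducingDatum u N).rho A v = act k N (blockJ k m A) v + evalI k u A • v := rfl

end lower

end blocks

/-! ### The Borel subalgebra ()⋆𝔟, its simple root ε_1 - δ_1, and atypicality -/

section combinatorics

variable {m : ℕ} (b : BoxPartition m)

namespace BoxPartition

theorem star_part_last : ((empty 1).star b).part (Fin.last m) = 0 := by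
  simp [star, empty]

theorem star_part_rev_succ (i : Fin m) :
    ((empty 1).star b).part (Fin.rev i.succ) = b.part i.rev + 1 := by
  rw [Fin.rev_succ]
  simp [star]

theorem star_pos_up (p q : Ix m) : ((empty 1).star b).pos (up p) (up q) ↔ b.pos p q := by
  rcases p with p | p <;> rcases q with q | q <;>
    simp [up, pos, star_part_rev_succ]

theorem star_pos_of_lt {a c : Ix (m + 1)} (h : rk a < rk c) : ((empty 1).star b).pos a c := by
  rcases ix_cases a with rfl | rfl | ⟨p, rfl⟩ <;>
    rcases ix_cases c with rfl | rfl | ⟨q, rfl⟩ <;> simp at h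
  · simp [pos, star_part_last]
  · rcases q with q | q <;> simp [up, pos, star_part_last]
  · rcases q with q | q <;> simp [up, pos, star_part_rev_succ]

theorem star_not_pos_of_lt {a c : Ix (m + 1)} (h : rk c < rk a) :
    ¬ ((empty 1).star b).pos a c := by
  rcases ix_cases a with rfl | rfl | ⟨p, rfl⟩ <;>
    rcases ix_cases c with rfl | rfl | ⟨q, rfl⟩ <;> simp at h
  · simp [pos, star_part_last]
  · rcases p with q | q <;> simp [up, pos, star_part_last]
  · rcases p with q | q <;> simp [up, pos, star_part_rev_succ]

theorem star_empty_bo : (empty 1).star (bo m) = bo (m + 1) := by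
  have h : ∀ b c : BoxPartition (m + 1), b.part = c.part → b = c := by
    rintro ⟨_, _, _⟩ ⟨_, _, _⟩ rfl; rfl
  apply h
  funext r
  induction r using Fin.lastCases with
  | last => simp [star, empty, bo, hypercube]
  | cast r =>
    have := r.isLt
    simp [star, bo, hypercube, Fin.val_rev]
    omega

variable {b}

/-- The εδ-sequence of ()⋆𝔟 begins with ε_1, δ_1 and continues with the sequence of 𝔟 on J. This
places the Borel inside 𝔭 and so allows induction in stages. -/
theorem mem_star_borel {k : Type*} [Field k] {A : gl k (m + 1)} :
    A ∈ ((empty 1).star b).borel k ↔ IsBlockUpper A ∧ blockJ k m A ∈ b.borel k := by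
  constructor
  · intro h
    refine ⟨fun a c hac => h a c ?_ (star_not_pos_of_lt b (not_not.1 hac)), fun p q hpq hb => ?_⟩
    · rintro rfl; exact hac (lt_irrefl _)
    · exact h _ _ (up_injective.ne hpq) (by rwa [star_pos_up])
  · rintro ⟨h1, h2⟩ a c hac hp
    by_cases h : rk c < rk a
    · exact h1 a c (not_not.2 h)
    · have h3 : ¬ rk a < rk c := fun h4 => hp (star_pos_of_lt b h4)
      rcases ix_cases a with rfl | rfl | ⟨p, rfl⟩ <;>
        rcases ix_cases c with rfl | rfl | ⟨q, rfl⟩ <;> simp at h h3 hac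
      exact h2 p q (fun e => hac (congrArg up e)) (by rwa [star_pos_up] at hp)

variable (b)

/-- Boundaries [x,C] have zero J-block, so the J-block of a cycle depends only on its class; it
recovers the matrix from which the class comes. -/
theorem dsBorel_star (k : Type*) [Field k] : dsBorel k ((empty 1).star b) = b.borel k := by
  ext A
  constructor
  · rintro ⟨⟨B, hB⟩, hBb, h⟩
    have h' := sub_eq_zero.2 h
    have h2 := (map_sub (DS.mk (rootVec k m) (gl k (m + 1))) _ _).trans h'
    obtain ⟨C, hC⟩ := (DS.mk_eq_zero _ _).1 h2
    have hC' : br k (rootVec k m).val C = B - embJ k m A := hC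
    have hA : A = blockJ k m B := by
      ext p q
      have h3 := congrFun (congrFun hC' (up p)) (up q)
      rw [br_rootVec, Matrix.sub_apply, embJ_up] at h3
      simp only [up_ne_inl, up_ne_inr, if_false, sub_zero] at h3
      exact (sub_eq_zero.1 h3.symm).symm
    rw [hA]
    exact (mem_star_borel.1 hBb).2
  · intro hA
    refine ⟨⟨embJ k m A, ?_⟩, ?_, rfl⟩
    · change br k (rootVec k m).val (embJ k m A) = 0
      ext a c
      rw [br_rootVec, embJ_of_left _ up_ne_inr, embJ_of_right _ up_ne_inl]
      simp
    · exact mem_star_borel.2 ⟨isBlockUpper_embJ A, (blockJ_embJ A).symm ▸ hA⟩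

/-- No index lies strictly between 1 and n+1 in the order of the Borel, whereas a sum of two
positive roots equal to ε_1 - δ_1 would have to pass through such an index. -/
theorem star_isSimpleRoot : ((empty 1).star b).IsSimpleRoot (Sum.inl 0) (Sum.inr 0) := by
  have hirr : ∀ a, ¬ ((empty 1).star b).pos a a := by
    rintro (a | a) <;> exact lt_irrefl _
  have hchain : ∀ q, ((empty 1).star b).pos (Sum.inl 0) q →
      ¬ ((empty 1).star b).pos q (Sum.inr 0) := by
    intro q h1 h2
    rcases ix_cases q with rfl | rfl | ⟨q, rfl⟩
    · exact hirr _ h1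
    · exact hirr _ h2
    · exact star_not_pos_of_lt b (by simp) h2
  refine ⟨star_pos_of_lt b (by simp), ?_⟩
  rintro ⟨p, q, r, s, h1, h2, h⟩
  have hpq : p ≠ q := by rintro rfl; exact hirr _ h1
  have hrs : r ≠ s := by rintro rfl; exact hirr _ h2
  have hx : ∀ x, (if x = p then (1 : ℤ) else 0) - (if x = q then 1 else 0) +
      ((if x = r then 1 else 0) - if x = s then 1 else 0) =
      (if x = Sum.inl 0 then 1 else 0) - if x = Sum.inr 0 then 1 else 0 := by
    intro x
    have := congrFun h x
    simpa [root, Pi.single_apply] using this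
  have e0 := hx (Sum.inl 0)
  have e1 := hx (Sum.inr 0)
  simp only [reduceCtorEq, if_true, if_false] at e0 e1
  have hp : p = Sum.inl 0 ∨ r = Sum.inl 0 := by
    by_contra! hc
    rw [if_neg hc.1.symm, if_neg hc.2.symm] at e0
    split_ifs at e0 <;> omega
  have hs : s = Sum.inr 0 ∨ q = Sum.inr 0 := by
    by_contra! hc
    rw [if_neg hc.1.symm, if_neg hc.2.symm] at e1
    split_ifs at e1 <;> omega
  -- Either the two roots share an intermediate index, which `hchain` excludes, or one of them is
  -- already ε_1 - δ_1 and the other would be zero.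
  rcases hp with rfl | rfl <;> rcases hs with rfl | rfl
  · have e2 := hx q
    have hqr : q = r := by
      by_contra hqr
      simp [hqr, hpq.symm] at e2
    exact hchain q h1 (hqr ▸ h2)
  · have e2 := hx r
    simp [hrs] at e2
  · have e2 := hx p
    simp [hpq] at e2
  · have e2 := hx s
    have hsp : s = p := by
      by_contra hsp
      simp [hsp, hrs.symm] at e2
    exact hchain s h2 (hsp ▸ h1)

/-- Here ρ_0 = 0, and ρ_1 = (ε_1 - δ_1)/2 is cancelled by half the Berezinian weight. -/
theorem rho_empty_one : (empty 1).rho = 0 := by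
  funext a
  rcases a with a | a <;> rw [Subsingleton.elim a 0] <;>
    simp [rho, rho0, rho1, ber, pos, empty, ipar, root, Wt.toRat, ZMod.val_one]

theorem form_oddRoot {n : ℕ} (u : Ix n → ℚ) (s : Fin n × Fin n) :
    form u (oddRoot s) = u (Sum.inl s.1) + u (Sum.inr s.2) := by
  simp [form, oddRoot, Wt.toRat, root, ipar, Pi.single_apply, ZMod.val_one, Fintype.sum_sum_type]

/-- With ρ = 0 and a single odd root up to sign, only the pairing with ε_1 - δ_1 matters. It is a
sum of coordinates since (δ_1,δ_1) = -1. -/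
theorem isAtypical_prI (u : Wt (m + 1)) : (empty 1).IsAtypical (prI u) ↔
    u (Sum.inl 0) + u (Sum.inr 0) = 0 := by
  have hform : ∀ s, form ((prI u).toRat + (empty 1).rho) (oddRoot s) =
      ((u (Sum.inl 0) + u (Sum.inr 0) : ℤ) : ℚ) := by
    intro s
    rw [rho_empty_one, add_zero, form_oddRoot]
    simp [Wt.toRat, prI]
  rw [IsAtypical, atypicality]
  constructor
  · intro h
    by_contra hne
    apply h
    refine (Finset.sup_eq_bot_iff _ _).2 fun S hS => ?_
    change S.card = 0
    rw [Finset.mem_filter] at hS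
    rw [Finset.card_eq_zero, Finset.eq_empty_iff_forall_notMem]
    intro s hs
    have := hS.2.1 s hs
    rw [hform, Int.cast_eq_zero] at this
    exact hne this
  · intro h
    refine (Nat.pos_iff_ne_zero).1 (lt_of_lt_of_le Nat.zero_lt_one ?_)
    refine Finset.le_sup (f := Finset.card) (b := {((0 : Fin 1), (0 : Fin 1))}) ?_
    rw [Finset.mem_filter]
    refine ⟨Finset.mem_univ _, fun s _ => by rw [hform, h, Int.cast_zero], ?_⟩
    intro s hs t ht hst
    rw [Finset.mem_singleton] at hs ht
    exact absurd (hs.trans ht.symm) hst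

theorem form_toRat_root (u : Wt (m + 1)) : form u.toRat (root (Sum.inl 0) (Sum.inr 0)).toRat = 0 ↔
    u (Sum.inl 0) + u (Sum.inr 0) = 0 := by
  rw [show (root (Sum.inl 0) (Sum.inr 0) : Wt (m + 1)).toRat = oddRoot (0, 0) from rfl,
    form_oddRoot, ← Int.cast_eq_zero (α := ℚ), Int.cast_add]
  rfl

end BoxPartition
end combinatorics

/-! ### Sign rules in supermodules -/

section supermodules

variable {k L V : Type*} [Field k] [AddCommGroup L] [Module k L] [LieSuper k L]
  [AddCommGroup V] [Module k V] [SuperSpace k V] [LieSuperRep k L V]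

theorem pinv_act {i : ZMod 2} {A : L} (hA : A ∈ gr k L i) (v : V) :
    pinv k V (act k V A v) = sgn k 1 i • act k V A (pinv k V v) := by
  have h : ∀ j, ∀ v ∈ gr k V j, pinv k V (act k V A v) = sgn k 1 i • act k V A (pinv k V v) := by
    intro j v hv
    rw [pinv_gr hv, pinv_gr (LieSuperRep.act_mem hA hv), sgn_add_right, map_smul, smul_smul]
  obtain ⟨a, ha, b, hb, rfl⟩ := exists_decomp k v
  simp only [map_add, smul_add, h 0 a ha, h 1 b hb]

theorem act_act_eq {i j : ZMod 2} {A B : L} (hA : A ∈ gr k L i) (hB : B ∈ gr k L j) (v : V) :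
    act k V A (act k V B v) = sgn k i j • act k V B (act k V A v) + act k V (br k A B) v := by
  have h : act k V (br k A B) v = _ := LieSuperRep.act_br v hA hB
  rw [h]
  abel

end supermodules

theorem mem_gr_of_pinv {k V : Type*} [Field k] [CharZero k] [AddCommGroup V] [Module k V]
    [SuperSpace k V] {i : ZMod 2} {v : V} (h : pinv k V v = sgn k 1 i • v) :
    v ∈ gr k V i := by
  obtain ⟨a, ha, b, hb, rfl⟩ := exists_decomp k v
  rw [map_add, pinv_zero ha, pinv_one hb] at h
  have h2 : (2 : k) ≠ 0 := two_ne_zero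
  rcases zmod_two_cases i with rfl | rfl
  · rw [sgn_zero_right, one_smul] at h
    have h3 : (2 : k) • b = 0 := by
      rw [two_smul]
      calc b + b = (a + b) - (a + -b) := by abel
        _ = 0 := by rw [h, sub_self]
    rw [(smul_eq_zero.1 h3).resolve_left h2, add_zero]
    exact ha
  · rw [sgn_one_one, neg_one_smul] at h
    have h3 : (2 : k) • a = 0 := by
      rw [two_smul]
      calc a + a = (a + -b) + (a + b) := by abel
        _ = 0 := by rw [h, neg_add_cancel]
    rw [(smul_eq_zero.1 h3).resolve_left h2, zero_add]
    exact hb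

/-! ### Universal property and generation of Verma modules -/

namespace IndVerma

variable {k : Type*} [Field k] {n : ℕ} (b : BoxPartition n) (u : Wt n)

variable (k) in
/-- The highest weight vector of `Ind_𝔟^𝔤 k_λ`. -/
noncomputable def gen : IndVerma k b u := mkₗ b u 1

variable {P : Type*} [AddCommGroup P] [Module k P] (f : gl k n →ₗ[k] Module.End k P)
  (hf : ∀ (i j : ZMod 2) (x y : gl k n), x ∈ gr k (gl k n) i → y ∈ gr k (gl k n) j →
    f (br k x y) = f x * f y - sgn k i j • (f y * f x))
  (p : P) (hp : ∀ A ∈ b.borel k, f A p = evalWt k u A • p)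

variable {b u} in
theorem lift_apply_eq_zero (hp : ∀ A ∈ b.borel k, f A p = evalWt k u A • p)
    {z : UEA k (gl k n)} (hz : z ∈ vermaIdeal k b u) : UEA.lift f hf z p = 0 := by
  induction hz using Submodule.span_induction with
  | mem z hz =>
    obtain ⟨A, hA, rfl⟩ := hz
    rw [map_sub, UEA.lift_ι, AlgHom.commutes, LinearMap.sub_apply, hp A hA,
      Module.algebraMap_end_apply, sub_self]
  | zero => rw [map_zero, LinearMap.zero_apply]
  | add y z _ _ hy hz => rw [map_add, LinearMap.add_apply, hy, hz, add_zero]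
  | smul t z _ hz => rw [smul_eq_mul, map_mul, Module.End.mul_apply, hz, map_zero]

/-- The universal property of `Ind_𝔟^𝔤 k_λ`. -/
noncomputable def desc : IndVerma k b u →ₗ[k] P :=
  (((vermaIdeal k b u).restrictScalars k).liftQ
    ((LinearMap.applyₗ p).comp (UEA.lift f hf).toLinearMap)
    fun _ hz => lift_apply_eq_zero f hf p hp hz).comp
  (Submodule.Quotient.restrictScalarsEquiv k (vermaIdeal k b u)).symm.toLinearMap

theorem desc_mkₗ (z : UEA k (gl k n)) : desc b u f hf p hp (mkₗ b u z) = UEA.lift f hf z p := rfl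

theorem desc_gen : desc b u f hf p hp (gen k b u) = p := by
  rw [gen, desc_mkₗ, map_one, Module.End.one_apply]

variable [CharZero k]

theorem act_mkₗ (A : gl k n) (z : UEA k (gl k n)) :
    act k (IndVerma k b u) A (mkₗ b u z) = mkₗ b u (UEA.ι k _ A * z) := rfl

variable {b} in
theorem act_gen {A : gl k n} (hA : A ∈ b.borel k) :
    act k (IndVerma k b u) A (gen k b u) = evalWt k u A • gen k b u := by
  rw [gen, act_mkₗ, mul_one, ← map_smul, ← sub_eq_zero, ← map_sub, mkₗ_eq_zero,
    ← Algebra.algebraMap_eq_smul_one]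
  exact Submodule.subset_span ⟨A, hA, rfl⟩

theorem gen_mem : gen k b u ∈ gr k (IndVerma k b u) 0 :=
  ⟨1, UEA.mem_gr.2 (by rw [map_one, sgn_zero_right, one_smul]), rfl⟩

/-- A subspace that contains the highest weight vector and is stable under the action is
everything. -/
theorem mem_of_act_mem (T : Submodule k (IndVerma k b u)) (h1 : gen k b u ∈ T)
    (hm : ∀ i, ∀ A ∈ gr k (gl k n) i, ∀ t ∈ T, act k _ A t ∈ T) (t : IndVerma k b u) : t ∈ T := by
  obtain ⟨z, rfl⟩ := mkₗ_surjective b u t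
  have h := UEA.eq_top_of_mul_mem (T.comap (mkₗ b u)) h1 (by
    intro A z hz
    obtain ⟨c, hc, d, hd, rfl⟩ := exists_decomp k A
    have := T.add_mem (hm 0 c hc _ hz) (hm 1 d hd _ hz)
    rwa [← LinearMap.add_apply, ← map_add, act_mkₗ] at this)
  have : z ∈ (⊤ : Submodule k (UEA k (gl k n))) := trivial
  rw [← h] at this
  exact this

theorem desc_act (A : gl k n) (t : IndVerma k b u) :
    desc b u f hf p hp (act k _ A t) = f A (desc b u f hf p hp t) := by
  obtain ⟨z, rfl⟩ := mkₗ_surjective b u t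
  rw [act_mkₗ, desc_mkₗ, desc_mkₗ, map_mul, UEA.lift_ι, Module.End.mul_apply]

end IndVerma

theorem apply_eq_zero_of_add {k : Type*} [Field k] {n : ℕ} {A B : gl k n}
    (hA : A ∈ gr k (gl k n) 0) (hB : B ∈ gr k (gl k n) 1) {a c : Ix n} (h : (A + B) a c = 0) :
    A a c = 0 ∧ B a c = 0 := by
  rw [Matrix.add_apply] at h
  rcases zmod_two_cases (ipar a + ipar c) with h1 | h1
  · have := hB a c (by rw [h1]; decide)
    rw [this, add_zero] at h
    exact ⟨h, this⟩
  · have := hA a c (by rw [h1]; decide)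
    rw [this, zero_add] at h
    exact ⟨this, h⟩

/-! ### Comparison of the Verma module M with the induced module U(S) ⊗ N -/

section comparison

variable {k : Type*} [Field k] [CharZero k] {m : ℕ} (b : BoxPartition m) (u : Wt (m + 1))

/-- The Verma module of `𝔤𝔩(m+1|m+1)`. -/
local notation "MM" => IndVerma k (BoxPartition.star (BoxPartition.empty 1) b) u
/-- The Verma module of `𝔤𝔩(m|m)`. -/
local notation "NN" => IndVerma k b (prJ u)
local notation "DD" => inducingDatum u NN
local notation "XX" => IndSpace (lowerSub k m) NN

theorem act_star_gen {A : gl k (m + 1)} (hA : IsBlockUpper A) (hA' : blockJ k m A ∈ b.borel k) :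
    act k MM A (IndVerma.gen k _ u) = evalWt k u A • IndVerma.gen k _ u :=
  IndVerma.act_gen u (BoxPartition.mem_star_borel.2 ⟨hA, hA'⟩)

variable (k) in
/-- The `𝔤𝔩(J)`-homomorphism that preserves highest weight vectors. -/
noncomputable def emb : NN →ₗ[k] MM :=
  IndVerma.desc b (prJ u) ((act k MM).comp (embJ k m))
    (fun i j x y hx hy => by
      ext v
      simp only [LinearMap.comp_apply, embJ_br]
      exact LieSuperRep.act_br v (embJ_mem hx) (embJ_mem hy))
    (IndVerma.gen k _ u) (fun A hA => by
      have h := act_star_gen b u (isBlockUpper_embJ A) (by rwa [blockJ_embJ])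
      rw [evalWt_eq, evalI_embJ, blockJ_embJ, zero_add] at h
      exact h)

theorem emb_gen : emb k b u (IndVerma.gen k b (prJ u)) = IndVerma.gen k _ u :=
  IndVerma.desc_gen _ _ _ _ _ _

theorem emb_act (A : gl k m) (n : NN) :
    emb k b u (act k NN A n) = act k MM (embJ k m A) (emb k b u n) :=
  IndVerma.desc_act _ _ _ _ _ _ A n

/-- The image of N is a 𝔭-submodule of M of the expected kind. For matrices with zero J-block this
spreads from the highest weight vector by 𝔤𝔩(J): their brackets with 𝔤𝔩(J) again have zero J-block,
and the weight on I vanishes on these brackets. -/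
theorem act_emb {A : gl k (m + 1)} (hA : IsBlockUpper A) (n : NN) :
    act k MM A (emb k b u n) = emb k b u ((DD).rho A n) := by
  have key : ∀ A : gl k (m + 1), IsBlockUpper A → blockJ k m A = 0 → ∀ n : NN,
      act k MM A (emb k b u n) = evalI k u A • emb k b u n := by
    have hom : ∀ n : NN, n ∈ (⨅ i : ZMod 2, ⨅ A : gr k (gl k (m + 1)) i,
        ⨅ _ : IsBlockUpper A.1, ⨅ _ : blockJ k m A.1 = 0,
        LinearMap.ker ((act k MM A.1 - evalI k u A.1 • LinearMap.id).comp (emb k b u))) := by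
      refine IndVerma.mem_of_act_mem b (prJ u) _ ?_ ?_
      · simp only [Submodule.mem_iInf]
        rintro i ⟨A, _⟩ h1 h2
        refine sub_eq_zero.2 ?_
        change act k MM A (emb k b u (IndVerma.gen k b (prJ u))) =
          evalI k u A • emb k b u (IndVerma.gen k b (prJ u))
        rw [emb_gen, act_star_gen b u h1 (h2 ▸ Submodule.zero_mem _), evalWt_eq,
          show blockJ k m A = 0 from h2, map_zero, add_zero]
      · intro j B hB n hn
        simp only [Submodule.mem_iInf] at hn ⊢
        rintro i ⟨A, hA⟩ h1 h2
        have hn' : ∀ {i} {A : gl k (m + 1)}, A ∈ gr k (gl k (m + 1)) i → IsBlockUpper A →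
            blockJ k m A = 0 → act k MM A (emb k b u n) = evalI k u A • emb k b u n :=
          fun {i A} hA h1 h2 => sub_eq_zero.1 (LinearMap.mem_ker.1 (hn i ⟨A, hA⟩ h1 h2))
        refine sub_eq_zero.2 ?_
        change act k MM A (emb k b u (act k NN B n)) = evalI k u A • emb k b u (act k NN B n)
        have hB' := isBlockUpper_embJ B
        have h3 : blockJ k m (br k A (embJ k m B)) = 0 := by
          rw [blockJ_br h1 hB', show blockJ k m A = 0 from h2, map_zero, LinearMap.zero_apply]
        rw [emb_act, act_act_eq hA (embJ_mem hB), hn' hA h1 h2,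
          hn' (LieSuper.br_mem (k := k) hA (embJ_mem hB)) (h1.br hB') h3, evalI_br u h1 hB',
          zero_smul, add_zero, map_smul]
        rcases zmod_two_cases i with rfl | rfl
        · rw [sgn_zero_left, one_smul]
        · rw [evalI_odd u hA, zero_smul, smul_zero]
    have hom' : ∀ {i} {A : gl k (m + 1)}, A ∈ gr k (gl k (m + 1)) i → IsBlockUpper A →
        blockJ k m A = 0 → ∀ n, act k MM A (emb k b u n) = evalI k u A • emb k b u n := by
      intro i A hA h1 h2 n
      have h := hom n
      simp only [Submodule.mem_iInf] at h
      exact sub_eq_zero.1 (LinearMap.mem_ker.1 (h i ⟨A, hA⟩ h1 h2))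
    intro A hA hA0 n
    obtain ⟨a, ha, c, hc, rfl⟩ := exists_decomp k A
    have h0 := fun p q => apply_eq_zero_of_add ha hc (a := p) (c := q)
    rw [map_add, LinearMap.add_apply,
      hom' ha (fun p q h => (h0 p q (hA p q h)).1)
        (by ext p q; exact (h0 _ _ (congrFun (congrFun hA0 p) q)).1),
      hom' hc (fun p q h => (h0 p q (hA p q h)).2)
        (by ext p q; exact (h0 _ _ (congrFun (congrFun hA0 p) q)).2), map_add, add_smul]
  -- Subtracting the J-block reduces to `key`; the J-block itself acts through `emb_act`.
  have h := key (A - embJ k m (blockJ k m A)) (by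
    intro a c hac
    rw [Matrix.sub_apply, hA a c hac, isBlockUpper_embJ _ a c hac, sub_zero])
    (by rw [map_sub, blockJ_embJ, sub_self]) n
  rw [map_sub, LinearMap.sub_apply, ← emb_act, map_sub, evalI_embJ, sub_zero, sub_eq_iff_eq_add'] at h
  rw [h, inducingDatum_rho, map_add, map_smul]

variable (k) in
/-- The map from the Verma module to the explicit induced module. -/
noncomputable def toInd : MM →ₗ[k] XX :=
  IndVerma.desc _ u (DD).op (fun _ _ _ _ => (DD).op_br) (IndSpace.tmul 1 (IndVerma.gen k b (prJ u)))
    (fun A hA => by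
      obtain ⟨h1, h2⟩ := BoxPartition.mem_star_borel.1 hA
      have h3 : (DD).proj A = 0 := lowerProj_eq_zero.2 h1
      rw [InducingDatum.op_one_tmul, h3, map_zero, map_zero, LinearMap.zero_apply, zero_add,
        inducingDatum_rho, IndVerma.act_gen _ h2, ← add_smul, map_smul, evalWt_eq]
      exact congrArg (· • _) (add_comm _ _))

theorem toInd_gen : toInd k b u (IndVerma.gen k _ u) =
    IndSpace.tmul 1 (IndVerma.gen k b (prJ u)) :=
  IndVerma.desc_gen _ _ _ _ _ _

theorem toInd_act (A : gl k (m + 1)) (t : MM) :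
    toInd k b u (act k MM A t) = (DD).op A (toInd k b u t) :=
  IndVerma.desc_act _ _ _ _ _ _ A t

/-- This detects elements of the image of N inside M, and is the source of the injectivity of
`embPair`. -/
theorem toInd_emb (n : NN) : toInd k b u (emb k b u n) = IndSpace.tmul 1 n := by
  refine IndVerma.mem_of_act_mem b (prJ u)
    (LinearMap.eqLocus ((toInd k b u).comp (emb k b u)) (IndSpace.tmul 1)) ?_ ?_ n
  · exact (congrArg _ (emb_gen b u)).trans (toInd_gen b u)
  · intro i A _ n hn
    have hn' : toInd k b u (emb k b u n) = IndSpace.tmul 1 n := hn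
    change toInd k b u (emb k b u _) = IndSpace.tmul 1 _
    have h3 : (DD).proj (embJ k m A) = 0 := lowerProj_eq_zero.2 (isBlockUpper_embJ A)
    rw [emb_act, toInd_act, hn', InducingDatum.op_one_tmul, h3, inducingDatum_rho, blockJ_embJ,
      evalI_embJ, map_zero, map_zero, LinearMap.zero_apply, zero_add, zero_smul, add_zero]

variable (k) in
/-- The action of the enveloping algebra of the strictly block lower triangular matrices. -/
noncomputable def lowerAct : UEA k (lowerSub k m).toSubmodule →ₐ[k] Module.End k MM :=
  UEA.lift ((act k MM).comp (lowerSub k m).toSubmodule.subtype) fun i j x y hx hy => by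
    ext v
    exact LieSuperRep.act_br (k := k) (L := gl k (m + 1)) v hx hy

theorem lowerAct_ι (v : (lowerSub k m).toSubmodule) :
    lowerAct k b u (UEA.ι k _ v) = act k MM v.1 := UEA.lift_ι _ _ _

variable (k) in
/-- The map from the explicit induced module to the Verma module. -/
noncomputable def ofInd : XX →ₗ[k] MM :=
  IndSpace.lift ((LinearMap.lcomp k _ (emb k b u)).comp (lowerAct k b u).toLinearMap)

theorem ofInd_tmul (z : UEA k (lowerSub k m).toSubmodule) (n : NN) :
    ofInd k b u (IndSpace.tmul z n) = lowerAct k b u z (emb k b u n) := rfl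

theorem ofInd_smul (v : (lowerSub k m).toSubmodule) (t : XX) :
    ofInd k b u (UEA.ι k _ v • t) = act k MM v.1 (ofInd k b u t) := by
  induction t using IndSpace.induction with
  | h0 => rw [smul_zero, map_zero, map_zero]
  | h2 a c ha hc => rw [smul_add, map_add, map_add, map_add, ha, hc]
  | h1 z n =>
    rw [IndSpace.smul_tmul, ofInd_tmul, ofInd_tmul, map_mul, lowerAct_ι, Module.End.mul_apply]

/-- On 1 ⊗ N the component of A in S acts by the definition of `ofInd`, and the component in 𝔭 by
`act_emb`. The commutation rule past S is the same on both sides, which carries the claim to all of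
U(S) ⊗ N. -/
theorem ofInd_op (A : gl k (m + 1)) (t : XX) :
    ofInd k b u ((DD).op A t) = act k MM A (ofInd k b u t) := by
  suffices h : ∀ t, t ∈ (⨅ i : ZMod 2, ⨅ A : gr k (gl k (m + 1)) i,
      LinearMap.ker ((ofInd k b u).comp ((DD).op A.1) - (act k MM A.1).comp (ofInd k b u))) by
    have key : ∀ i, ∀ A ∈ gr k (gl k (m + 1)) i,
        ofInd k b u ((DD).op A t) = act k MM A (ofInd k b u t) := by
      intro i A hA
      have h := h t
      simp only [Submodule.mem_iInf] at h
      exact sub_eq_zero.1 (LinearMap.mem_ker.1 (h i ⟨A, hA⟩))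
    obtain ⟨a, ha, c, hc, rfl⟩ := exists_decomp k A
    simp only [map_add, LinearMap.add_apply, key 0 a ha, key 1 c hc]
  refine IndSpace.mem_of_smul_mem _ ?_ ?_
  · intro n
    simp only [Submodule.mem_iInf]
    rintro i ⟨A, hA⟩
    refine sub_eq_zero.2 ?_
    change ofInd k b u ((DD).op A _) = act k MM A (ofInd k b u _)
    have h2 : IsBlockUpper (A - (lowerProj k m A).1) := by
      rw [← lowerProj_eq_zero, map_sub]
      exact sub_eq_zero.2 ((DD).proj_coe _).symm
    have h3 : (DD).rho (A - (lowerProj k m A).1) = (DD).rho A := by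
      rw [map_sub, (DD).rho_coe, sub_zero]
    have h4 := act_emb b u h2 n
    rw [h3, map_sub, LinearMap.sub_apply, sub_eq_iff_eq_add] at h4
    rw [InducingDatum.op_one_tmul, map_add, ofInd_tmul, ofInd_tmul, ofInd_tmul, lowerAct_ι, map_one,
      Module.End.one_apply, Module.End.one_apply, h4]
    exact add_comm _ _
  · intro j v hv t ht
    simp only [Submodule.mem_iInf] at ht ⊢
    have key : ∀ i, ∀ A ∈ gr k (gl k (m + 1)) i,
        ofInd k b u ((DD).op A t) = act k MM A (ofInd k b u t) :=
      fun i A hA => sub_eq_zero.1 (LinearMap.mem_ker.1 (ht i ⟨A, hA⟩))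
    rintro i ⟨A, hA⟩
    refine sub_eq_zero.2 ?_
    change ofInd k b u ((DD).op A _) = act k MM A (ofInd k b u _)
    have hv' : v.1 ∈ gr k (gl k (m + 1)) j := hv
    rw [InducingDatum.op_smul _ hv hA, map_add, map_smul, ofInd_smul, ofInd_smul, key i A hA,
      key _ _ (LieSuper.br_mem (k := k) hA hv'), act_act_eq hA hv', sgn_comm]

/-- The composite is a homomorphism that fixes the highest weight vector. A left inverse of `toInd`
suffices to bring generation and the homotopy back to M. -/
theorem ofInd_toInd (t : MM) : ofInd k b u (toInd k b u t) = t := by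
  refine IndVerma.mem_of_act_mem _ u
    (LinearMap.eqLocus ((ofInd k b u).comp (toInd k b u)) LinearMap.id) ?_ ?_ t
  · change ofInd k b u (toInd k b u _) = _
    rw [toInd_gen, ofInd_tmul, map_one, emb_gen]
    rfl
  · intro i A _ t ht
    have ht' : ofInd k b u (toInd k b u t) = t := ht
    change ofInd k b u (toInd k b u _) = act k MM A t
    rw [toInd_act, ofInd_op, ht']

/-- A subspace of the Verma module that contains the image of `emb` and is stable under the
strictly block lower triangular matrices is everything. -/
theorem mem_of_lower_mem (T : Submodule k MM) (h1 : ∀ n, emb k b u n ∈ T)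
    (hm : ∀ i, ∀ v ∈ (lowerSub k m).toSubmodule, v ∈ gr k (gl k (m + 1)) i → ∀ t ∈ T,
      act k MM v t ∈ T) (t : MM) : t ∈ T := by
  have h := IndSpace.mem_of_smul_mem (T.comap (ofInd k b u))
    (fun n => by
      change ofInd k b u _ ∈ T
      rw [ofInd_tmul, map_one]
      exact h1 n)
    (fun i v hv t ht => by
      change ofInd k b u _ ∈ T
      rw [ofInd_smul]
      exact hm i v.1 v.2 hv _ ht) (toInd k b u t)
  have h2 : ofInd k b u (toInd k b u t) ∈ T := h
  rwa [ofInd_toInd] at h2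

/-- Both highest weight vectors are even and the inclusion of 𝔤𝔩(J) preserves parity, so the two
sides agree on generators and obey the same sign rule. -/
theorem pinv_emb (n : NN) : pinv k MM (emb k b u n) = emb k b u (pinv k NN n) := by
  refine IndVerma.mem_of_act_mem b (prJ u)
    (LinearMap.eqLocus ((pinv k MM).comp (emb k b u)) ((emb k b u).comp (pinv k NN))) ?_ ?_ n
  · change pinv k MM (emb k b u _) = emb k b u (pinv k NN _)
    rw [pinv_zero (IndVerma.gen_mem b (prJ u)), emb_gen, pinv_zero (IndVerma.gen_mem _ u)]
  · intro i A hA n hn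
    have hn' : pinv k MM (emb k b u n) = emb k b u (pinv k NN n) := hn
    change pinv k MM (emb k b u _) = emb k b u (pinv k NN _)
    rw [emb_act, pinv_act (embJ_mem hA), hn', pinv_act hA, map_smul, emb_act]

theorem emb_mem {i : ZMod 2} {n : NN} (hn : n ∈ gr k NN i) : emb k b u n ∈ gr k MM i :=
  mem_gr_of_pinv (by rw [pinv_emb, pinv_gr hn, map_smul])

end comparison

/-! ### The 𝔤𝔩(1|1)-triple x, y, h and its brackets with S -/

section rootVectors

variable (k : Type*) [Field k] (m : ℕ)

/-- The root vector `e_{n+1,1}` of the root `δ_1 - ε_1`. -/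
def negVec : gl k (m + 1) := Matrix.single (Sum.inr 0) (Sum.inl 0) 1

/-- The coroot `[e_{1,n+1}, e_{n+1,1}] = e_{11} + e_{n+1,n+1}`. -/
def corootVec : gl k (m + 1) :=
  Matrix.single (Sum.inl 0) (Sum.inl 0) 1 + Matrix.single (Sum.inr 0) (Sum.inr 0) 1

variable {k m}

theorem negVec_odd : negVec k m ∈ gr k (gl k (m + 1)) 1 := by
  intro a c h
  refine Matrix.single_apply_of_ne _ _ _ _ _ ?_
  rintro ⟨rfl, rfl⟩
  exact h (by simp [ipar])

theorem corootVec_apply (a c : Ix (m + 1)) :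
    corootVec k m a c = if a = c ∧ rk a < 2 then 1 else 0 := by
  rw [corootVec, Matrix.add_apply, Matrix.single_apply, Matrix.single_apply]
  rcases ix_cases a with rfl | rfl | ⟨p, rfl⟩ <;>
    rcases ix_cases c with rfl | rfl | ⟨q, rfl⟩ <;>
    simp [(up_ne_inl _).symm, (up_ne_inr _).symm]

theorem corootVec_even : corootVec k m ∈ gr k (gl k (m + 1)) 0 := by
  intro a c h
  rw [corootVec_apply, if_neg]
  rintro ⟨rfl, -⟩
  have h2 : ∀ p : ZMod 2, p + p = 0 := by decide
  exact h (h2 _)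

theorem isBlockUpper_corootVec : IsBlockUpper (corootVec k m) := by
  intro a c h
  rw [corootVec_apply, if_neg]
  rintro ⟨rfl, -⟩
  exact h (lt_irrefl _)

theorem blockJ_corootVec : blockJ k m (corootVec k m) = 0 := by
  ext p q
  simp [blockJ_apply, corootVec_apply]

theorem evalI_corootVec (u : Wt (m + 1)) :
    evalI k u (corootVec k m) = ((u (Sum.inl 0) + u (Sum.inr 0) : ℤ) : k) := by
  simp [evalI_apply, corootVec_apply]

theorem isBlockUpper_rootVec : IsBlockUpper (rootVec k m).val := by
  intro a c h
  refine Matrix.single_apply_of_ne _ _ _ _ _ ?_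
  rintro ⟨rfl, rfl⟩
  simp at h

theorem blockJ_rootVec : blockJ k m (rootVec k m).val = 0 := by
  ext p q
  exact Matrix.single_apply_of_ne _ _ _ _ _ fun h => up_ne_inl p h.1.symm

theorem br_rootVec_negVec : br k (rootVec k m).val (negVec k m) = corootVec k m := by
  have h : br k (rootVec k m).val (negVec k m) = _ := superComm_eq (rootVec k m).odd negVec_odd
  rw [h, sgn_one_one]
  simp [rootVec, negVec, corootVec]

theorem br_negVec_negVec : br k (negVec k m) (negVec k m) = 0 := by
  have h : br k (negVec k m) (negVec k m) = _ := superComm_eq negVec_odd negVec_odd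
  rw [h]
  simp [negVec]

theorem br_corootVec_apply (A : gl k (m + 1)) (a c : Ix (m + 1)) :
    br k (corootVec k m) A a c =
      (if rk a < 2 then A a c else 0) - (if rk c < 2 then A a c else 0) := by
  have h : br k (corootVec k m) A = corootVec k m * A - A * corootVec k m := by
    rw [br_eq, oddPart_zero corootVec_even, mul_zero, smul_zero, add_zero]
  rw [h, Matrix.sub_apply, Matrix.mul_apply, Matrix.mul_apply]
  simp [-Fintype.sum_sum_type, corootVec_apply, ite_and]

theorem br_corootVec_negVec : br k (corootVec k m) (negVec k m) = 0 := by
  ext a c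
  rw [br_corootVec_apply, negVec, Matrix.single_apply, Matrix.zero_apply]
  by_cases h : Sum.inr 0 = a ∧ Sum.inl 0 = c
  · obtain ⟨rfl, rfl⟩ := h
    simp
  · simp [h]

theorem br_negVec_embJ (A : gl k m) : br k (negVec k m) (embJ k m A) = 0 := by
  have h1 : ∀ B : gl k m, negVec k m * embJ k m B = 0 := by
    intro B
    ext a c
    simp only [negVec, Matrix.mul_apply, Matrix.single_apply]
    refine Finset.sum_eq_zero fun d _ => ?_
    split_ifs with h
    · rw [← h.2, embJ_of_left _ up_ne_inl, mul_zero]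
    · rw [zero_mul]
  have h2 : ∀ B : gl k m, embJ k m B * negVec k m = 0 := by
    intro B
    ext a c
    simp only [negVec, Matrix.mul_apply, Matrix.single_apply]
    refine Finset.sum_eq_zero fun d _ => ?_
    split_ifs with h
    · rw [← h.1, embJ_of_right _ up_ne_inr, zero_mul]
    · rw [mul_zero]
  obtain ⟨a, ha, c, hc, rfl⟩ := exists_decomp k A
  have e1 : br k (negVec k m) (embJ k m a) = _ := superComm_eq negVec_odd (embJ_mem ha)
  have e2 : br k (negVec k m) (embJ k m c) = _ := superComm_eq negVec_odd (embJ_mem hc)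
  rw [map_add, map_add, e1, e2, h1, h2, h1, h2]
  simp

variable [CharZero k]

theorem negVec_mem_lowerSub : negVec k m ∈ (lowerSub k m).toSubmodule := by
  intro a c h
  refine Matrix.single_apply_of_ne _ _ _ _ _ ?_
  rintro ⟨rfl, rfl⟩
  simp at h

theorem br_corootVec_mem_lowerSub {v : gl k (m + 1)} (hv : v ∈ (lowerSub k m).toSubmodule) :
    br k (corootVec k m) v ∈ (lowerSub k m).toSubmodule := by
  intro a c h
  rw [br_corootVec_apply, hv a c h]
  simp

/-- Rows in J and columns in I have ad h-weight -1, while y has weight 0: this is the source of the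
negative eigenvalues of h on M. -/
theorem br_corootVec_lower {v : gl k (m + 1)} (hv : v ∈ (lowerSub k m).toSubmodule) :
    br k (corootVec k m) v = v (Sum.inr 0) (Sum.inl 0) • negVec k m - v := by
  ext a c
  rw [br_corootVec_apply, Matrix.sub_apply, Matrix.smul_apply, negVec, Matrix.single_apply]
  have := hv a c
  rcases ix_cases a with rfl | rfl | ⟨p, rfl⟩ <;>
    rcases ix_cases c with rfl | rfl | ⟨q, rfl⟩ <;>
    simp_all [(up_ne_inl _).symm, (up_ne_inr _).symm]

/-- Only the y-component of v contributes to [x,v] outside S, namely through [x,y] = h. -/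
theorem br_rootVec_sub_mem_lowerSub {v : gl k (m + 1)} (hv : v ∈ (lowerSub k m).toSubmodule) :
    br k (rootVec k m).val v - v (Sum.inr 0) (Sum.inl 0) • corootVec k m ∈
      (lowerSub k m).toSubmodule := by
  intro a c h
  rw [Matrix.sub_apply, Matrix.smul_apply, br_rootVec, corootVec_apply]
  have h1 := hv (Sum.inr 0) c
  have h2 := hv a (Sum.inl 0)
  rcases ix_cases a with rfl | rfl | ⟨p, rfl⟩ <;>
    rcases ix_cases c with rfl | rfl | ⟨q, rfl⟩ <;>
    simp_all [(up_ne_inl _).symm, (up_ne_inr _).symm, up_ne_inl, up_ne_inr, ipar, sgn_one_one]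

end rootVectors

/-! ### The homotopy given by right multiplication by y -/

section typical

variable {k : Type*} [Field k] [CharZero k] {m : ℕ} (N : Type*) [AddCommGroup N] [Module k N]

local notation "XX" => IndSpace (lowerSub k m) N

variable (k m) in
/-- Right multiplication by `e_{n+1,1}` on `U(S) ⊗ N`, with the Koszul sign. -/
noncomputable def rightMul : XX →ₗ[k] XX :=
  IndSpace.lift (IndSpace.tmul.comp ((LinearMap.mulRight k
    (UEA.ι k (lowerSub k m).toSubmodule ⟨negVec k m, negVec_mem_lowerSub⟩)).comp UEA.parity.toLinearMap))

theorem rightMul_tmul (z : UEA k (lowerSub k m).toSubmodule) (n : N) :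
    rightMul k m N (IndSpace.tmul z n) = IndSpace.tmul (UEA.parity z *
      UEA.ι k (lowerSub k m).toSubmodule ⟨negVec k m, negVec_mem_lowerSub⟩) n := rfl

theorem rightMul_one_tmul (n : N) :
    rightMul k m N (IndSpace.tmul 1 n) =
      UEA.ι k (lowerSub k m).toSubmodule ⟨negVec k m, negVec_mem_lowerSub⟩ • IndSpace.tmul 1 n := by
  rw [rightMul_tmul, map_one, one_mul, IndSpace.smul_tmul, mul_one]

variable {N}

/-- Left and right multiplications commute; the parity automorphism in `rightMul` supplies the sign
of an odd operator. -/
theorem rightMul_smul {i : ZMod 2} {v : (lowerSub k m).toSubmodule}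
    (hv : v ∈ gr k (lowerSub k m).toSubmodule i) (t : XX) :
    rightMul k m N (UEA.ι k _ v • t) = sgn k 1 i • UEA.ι k _ v • rightMul k m N t := by
  induction t using IndSpace.induction with
  | h0 => simp
  | h2 a b ha hb => rw [smul_add, map_add, map_add, ha, hb, smul_add, smul_add]
  | h1 z n =>
    rw [IndSpace.smul_tmul, rightMul_tmul, rightMul_tmul, map_mul UEA.parity, UEA.parity_ι, pinv_gr hv,
      map_smul, smul_mul_assoc, smul_mul_assoc, map_smul, LinearMap.smul_apply, IndSpace.smul_tmul,
      mul_assoc]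

variable (u : Wt (m + 1)) [SuperSpace k N] [LieSuperRep k (gl k m) N]

local notation "DD" => inducingDatum u N

theorem rightMul_op_lower {i : ZMod 2} {v : gl k (m + 1)} (hv : v ∈ (lowerSub k m).toSubmodule)
    (hvi : v ∈ gr k (gl k (m + 1)) i) (t : XX) :
    rightMul k m N ((DD).op v t) = sgn k 1 i • (DD).op v (rightMul k m N t) := by
  have h := fun t => (DD).op_coe ⟨v, hv⟩ t
  dsimp only at h
  rw [h, h]
  exact rightMul_smul (v := ⟨v, hv⟩) hvi t

theorem op_corootVec_one_tmul (n : N) : (DD).op (corootVec k m) (IndSpace.tmul 1 n) =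
    ((u (Sum.inl 0) + u (Sum.inr 0) : ℤ) : k) • IndSpace.tmul 1 n := by
  have h : (DD).proj (corootVec k m) = 0 := lowerProj_eq_zero.2 isBlockUpper_corootVec
  rw [InducingDatum.op_one_tmul, h, inducingDatum_rho, blockJ_corootVec, evalI_corootVec]
  simp

theorem op_rootVec_one_tmul (n : N) : (DD).op (rootVec k m).val (IndSpace.tmul 1 n) = 0 := by
  have h : (DD).proj (rootVec k m).val = 0 := lowerProj_eq_zero.2 isBlockUpper_rootVec
  rw [InducingDatum.op_one_tmul, h, inducingDatum_rho, blockJ_rootVec,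
    evalI_odd u (rootVec k m).odd]
  simp

/-- On 1 ⊗ N this holds since [h,y] = 0 and h is a scalar there; it spreads because ad h preserves
S. -/
theorem rightMul_op_corootVec (t : XX) : rightMul k m N ((DD).op (corootVec k m) t) =
    (DD).op (corootVec k m) (rightMul k m N t) := by
  refine IndSpace.mem_of_smul_mem (LinearMap.eqLocus ((rightMul k m N).comp
    ((DD).op (corootVec k m))) (((DD).op (corootVec k m)).comp (rightMul k m N))) ?_ ?_ t
  · intro n
    change rightMul k m N ((DD).op (corootVec k m) _) = (DD).op (corootVec k m) (rightMul k m N _)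
    rw [op_corootVec_one_tmul, map_smul, rightMul_one_tmul,
      (DD).op_smul (i := 1) negVec_odd corootVec_even, br_corootVec_negVec, map_zero,
      LinearMap.zero_apply, add_zero, op_corootVec_one_tmul, sgn_zero_right, one_smul, smul_comm]
  · intro i v hv t ht
    have ht' : rightMul k m N ((DD).op (corootVec k m) t) =
      (DD).op (corootVec k m) (rightMul k m N t) := ht
    change rightMul k m N ((DD).op (corootVec k m) _) = (DD).op (corootVec k m) (rightMul k m N _)
    have h1 := br_corootVec_mem_lowerSub v.2
    have h2 : br k (corootVec k m) v.1 ∈ gr k (gl k (m + 1)) (0 + i) :=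
      LieSuper.br_mem (k := k) corootVec_even hv
    rw [zero_add] at h2
    rw [(DD).op_smul hv corootVec_even, sgn_zero_right, one_smul, map_add, rightMul_smul hv, ht',
      rightMul_op_lower u h1 h2, rightMul_smul hv, map_smul, (DD).op_smul hv corootVec_even,
      sgn_zero_right, one_smul, smul_add]

/-- On 1 ⊗ n, x kills the vector and xy gives h, that is, c. The anticommutator of x and right
multiplication then commutes with S, so the scalar persists. -/
theorem op_rightMul_add (t : XX) : (DD).op (rootVec k m).val (rightMul k m N t) +
    rightMul k m N ((DD).op (rootVec k m).val t) =
      ((u (Sum.inl 0) + u (Sum.inr 0) : ℤ) : k) • t := by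
  refine IndSpace.mem_of_smul_mem (LinearMap.eqLocus
    (((DD).op (rootVec k m).val).comp (rightMul k m N) + (rightMul k m N).comp
      ((DD).op (rootVec k m).val))
    (((u (Sum.inl 0) + u (Sum.inr 0) : ℤ) : k) • LinearMap.id)) ?_ ?_ t
  · intro n
    change (DD).op (rootVec k m).val (rightMul k m N (IndSpace.tmul 1 n)) +
      rightMul k m N ((DD).op (rootVec k m).val (IndSpace.tmul 1 n)) =
        ((u (Sum.inl 0) + u (Sum.inr 0) : ℤ) : k) • IndSpace.tmul 1 n
    rw [op_rootVec_one_tmul, map_zero, add_zero, rightMul_one_tmul,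
      (DD).op_smul (i := 1) negVec_odd (rootVec k m).odd, op_rootVec_one_tmul, smul_zero, smul_zero,
      zero_add, br_rootVec_negVec, op_corootVec_one_tmul]
  · intro i v hv t ht
    have ht' : (DD).op (rootVec k m).val (rightMul k m N t) +
      rightMul k m N ((DD).op (rootVec k m).val t) =
        ((u (Sum.inl 0) + u (Sum.inr 0) : ℤ) : k) • t := ht
    change (DD).op (rootVec k m).val (rightMul k m N (UEA.ι k _ v • t)) +
      rightMul k m N ((DD).op (rootVec k m).val (UEA.ι k _ v • t)) =
        ((u (Sum.inl 0) + u (Sum.inr 0) : ℤ) : k) • UEA.ι k _ v • t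
    -- Since [x,v] lies in S + kh, right multiplication by y supercommutes with it. For even v the
    -- h-component is absent, because y is odd.
    have key : rightMul k m N ((DD).op (br k (rootVec k m).val v.1) t) =
        -(sgn k 1 i • (DD).op (br k (rootVec k m).val v.1) (rightMul k m N t)) := by
      have hv' : v.1 ∈ gr k (gl k (m + 1)) i := hv
      have h1 := br_rootVec_sub_mem_lowerSub v.2
      have h2 : br k (rootVec k m).val v.1 ∈ gr k (gl k (m + 1)) (1 + i) :=
        LieSuper.br_mem (k := k) (rootVec k m).odd hv'
      rcases zmod_two_cases i with rfl | rfl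
      · have h3 : v.1 (Sum.inr 0) (Sum.inl 0) = 0 := hv' _ _ (by simp [ipar])
        rw [h3, zero_smul, sub_zero] at h1
        rw [rightMul_op_lower u h1 h2, add_zero, sgn_one_one, sgn_zero_right]
        simp
      · have h3 : br k (rootVec k m).val v.1 - v.1 (Sum.inr 0) (Sum.inl 0) • corootVec k m ∈
            gr k (gl k (m + 1)) 0 :=
          Submodule.sub_mem _ h2 (Submodule.smul_mem _ _ corootVec_even)
        have h4 := rightMul_op_lower u h1 h3 t
        rw [sgn_zero_right, one_smul, map_sub, map_smul, LinearMap.sub_apply, LinearMap.smul_apply,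
          LinearMap.sub_apply, LinearMap.smul_apply, map_sub, map_smul, rightMul_op_corootVec,
          sub_left_inj] at h4
        rw [h4, sgn_one_one]
        simp
    rw [rightMul_smul hv, map_smul, (DD).op_smul hv (rootVec k m).odd,
      (DD).op_smul hv (rootVec k m).odd, map_add, map_smul, rightMul_smul hv, key, sgn_comm i 1,
      smul_comm _ (UEA.ι k _ v) t, ← ht', smul_add, smul_add, smul_smul, smul_smul, sgn_mul_self,
      one_smul, one_smul]
    abel

end typical

/-! ### The homology of x on M -/

section fiber

variable {k : Type*} [Field k] [CharZero k] {m : ℕ}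

variable (k m) in
/-- The coefficient of `e_{n+1,1}`, as a map to the dual numbers. -/
noncomputable def epsCoeff : UEA k (lowerSub k m).toSubmodule →ₐ[k] DualNumber k :=
  UEA.lift
    ((TrivSqZeroExt.inrHom k k).comp ((Matrix.entryLinearMap k k (Sum.inr 0) (Sum.inl 0)).comp
      (lowerSub k m).toSubmodule.subtype))
    (by
      rintro i j ⟨v, hv⟩ ⟨w, hw⟩ _ _
      -- No block lies strictly between 1 and n+1, so products in S have no y-component. In the dual
      -- numbers the products vanish too, so the relations hold whatever the sign.
      have h0 : ∀ {v w : gl k (m + 1)}, v ∈ (lowerSub k m).toSubmodule →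
          w ∈ (lowerSub k m).toSubmodule → (v * w) (Sum.inr 0) (Sum.inl 0) = 0 := by
        intro v w hv hw
        rw [Matrix.mul_apply]
        refine Finset.sum_eq_zero fun d _ => ?_
        by_cases h : rk d < 1
        · rw [hw d _ (by simp at h ⊢; exact h), mul_zero]
        · rw [hv _ d (by simp at h ⊢; omega), zero_mul]
      have h1 : (br k v w) (Sum.inr 0) (Sum.inl 0) = 0 := by
        rw [br_eq, Matrix.add_apply, Matrix.sub_apply, Matrix.smul_apply, h0 hv hw, h0 hw hv,
          h0 (SupportedOn.oddPart hw) (SupportedOn.oddPart hv)]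
        simp
      change TrivSqZeroExt.inr (br k v w (Sum.inr 0) (Sum.inl 0)) = _
      rw [h1]
      simp)

theorem epsCoeff_negVec : epsCoeff k m (UEA.ι k _ ⟨negVec k m, negVec_mem_lowerSub⟩) =
    TrivSqZeroExt.inr 1 := by
  rw [epsCoeff, UEA.lift_ι]
  simp [negVec]

/-- `1` and `e_{n+1,1}` are independent over `N` in `U(S) ⊗ N`. -/
theorem tmul_add_smul_eq_zero {N : Type*} [AddCommGroup N] [Module k N] {n n' : N}
    (h : (IndSpace.tmul 1 n + UEA.ι k (lowerSub k m).toSubmodule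
      ⟨negVec k m, negVec_mem_lowerSub⟩ • IndSpace.tmul 1 n' : IndSpace (lowerSub k m) N) = 0) :
    n = 0 ∧ n' = 0 := by
  rw [IndSpace.smul_tmul, mul_one] at h
  have h1 := congrArg (IndSpace.lift ((LinearMap.lsmul k N).comp
    ((TrivSqZeroExt.fstHom k k k).toLinearMap.comp (epsCoeff k m).toLinearMap))) h
  have h2 := congrArg (IndSpace.lift ((LinearMap.lsmul k N).comp
    ((TrivSqZeroExt.sndHom k k).comp (epsCoeff k m).toLinearMap))) h
  rw [map_add, map_zero, IndSpace.lift_tmul, IndSpace.lift_tmul] at h1 h2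
  simp only [LinearMap.comp_apply, AlgHom.toLinearMap_apply, map_one, epsCoeff_negVec] at h1 h2
  simp at h1 h2
  exact ⟨h1, h2⟩

variable (b : BoxPartition m) (u : Wt (m + 1))

local notation "MM" => IndVerma k (BoxPartition.star (BoxPartition.empty 1) b) u
local notation "NN" => IndVerma k b (prJ u)
local notation "DD" => inducingDatum u NN
local notation "xx" => act k MM (OddSqZero.val (rootVec k m))
local notation "hh" => act k MM (corootVec k m)
local notation "yy" => act k MM (negVec k m)
local notation "cc" => ((((u (Sum.inl 0) + u (Sum.inr 0) : ℤ))) : k)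

/-- In the typical case `DS` of the Verma module vanishes. -/
theorem exists_act_rootVec_eq (hc : u (Sum.inl 0) + u (Sum.inr 0) ≠ 0) {t : MM} (ht : xx t = 0) :
    ∃ w, xx w = t := by
  have h := op_rightMul_add u (toInd k b u t)
  rw [← toInd_act, ht, map_zero, map_zero, add_zero] at h
  have h2 := congrArg (ofInd k b u) h
  rw [ofInd_op, map_smul, ofInd_toInd] at h2
  -- On cycles the homotopy identity reads x(Rt) = ct, so Rt divided by c is a preimage.
  refine ⟨(cc)⁻¹ • ofInd k b u (rightMul k m _ (toInd k b u t)), ?_⟩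
  rw [map_smul, h2, inv_smul_smul₀ (Int.cast_ne_zero.2 hc)]

theorem rootVec_emb (n : NN) : xx (emb k b u n) = 0 := by
  rw [act_emb b u isBlockUpper_rootVec, inducingDatum_rho, blockJ_rootVec,
    evalI_odd u (rootVec k m).odd]
  simp

theorem coroot_emb (hc : u (Sum.inl 0) + u (Sum.inr 0) = 0) (n : NN) :
    hh (emb k b u n) = 0 := by
  rw [act_emb b u isBlockUpper_corootVec, inducingDatum_rho, blockJ_corootVec, evalI_corootVec, hc]
  simp

theorem coroot_neg (t : MM) : hh (yy t) = yy (hh t) := by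
  rw [act_act_eq corootVec_even negVec_odd, br_corootVec_negVec, sgn_zero_left]
  simp

theorem root_neg (t : MM) : xx (yy t) = hh t - yy (xx t) := by
  rw [act_act_eq (rootVec k m).odd negVec_odd, br_rootVec_negVec, sgn_one_one, neg_one_smul]
  abel

theorem neg_neg_act (t : MM) : yy (yy t) = 0 := by
  have h := act_act_eq (negVec_odd (k := k) (m := m)) negVec_odd t
  rw [br_negVec_negVec, sgn_one_one, map_zero, LinearMap.zero_apply, add_zero, neg_one_smul,
    eq_neg_iff_add_eq_zero, ← two_smul k] at h
  exact (smul_eq_zero.1 h).resolve_left two_ne_zero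

theorem root_root (t : MM) : xx (xx t) = 0 := by
  have h := act_act_eq (rootVec k m).odd (rootVec k m).odd t
  rw [(rootVec k m).sq, sgn_one_one, map_zero, LinearMap.zero_apply, add_zero, neg_one_smul,
    eq_neg_iff_add_eq_zero, ← two_smul k] at h
  exact (smul_eq_zero.1 h).resolve_left two_ne_zero

/-- Both sides are xyx, because h = xy + yx and x² = 0. -/
theorem coroot_root (t : MM) : hh (xx t) = xx (hh t) := by
  have h1 := root_neg b u (xx t)
  have h2 := congrArg xx (root_neg b u t)
  rw [root_root, map_zero, sub_zero] at h1
  rw [root_root, map_sub] at h2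
  rw [← h1, eq_comm, ← sub_eq_zero, h2]

variable (k) in
/-- The map `N ⊕ N → M` onto the kernel of the coroot. -/
noncomputable def embPair : (NN × NN) →ₗ[k] MM :=
  (emb k b u).coprod ((yy).comp (emb k b u))

theorem embPair_apply (p : NN × NN) : embPair k b u p = emb k b u p.1 + yy (emb k b u p.2) := rfl

/-- In U(S) ⊗ N the pair becomes 1 ⊗ n + y ⊗ n', and `epsCoeff` separates the two terms. -/
theorem embPair_injective : Function.Injective (embPair k b u) := by
  rw [← LinearMap.ker_eq_bot, LinearMap.ker_eq_bot']
  rintro ⟨n, n'⟩ h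
  have h1 := congrArg (toInd k b u) h
  have h2 := fun t => (DD).op_coe ⟨negVec k m, negVec_mem_lowerSub⟩ t
  dsimp only at h2
  rw [embPair_apply, map_add, toInd_act, toInd_emb, toInd_emb, map_zero, h2] at h1
  obtain ⟨rfl, rfl⟩ := tmul_add_smul_eq_zero h1
  rfl

variable (k) in
/-- The sum of the eigenspaces of the coroot for negative integral eigenvalues. -/
noncomputable def negPart : Submodule k MM :=
  ⨆ d : ℕ, Module.End.eigenspace hh (-((d : k) + 1))

theorem coroot_embPair (hc : u (Sum.inl 0) + u (Sum.inr 0) = 0) (p : NN × NN) :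
    hh (embPair k b u p) = 0 := by
  rw [embPair_apply, map_add, coroot_neg, coroot_emb b u hc, coroot_emb b u hc, map_zero, add_zero]

theorem root_embPair (hc : u (Sum.inl 0) + u (Sum.inr 0) = 0) (p : NN × NN) :
    xx (embPair k b u p) = 0 := by
  rw [embPair_apply, map_add, root_neg, rootVec_emb, rootVec_emb, coroot_emb b u hc, map_zero,
    sub_zero, add_zero]

/-- An operator that commutes with the coroot preserves `negPart`. -/
theorem map_mem_negPart {f : Module.End k MM} (hf : ∀ t, hh (f t) = f (hh t)) {t : MM}
    (ht : t ∈ negPart k b u) : f t ∈ negPart k b u := by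
  suffices h : negPart k b u ≤ (negPart k b u).comap f from h ht
  refine iSup_le fun d t ht => ?_
  refine Submodule.mem_iSup_of_mem d ?_
  rw [Module.End.mem_eigenspace_iff] at ht ⊢
  rw [hf, ht, map_smul]

/-- Eigenspaces for distinct eigenvalues are independent, and -(d+1) is nonzero in characteristic 0.
-/
theorem eq_zero_of_mem_negPart {t : MM} (ht : t ∈ negPart k b u) (h : hh t = 0) : t = 0 := by
  have hi := Module.End.eigenspaces_iSupIndep (hh : Module.End k MM)
  refine Submodule.disjoint_def.1 (hi 0) t ?_ ?_
  · rw [Module.End.mem_eigenspace_iff, h, zero_smul]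
  · refine (iSup_le fun d => ?_ : negPart k b u ≤ _) ht
    refine le_iSup₂_of_le (-((d : k) + 1)) ?_ le_rfl
    exact neg_ne_zero.2 (Nat.cast_add_one_ne_zero d)

theorem exists_coroot_eq {t : MM} (ht : t ∈ negPart k b u) :
    ∃ s ∈ negPart k b u, hh s = t := by
  suffices h : negPart k b u ≤ (negPart k b u).map hh from h ht
  refine iSup_le fun d t ht => ?_
  refine ⟨(-((d : k) + 1))⁻¹ • t, Submodule.smul_mem _ _ (Submodule.mem_iSup_of_mem d ht), ?_⟩
  rw [Module.End.mem_eigenspace_iff] at ht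
  rw [map_smul, ht, inv_smul_smul₀ (neg_ne_zero.2 (Nat.cast_add_one_ne_zero d))]

/-- The sum contains N and is stable under S: y commutes with h and preserves N + yN because y² = 0,
while the complementary part of S lowers eigenvalues of h by one. -/
theorem exists_decomp_negPart (hc : u (Sum.inl 0) + u (Sum.inr 0) = 0) (t : MM) :
    ∃ p, ∃ w ∈ negPart k b u, t = embPair k b u p + w := by
  suffices h : t ∈ LinearMap.range (embPair k b u) ⊔ negPart k b u by
    obtain ⟨_, ⟨p, rfl⟩, w, hw, h⟩ := Submodule.mem_sup.1 h
    exact ⟨p, w, hw, h.symm⟩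
  refine mem_of_lower_mem b u (LinearMap.range (embPair k b u) ⊔ negPart k b u) (fun n => Submodule.mem_sup_left ⟨(n, 0), ?_⟩) ?_ t
  · rw [embPair_apply, map_zero, map_zero, add_zero]
  intro _ v hv _ t ht
  obtain ⟨_, ⟨p, rfl⟩, w, hw, rfl⟩ := Submodule.mem_sup.1 ht
  have hy : ∀ t ∈ LinearMap.range (embPair k b u) ⊔ negPart k b u,
      yy t ∈ LinearMap.range (embPair k b u) ⊔ negPart k b u := by
    intro t ht
    obtain ⟨_, ⟨p, rfl⟩, w, hw, rfl⟩ := Submodule.mem_sup.1 ht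
    rw [map_add]
    refine Submodule.add_mem_sup ⟨(0, p.1), ?_⟩ (map_mem_negPart b u (coroot_neg b u) hw)
    rw [embPair_apply, embPair_apply, map_add, neg_neg_act, map_zero, zero_add, add_zero]
  -- Removing the y-component leaves an element of ad h-weight -1.
  set v' := v - v (Sum.inr 0) (Sum.inl 0) • negVec k m with hv'
  have hbr : br k (corootVec k m) v' = -v' := by
    rw [hv', map_sub, map_smul, br_corootVec_negVec, smul_zero, sub_zero, br_corootVec_lower hv]
    abel
  have hcomm : ∀ t, hh (act k MM v' t) = act k MM v' (hh t) - act k MM v' t := by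
    intro t
    have e1 : ∀ w : gl k (m + 1), hh (act k MM w t) =
        act k MM w (hh t) + act k MM (br k (corootVec k m) w) t := by
      intro w
      obtain ⟨a, ha, c, hc, rfl⟩ := exists_decomp k w
      simp only [map_add, LinearMap.add_apply, act_act_eq corootVec_even ha,
        act_act_eq corootVec_even hc, sgn_zero_left, one_smul]
      abel
    rw [e1, hbr, map_neg, LinearMap.neg_apply, sub_eq_add_neg]
  have hvv : v = v (Sum.inr 0) (Sum.inl 0) • negVec k m + v' := by rw [hv']; abel
  have hact : ∀ t, act k MM v t =
      v (Sum.inr 0) (Sum.inl 0) • yy t + act k MM v' t := by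
    intro t
    conv_lhs => rw [hvv]
    simp only [map_add, map_smul, LinearMap.add_apply, LinearMap.smul_apply]
  rw [hact]
  refine Submodule.add_mem _ (Submodule.smul_mem _ _ (hy _ ht)) (Submodule.mem_sup_right ?_)
  rw [map_add]
  -- The index d stands for the eigenvalue -(d+1): v' sends the kernel of h to index 0, and index d
  -- to d+1.
  refine Submodule.add_mem _ (Submodule.mem_iSup_of_mem 0 ?_) ?_
  · rw [Module.End.mem_eigenspace_iff, hcomm, coroot_embPair b u hc, map_zero]
    simp
  · suffices h : negPart k b u ≤ (negPart k b u).comap (act k MM v') from h hw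
    refine iSup_le fun d t ht => Submodule.mem_iSup_of_mem (d + 1) ?_
    rw [Module.End.mem_eigenspace_iff] at ht ⊢
    rw [hcomm, ht, map_smul]
    push_cast
    module

/-- In the atypical case every cycle is homologous to an element of the image of `embPair`. -/
theorem exists_embPair_eq_add (hc : u (Sum.inl 0) + u (Sum.inr 0) = 0) {t : MM} (ht : xx t = 0) :
    ∃ p w, t = embPair k b u p + xx w := by
  obtain ⟨p, w, hw, rfl⟩ := exists_decomp_negPart b u hc t
  rw [map_add, root_embPair b u hc, zero_add] at ht
  obtain ⟨s, hs, rfl⟩ := exists_coroot_eq b u hw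
  rw [← coroot_root] at ht
  have h := eq_zero_of_mem_negPart b u (map_mem_negPart b u (coroot_root b u) hs) ht
  -- The remaining part of the cycle is hs, and xs = 0 since xs has negative eigenvalues and is
  -- killed by h; thus hs = xys.
  refine ⟨p, yy s, ?_⟩
  rw [root_neg, h, map_zero, sub_zero]

/-- In the atypical case `embPair` is injective modulo boundaries. -/
theorem eq_zero_of_embPair_eq (hc : u (Sum.inl 0) + u (Sum.inr 0) = 0) {p : NN × NN} {w : MM}
    (h : embPair k b u p = xx w) : p = 0 := by
  obtain ⟨q, w, hw, rfl⟩ := exists_decomp_negPart b u hc w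
  rw [map_add, root_embPair b u hc, zero_add] at h
  apply embPair_injective b u
  rw [map_zero, h]
  -- The boundary xw lies in the negative part and, being in N + yN, is killed by h.
  refine eq_zero_of_mem_negPart b u (map_mem_negPart b u (coroot_root b u) hw) ?_
  rw [← h, coroot_embPair b u hc]

end fiber

/-! ### Inverting isomorphisms of supermodules -/

section repEquiv

variable {k L V W : Type*} [Field k] [AddCommGroup L] [Module k L] [LieSuper k L]
  [AddCommGroup V] [Module k V] [SuperSpace k V] [LieSuperRep k L V]
  [AddCommGroup W] [Module k W] [SuperSpace k W] [LieSuperRep k L W]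

/-- The inverse of an isomorphism of supermodules. -/
def RepEquiv.symm (e : RepEquiv k L V W) : RepEquiv k L W V where
  toLinearEquiv := e.toLinearEquiv.symm
  map_gr := by
    intro i w hw
    obtain ⟨v, rfl⟩ := e.toLinearEquiv.surjective w
    rw [LinearEquiv.symm_apply_apply]
    obtain ⟨a, ha, b, hb, rfl⟩ := exists_decomp k v
    have h0 := e.map_gr ha
    have h1 := e.map_gr hb
    rw [map_add] at hw
    rcases zmod_two_cases i with rfl | rfl
    · have h2 := (gr k W 0).sub_mem hw h0
      rw [add_sub_cancel_left] at h2
      have h3 := Submodule.disjoint_def.1 (isCompl_gr (k := k) (V := W)).disjoint _ h2 h1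
      rw [(LinearEquiv.map_eq_zero_iff _).1 h3, add_zero]
      exact ha
    · have h2 := (gr k W 1).sub_mem hw h1
      rw [add_sub_cancel_right] at h2
      have h3 := Submodule.disjoint_def.1 (isCompl_gr (k := k) (V := W)).disjoint _ h0 h2
      rw [(LinearEquiv.map_eq_zero_iff _).1 h3, zero_add]
      exact hb
  map_act := by
    intro x w
    apply e.toLinearEquiv.injective
    rw [e.map_act, LinearEquiv.apply_symm_apply, LinearEquiv.apply_symm_apply]

end repEquiv

/-! ### The isomorphism of N ⊕ ΠN with the homology, and parity bookkeeping -/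

section main

variable {k : Type*} [Field k] [CharZero k] {m : ℕ} (b : BoxPartition m) (u : Wt (m + 1))

local notation "MM" => IndVerma k (BoxPartition.star (BoxPartition.empty 1) b) u
local notation "NN" => IndVerma k b (prJ u)

variable (k) in
/-- The map `(n, n') ↦ n + (-1)^{|n'|} e_{n+1,1} n'` into the cycles. -/
noncomputable def cycleMap (hc : u (Sum.inl 0) + u (Sum.inr 0) = 0) (p : ZMod 2) :
    (NN × NN) →ₗ[k] DS (rootVec k m) (PShift p MM) :=
  (DS.mk (rootVec k m) (PShift p MM)).comp <|
    ((embPair k b u).comp (LinearMap.id.prodMap (pinv k NN))).codRestrict _ fun _ =>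
      root_embPair b u hc _

theorem cycleMap_bijective (hc : u (Sum.inl 0) + u (Sum.inr 0) = 0) (p : ZMod 2) :
    Function.Bijective (cycleMap k b u hc p) := by
  constructor
  · rw [← LinearMap.ker_eq_bot, LinearMap.ker_eq_bot']
    rintro ⟨n, n'⟩ h
    obtain ⟨w, hw⟩ := (DS.mk_eq_zero _ _).1 h
    have h2 := eq_zero_of_embPair_eq b u hc (Eq.symm hw)
    have h3 : n = 0 := congrArg Prod.fst h2
    have h4 : pinv k NN n' = 0 := congrArg Prod.snd h2
    rw [h3, ← pinv_pinv (k := k) n', h4, map_zero]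
    rfl
  · intro v
    obtain ⟨⟨t, ht⟩, rfl⟩ := DS.mk_surjective _ v
    obtain ⟨⟨n, n'⟩, w, h⟩ := exists_embPair_eq_add b u hc (t := t) ht
    subst h
    refine ⟨(n, pinv k NN n'), ?_⟩
    refine eq_of_sub_eq_zero ((map_sub (DS.mk (rootVec k m) (PShift p MM)) _ _).symm.trans ?_)
    refine (DS.mk_eq_zero _ _).2 ⟨-w, ?_⟩
    change act k MM (rootVec k m).val (-w) = embPair k b u (n, pinv k NN (pinv k NN n')) -
      (embPair k b u (n, n') + act k MM (rootVec k m).val w)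
    rw [pinv_pinv, map_neg]
    abel

theorem cycleMap_mem (hc : u (Sum.inl 0) + u (Sum.inr 0) = 0) (p : ZMod 2) {i : ZMod 2} {n n' : NN}
    (hn : n ∈ gr k NN (i + p)) (hn' : n' ∈ gr k NN (i + 1 + p)) :
    cycleMap k b u hc p (n, n') ∈ gr k (DS (rootVec k m) (PShift p MM)) i := by
  refine ⟨_, ?_, rfl⟩
  change embPair k b u (n, pinv k NN n') ∈ gr k MM (i + p)
  rw [embPair_apply]
  refine Submodule.add_mem _ (emb_mem b u hn) ?_
  have h := LieSuperRep.act_mem (k := k) (L := gl k (m + 1)) (V := MM) negVec_odd (emb_mem b u (pinv_mem_gr hn'))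
  have e : ∀ i p : ZMod 2, 1 + (i + 1 + p) = i + p := by decide
  rwa [e] at h

/-- The signs from moving A past y and past the parity involution cancel. This is the purpose of the
involution in `cycleMap`, as `PShift` leaves the action unsigned. -/
theorem cycleMap_act (hc : u (Sum.inl 0) + u (Sum.inr 0) = 0) (p : ZMod 2) (A : gl k m)
    (n n' : NN) : cycleMap k b u hc p (act k NN A n, act k NN A n') =
      act k (DSroot k m (PShift p MM)) A (cycleMap k b u hc p (n, n')) := by
  have hom : ∀ i, ∀ A ∈ gr k (gl k m) i, embPair k b u (act k NN A n, pinv k NN (act k NN A n')) =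
      act k MM (embJ k m A) (embPair k b u (n, pinv k NN n')) := by
    intro i A hA
    have h := act_act_eq negVec_odd (embJ_mem hA) (emb k b u (pinv k NN n'))
    rw [br_negVec_embJ, map_zero, LinearMap.zero_apply, add_zero] at h
    rw [embPair_apply, embPair_apply, map_add, emb_act, pinv_act hA, map_smul, map_smul, emb_act, h,
      smul_smul, sgn_mul_self, one_smul]
  refine congrArg (DS.mk (rootVec k m) (PShift p MM)) (Subtype.ext ?_)
  change embPair k b u (act k NN A n, pinv k NN (act k NN A n')) =
    act k MM (embJ k m A) (embPair k b u (n, pinv k NN n'))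
  obtain ⟨a, ha, c, hc, rfl⟩ := exists_decomp k A
  have e : embPair k b u (act k NN (a + c) n, pinv k NN (act k NN (a + c) n')) =
      embPair k b u (act k NN a n, pinv k NN (act k NN a n')) +
        embPair k b u (act k NN c n, pinv k NN (act k NN c n')) := by
    rw [← map_add, Prod.mk_add_mk, ← map_add, map_add (act k NN), LinearMap.add_apply,
      LinearMap.add_apply]
  rw [e, hom 0 a ha, hom 1 c hc, ← LinearMap.add_apply, ← map_add, ← map_add]

theorem nonempty_repEquiv_DSroot (par : ParityChoice (m + 1)) (par' : ParityChoice m)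
    (hc : u (Sum.inl 0) + u (Sum.inr 0) = 0) :
    Nonempty (RepEquiv k (gl k m)
      (DSroot k m (Verma k par ((BoxPartition.empty 1).star b) u))
      (Verma k par' b (prJ u) × PShift 1 (Verma k par' b (prJ u)))) := by
  let e : (NN × NN) ≃ₗ[k] DS (rootVec k m) (PShift (par.par u) MM) :=
    LinearEquiv.ofBijective _ (cycleMap_bijective b u hc (par.par u))
  by_cases hp : par.par u = par'.par (prJ u)
  · refine ⟨RepEquiv.symm { toLinearEquiv := e, map_gr := ?_, map_act := ?_ }⟩
    · rintro i ⟨n, n'⟩ ⟨hn, hn'⟩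
      refine cycleMap_mem b u hc _ ?_ ?_
      · rw [hp]; exact hn
      · rw [hp]; exact hn'
    · rintro A ⟨n, n'⟩
      exact cycleMap_act b u hc _ A n n'
  · have hp' : par.par u = 1 + par'.par (prJ u) := by
      have h : ∀ p q : ZMod 2, p ≠ q → p = 1 + q := by decide
      exact h _ _ hp
    -- The parity functions of the two ranks may differ at λ and pr_J(λ). The discrepancy is one
    -- application of Π, absorbed by exchanging the summands.
    let e' := (LinearEquiv.prodComm k NN NN).trans e
    refine ⟨RepEquiv.symm { toLinearEquiv := e', map_gr := ?_, map_act := ?_ }⟩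
    · rintro i ⟨n, n'⟩ ⟨hn, hn'⟩
      refine cycleMap_mem b u hc _ ?_ ?_
      · rw [hp', ← add_assoc]; exact hn'
      · have h : ∀ i q : ZMod 2, i + 1 + (1 + q) = i + q := by decide
        rw [hp', h]; exact hn
    · rintro A ⟨n, n'⟩
      exact cycleMap_act b u hc _ A n' n

theorem subsingleton_DSroot (par : ParityChoice (m + 1)) (hc : u (Sum.inl 0) + u (Sum.inr 0) ≠ 0) :
    Subsingleton (DSroot k m (Verma k par ((BoxPartition.empty 1).star b) u)) := by
  refine subsingleton_of_forall_eq 0 fun v => ?_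
  obtain ⟨⟨t, ht⟩, rfl⟩ := DS.mk_surjective (rootVec k m) v
  exact (DS.mk_eq_zero _ _).2 (exists_act_rootVec_eq b u hc ht)

end main
end GLSuper

open GLSuper
theorem mainTheorem2 {k : Type*} [Field k] [IsAlgClosed k] [CharZero k] (m : ℕ)
    (par : ParityChoice (m + 1)) (par' : ParityChoice m) :
    (∀ (b : BoxPartition m) (u : Wt (m + 1)),
      ((BoxPartition.empty 1).IsAtypical (prI u) →
        Nonempty (RepEquiv k (gl k m)
          (DSroot k m (Verma k par ((BoxPartition.empty 1).star b) u))
          (Verma k par' b (prJ u) × PShift 1 (Verma k par' b (prJ u))))) ∧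
      (¬ (BoxPartition.empty 1).IsAtypical (prI u) →
        Subsingleton (DSroot k m (Verma k par ((BoxPartition.empty 1).star b) u)))) ∧
    (∀ u : Wt (m + 1),
      ((BoxPartition.empty 1).IsAtypical (prI u) →
        Nonempty (RepEquiv k (gl k m)
          (DSroot k m (Verma k par (BoxPartition.bo (m + 1)) u))
          (Verma k par' (BoxPartition.bo m) (prJ u) ×
            PShift 1 (Verma k par' (BoxPartition.bo m) (prJ u))))) ∧
      (¬ (BoxPartition.empty 1).IsAtypical (prI u) →
        Subsingleton (DSroot k m (Verma k par (BoxPartition.bo (m + 1)) u)))) ∧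
    (∀ b : BoxPartition m,
      ((BoxPartition.empty 1).star b).IsSimpleRoot (Sum.inl 0) (Sum.inr 0) ∧
      dsBorel k ((BoxPartition.empty 1).star b) = b.borel k) ∧
    (∀ u : Wt (m + 1), (BoxPartition.empty 1).IsAtypical (prI u) ↔
      form u.toRat (root (Sum.inl 0) (Sum.inr 0)).toRat = 0) := by
  have main : ∀ (b : BoxPartition m) (u : Wt (m + 1)),
      ((BoxPartition.empty 1).IsAtypical (prI u) →
        Nonempty (RepEquiv k (gl k m)
          (DSroot k m (Verma k par ((BoxPartition.empty 1).star b) u))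
          (Verma k par' b (prJ u) × PShift 1 (Verma k par' b (prJ u))))) ∧
      (¬ (BoxPartition.empty 1).IsAtypical (prI u) →
        Subsingleton (DSroot k m (Verma k par ((BoxPartition.empty 1).star b) u))) := by
    intro b u
    rw [BoxPartition.isAtypical_prI]
    exact ⟨nonempty_repEquiv_DSroot b u par par', subsingleton_DSroot b u par⟩
  refine ⟨main, fun u => ?_, fun b => ⟨BoxPartition.star_isSimpleRoot b,
    BoxPartition.dsBorel_star b k⟩, fun u => ?_⟩
  -- Adding 1 to each part of the staircase and appending 0 gives the next staircase, so this is a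
  -- case of the general statement.
  · rw [← BoxPartition.star_empty_bo]
    exact main _ u
  · rw [BoxPartition.isAtypical_prI, BoxPartition.form_toRat_root]
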